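/- **Setting.** Let $\mathcal Q\subset\mathbb R^2$ be a square of area $\mathcal A>0$, and let $v_{\max},u_{\max}>0$. A team of $m$ double-integrator robots moves in the plane; each has a position $x(t)$ and a velocity $v(t)$ with $\dot x=v$, $\dot v=u$, $\|v\|\le v_{\max}$, $\|u\|\le u_{\max}$. Service requests are generated by a spatio-temporal Poisson process of time intensity $\lambda>0$ with uniform spatial density on $\mathcal Q$; a request is fulfilled when one of the robots is at its location. A policy $\pi$ determines the motions of all robots, the motion up to time $t$ depending only on the requests generated up to time $t$. If $T_j$ is the time elapsed between the generation of the $j$-th request and its fulfilment, the coverage cost of $\pi$ is $T_\pi=\lim_{j\to\infty}\lim_{\lambda\to0^+}\mathrm E[T_j]$ (for the policies for which these limits exist), and $T^{\mathrm{DI}}_{\mathrm{opt}}=T^{\mathrm{DI}}_{\mathrm{opt}}(m)$ is the infimum of $T_\pi$ over all policies for $m$ robots. **The Strip Loitering algorithm.** Put $$v^*=\min\Big\{v_{\max},\tfrac{\sqrt{\sqrt{\mathcal A}\,u_{\max}}}{3.22}\Big\},\qquad \rho^*=\frac{{v^*}^2}{u_{\max}},\qquad w=\min\Big\{\Big(\frac{4}{3\sqrt{\rho^*}}\,\frac{\mathcal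 A+10.38\,\rho^*\sqrt{\mathcal A}}{m}\Big)^{2/3},\,2\rho^*\Big\}.$$ Cover $\mathcal Q$ from top to bottom by $\lceil\sqrt{\mathcal A}/w\rceil$ horizontal strips of width $w$. The loitering path is the closed path of turning radius at least $\rho^*$ that runs along the longitudinal bisectors of the strips from top to bottom, in alternating directions, each run extending beyond $\mathcal Q$ by $\rho^*$ at both ends; consecutive runs are joined by U-turns made of three arcs of radius $\rho^*$ (away from the next strip, by an angle $\alpha=\arccos(\tfrac12+\tfrac{w}{4\rho^*})$; towards it, by $\pi+2\alpha$; back, by $\alpha$), and the end of the last run is joined to the beginning of the first run by line segments and arcs of radius $\rho^*$ that pass beside $\mathcal Q$ (beside and above $\mathcal Q$, with a half turn into the first strip, if the number of strips is odd). All robots always move with constant speed $v^*$, and in the absence of requests they move along this path, equally spaced in terms of path length. A target is served along the circular arc of radius $\rho^*$ that departs tangentially from the bisector of the strip containing the target and ends at the target. The robot responsible for it is the one that, at the time the request appears, has the smallest distance $d_1$ to the point of departure along the path in the direction of motion; it follows the path to that point and then the arc, while the others continue to loiter. Within a bounded time (provided that no other request appears in the meantime) the responsible robot is back at its place in the loitering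 pattern. When requests appear in quicker succession, the order of service is arbitrary, except that the waiting time of the $j$-th request is at most a constant (which may depend on the policy) times $j$. **Theorem.** For every $m\ge1$ there is a policy for $m$ double-integrator robots that implements the Strip Loitering algorithm. For every choice of such policies, one for each $m$, the coverage cost $T^{\mathrm{DI}}_{\mathrm{SL}}=T^{\mathrm{DI}}_{\mathrm{SL}}(m)$ exists and satisfies $$\limsup_{m\to+\infty}T^{\mathrm{DI}}_{\mathrm{SL}}\,m^{1/3}\le\frac{1.238}{v^*}\big(\rho^*\mathcal A+10.38\,{\rho^*}^2\sqrt{\mathcal A}\big)^{1/3}.$$ Moreover $T^{\mathrm{DI}}_{\mathrm{opt}}=\Theta(m^{-1/3})$ as $m\to+\infty$, for fixed $\mathcal A,v_{\max},u_{\max}$. -/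

import Mathlib

open MeasureTheory ProbabilityTheory Filter Topology
open scoped ENNReal

noncomputable section

namespace StripLoitering

/-- The Euclidean plane. -/
abbrev Plane := EuclideanSpace ℝ (Fin 2)

/-- The data of the problem: the area of the square environment, and the bounds on the speed and
on the acceleration of the double-integrator robots. -/
structure Setting where
  area : ℝ
  vmax : ℝ
  umax : ℝ
  area_pos : 0 < area
  vmax_pos : 0 < vmax
  umax_pos : 0 < umax

namespace Setting

variable (E : Setting)

/-- The side of the square environment. -/
def side : ℝ := √E.area

/-- The environment, a square of the given area with sides along the coordinate axes. -/
def square : Set Plane := {p | ∀ i, 0 ≤ p i ∧ p i ≤ E.side}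

/-- The uniform distribution on the environment. -/
def uniformLaw : Measure Plane := volume[|E.square]

end Setting

/-! ### Service requests -/

/-- A sequence of service requests. Its `j`-th term consists of the time elapsed between the
previous request (or time `0`, if `j = 0`) and the `j`-th one, and of the location of the latter. -/
abbrev RequestSeq := ℕ → ℝ × Plane

namespace RequestSeq

/-- The time elapsed between request `j - 1` and request `j`. -/
def gap (ω : RequestSeq) (j : ℕ) : ℝ := (ω j).1

/-- The location of request `j`. -/
def loc (ω : RequestSeq) (j : ℕ) : Plane := (ω j).2

/-- The time at which request `j` is generated. -/
def arrival (ω : RequestSeq) (j : ℕ) : ℝ := ∑ k ∈ Finset.range (j + 1), ω.gap k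

/-- The sequences that occur (with probability one): requests are generated one after the other,
at locations in the environment, finitely many in bounded time. -/
def Proper (E : Setting) (ω : RequestSeq) : Prop :=
  (∀ j, 0 < ω.gap j) ∧ (∀ j, ω.loc j ∈ E.square) ∧ Tendsto ω.arrival atTop atTop

end RequestSeq

/-- The law of the spatio-temporal Poisson process of time intensity `r > 0` with uniform spatial
density: the gaps are independent exponential variables of rate `r`, and the locations are
independent of them and of each other and uniform in the environment. -/
def requestLaw (E : Setting) (r : ℝ) : Measure RequestSeq :=
  Measure.infinitePi fun _ : ℕ => (expMeasure r).prod E.uniformLaw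

/-! ### Double-integrator robots and motion coordination algorithms -/

/-- `x`, on the time interval `[0, ∞)`, is the motion of a double-integrator robot: its velocity
`v` has norm at most `vmax`, and is driven by a measurable control `u` of norm at most `umax`. -/
def IsDIMotion (E : Setting) (x : ℝ → Plane) : Prop :=
  ∃ v u : ℝ → Plane, Measurable u ∧ (∀ t, ‖u t‖ ≤ E.umax) ∧ (∀ t, 0 ≤ t → ‖v t‖ ≤ E.vmax) ∧
    ∀ t, 0 ≤ t → x t = x 0 + ∫ s in (0 : ℝ)..t, v s ∧ v t = v 0 + ∫ s in (0 : ℝ)..t, u s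

/-- A motion coordination algorithm for `m` double-integrator robots. It determines the motions of
all robots from the requests; what it does up to time `t` depends only on the requests that were
generated up to time `t`. -/
structure Policy (E : Setting) (m : ℕ) where
  pos : RequestSeq → Fin m → ℝ → Plane
  measurable : ∀ i t, Measurable fun ω => pos ω i t
  isDIMotion : ∀ ω, ω.Proper E → ∀ i, IsDIMotion E (pos ω i)
  causal : ∀ ω ω' : RequestSeq, ω.Proper E → ω'.Proper E → ∀ t, 0 ≤ t →
    (∀ j, ω.arrival j ≤ t ∨ ω'.arrival j ≤ t → ω j = ω' j) → ∀ i, pos ω i t = pos ω' i t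

namespace Policy

variable {E : Setting} {m : ℕ}

/-- The time elapsed between the generation of request `j` and the first time at which one of the
robots is at its location (infinite if there is no such time). -/
def waitTime (π : Policy E m) (j : ℕ) (ω : RequestSeq) : ℝ≥0∞ :=
  ⨅ (t : ℝ) (_ : ω.arrival j ≤ t ∧ ∃ i, π.pos ω i t = ω.loc j), ENNReal.ofReal (t - ω.arrival j)

/-- The expected waiting time of request `j` when requests have time intensity `r`. -/
def expectedWait (π : Policy E m) (j : ℕ) (r : ℝ) : ℝ≥0∞ :=
  ∫⁻ ω, π.waitTime j ω ∂(requestLaw E r)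

/-- `T` is the coverage cost of the policy: the limit, as `j → ∞`, of the limit, as the intensity
of requests decreases to `0`, of the expected waiting time of request `j`. -/
def HasCoverageCost (π : Policy E m) (T : ℝ≥0∞) : Prop :=
  ∃ τ : ℕ → ℝ≥0∞, (∀ j, Tendsto (π.expectedWait j) (𝓝[>] 0) (𝓝 (τ j))) ∧ Tendsto τ atTop (𝓝 T)

end Policy

/-- The optimal coverage cost of `m` double-integrator robots. -/
def optimalCost (E : Setting) (m : ℕ) : ℝ≥0∞ :=
  sInf {T | ∃ π : Policy E m, π.HasCoverageCost T}

/-! ### Planar paths made of line segments and circular arcs -/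

/-- A position in the plane together with a heading (an angle). -/
structure Pose where
  x : ℝ
  y : ℝ
  heading : ℝ

/-- The position of a pose. -/
def Pose.point (g : Pose) : Plane := !₂[g.x, g.y]

/-- The pose that is reached from `g` by moving forward along a path of constant signed
curvature `κ` (positive for left turns) and length `s`. -/
def Pose.advance (κ : ℝ) (g : Pose) (s : ℝ) : Pose where
  x := g.x + ∫ r in (0 : ℝ)..s, Real.cos (g.heading + κ * r)
  y := g.y + ∫ r in (0 : ℝ)..s, Real.sin (g.heading + κ * r)
  heading := g.heading + κ * s

/-- The pose at arc length `s` on the path that starts at `g` and consists of pieces of given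
signed curvature and length. -/
def Pose.follow : List (ℝ × ℝ) → Pose → ℝ → Pose
  | [], g, _ => g
  | (κ, l) :: rest, g, s =>
    if s ≤ l then g.advance κ s else Pose.follow rest (g.advance κ l) (s - l)

/-! ### The Strip Loitering algorithm -/

namespace Setting

variable (E : Setting) (m : ℕ)

/-- The constant speed of the robots. -/
def speed : ℝ := min E.vmax (√(√E.area * E.umax) / 3.22)

/-- The smallest turning radius at that speed. -/
def radius : ℝ := E.speed ^ 2 / E.umax

/-- The width of the strips. -/
def width : ℝ :=
  min ((4 / (3 * √E.radius) * ((E.area + 10.38 * E.radius * √E.area) / m)) ^ (2 / 3 : ℝ))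
    (2 * E.radius)

/-- The number of horizontal strips of that width that it takes to cover the square. -/
def numStrips : ℕ := ⌈E.side / E.width m⌉₊

/-- The height of the longitudinal bisector of strip `k`; strips are numbered from top to bottom,
starting with `0`, and the first one begins at the upper side of the square. -/
def bisector (k : ℕ) : ℝ := E.side - (k + 1 / 2) * E.width m

/-- The length of the straight run along a strip. It traverses the square and extends beyond it by
one turning radius at both ends. -/
def runLength : ℝ := E.side + 2 * E.radius

/-- The angle of the first and of the last arc of a U-turn. -/
def uTurnAngle : ℝ := Real.arccos (1 / 2 + E.width m / (4 * E.radius))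

/-- The sign of the first and last turn of the U-turn after strip `k`. Strips with even number are
run through from left to right, those with odd number from right to left, so that the next strip is
on the right-hand side in the former case and on the left-hand side in the latter. -/
def turnSign (k : ℕ) : ℝ := if Even k then 1 else -1

/-- The U-turn from strip `k` to the next one, whose bisector is at distance `width ≤ 2 * radius`:
an arc away from the next strip, a long arc towards it, and an arc back into its direction. -/
def uTurn (k : ℕ) : List (ℝ × ℝ) :=
  [(turnSign k / E.radius, E.radius * E.uTurnAngle m),
   (-turnSign k / E.radius, E.radius * (Real.pi + 2 * E.uTurnAngle m)),
   (turnSign k / E.radius, E.radius * E.uTurnAngle m)]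

/-- The length of a U-turn. -/
def uTurnLength : ℝ := E.radius * (Real.pi + 4 * E.uTurnAngle m)

/-- The way back from the end of the last strip to the beginning of the first one. If the number of
strips is even, it goes up on the left of the square; otherwise it goes up on the right, runs back
above the square, and makes a half turn into the first strip. -/
def closure : List (ℝ × ℝ) :=
  if Even (E.numStrips m) then
    [(-1 / E.radius, E.radius * (Real.pi / 2)),
     (0, (E.numStrips m - 1) * E.width m - 2 * E.radius),
     (-1 / E.radius, E.radius * (Real.pi / 2))]
  else
    [(1 / E.radius, E.radius * (Real.pi / 2)),
     (0, (E.numStrips m - 1) * E.width m),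
     (1 / E.radius, E.radius * (Real.pi / 2)),
     (0, E.runLength),
     (1 / E.radius, E.radius * Real.pi)]

/-- The pieces of the closed loitering path: the runs along all strips from top to bottom with
U-turns between them, and the closing piece. -/
def loiterPieces : List (ℝ × ℝ) :=
  (List.range (E.numStrips m)).flatMap
    (fun k => (0, E.runLength) :: if k + 1 < E.numStrips m then E.uTurn m k else [])
  ++ E.closure m

/-- The length of the closed loitering path. -/
def loiterLength : ℝ := ((E.loiterPieces m).map Prod.snd).sum

/-- The pose at which the loitering path begins. -/
def loiterStart : Pose := ⟨-E.radius, E.bisector m 0, 0⟩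

/-- The loitering path, parametrized periodically by arc length. -/
def loiterPose (s : ℝ) : Pose :=
  Pose.follow (E.loiterPieces m) (E.loiterStart m)
    (E.loiterLength m * Int.fract (s / E.loiterLength m))

/-- The place on the loitering path, as an arc length, of robot `i` at time `t`: the robots are
equally spaced and move at constant speed (`c` is the place of robot `0` at time `0`). -/
def place (c : ℝ) (i : Fin m) (t : ℝ) : ℝ := c + E.speed * t + i * (E.loiterLength m / m)

/-- The strip in which the target `q` lies. -/
def stripOf (q : Plane) : ℕ := min ⌊(E.side - q 1) / E.width m⌋₊ (E.numStrips m - 1)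

/-- The distance from the target to the bisector of its strip. -/
def offset (q : Plane) : ℝ := |q 1 - E.bisector m (E.stripOf m q)|

/-- The length of the circular arc, of smallest turning radius, that departs tangentially from the
bisector and ends at the target. -/
def serviceLength (q : Plane) : ℝ :=
  2 * E.radius * Real.arcsin √(E.offset m q / (2 * E.radius))

/-- The point of departure of that arc, as an arc length on the loitering path. -/
def departure (q : Plane) : ℝ :=
  E.stripOf m q * (E.runLength + E.uTurnLength m)
    + (if Even (E.stripOf m q) then q 0 + E.radius else E.side + E.radius - q 0)
    - E.radius * Real.sin (E.serviceLength m q / E.radius)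

/-- The curvature of that arc, which turns left if the target is to the left of the path as the
robots run along it, and right otherwise. -/
def serviceCurvature (q : Plane) : ℝ :=
  turnSign (E.stripOf m q) *
    (if E.bisector m (E.stripOf m q) ≤ q 1 then 1 else -1) / E.radius

/-- The distance, along the loitering path in the direction of motion, from the place of robot `i`
at time `t` to the point of departure for the target `q`. -/
def approachLength (c : ℝ) (i : Fin m) (t : ℝ) (q : Plane) : ℝ :=
  E.loiterLength m * Int.fract ((E.departure m q - E.place m c i t) / E.loiterLength m)

/-- Robot `i` is responsible for a target that appears at `q` at time `t`. -/
def Responsible (c : ℝ) (i : Fin m) (t : ℝ) (q : Plane) : Prop :=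
  ∀ i' : Fin m, E.approachLength m c i t q ≤ E.approachLength m c i' t q

end Setting

/-- The policy implements the Strip Loitering algorithm, for some initial phase `c`, some bound `R`
on the time it takes until, after the appearance of a request (or after time `0`), all robots are
back at their places on the loitering path, and some `K` that bounds waiting times.

How the robot returns to its place, and in which order requests are dealt with that appear less than
`R` apart, is left to the policy. -/
structure IsStripLoiteringWith (E : Setting) (m : ℕ) (π : Policy E m) (c R K : ℝ) : Prop where
  /-- The robots always move at the same constant speed. -/
  constant_speed : ∀ ω : RequestSeq, ω.Proper E → ∀ i t, 0 < t → ‖deriv (π.pos ω i) t‖ = E.speed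
  /-- As long as requests are at least `R` apart, all robots are at their places on the loitering
  path when time `R` has passed since the last request. -/
  loiter : ∀ ω : RequestSeq, ω.Proper E → ∀ t, R ≤ t →
    (∀ k, ω.arrival k < t → R ≤ ω.gap k ∧ ω.arrival k + R ≤ t) →
    ∀ i, π.pos ω i t = (E.loiterPose m (E.place m c i t)).point
  /-- A robot that is not responsible for the present request stays at its place. -/
  others_loiter : ∀ ω : RequestSeq, ω.Proper E → ∀ j, (∀ k ≤ j, R ≤ ω.gap k) →
    ∀ i, ¬ E.Responsible m c i (ω.arrival j) (ω.loc j) →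
    ∀ t, ω.arrival j ≤ t → t ≤ ω.arrival (j + 1) →
    π.pos ω i t = (E.loiterPose m (E.place m c i t)).point
  /-- The responsible robot loiters until it reaches the point of departure. -/
  approach : ∀ ω : RequestSeq, ω.Proper E → ∀ j, (∀ k ≤ j, R ≤ ω.gap k) →
    ∀ i, E.Responsible m c i (ω.arrival j) (ω.loc j) →
    ∀ t, ω.arrival j ≤ t → t ≤ ω.arrival (j + 1) →
    E.speed * (t - ω.arrival j) ≤ E.approachLength m c i (ω.arrival j) (ω.loc j) →
    π.pos ω i t = (E.loiterPose m (E.place m c i t)).point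
  /-- From there it follows the circular arc to the target. -/
  serve : ∀ ω : RequestSeq, ω.Proper E → ∀ j, (∀ k ≤ j, R ≤ ω.gap k) →
    ∀ i, E.Responsible m c i (ω.arrival j) (ω.loc j) →
    ∀ t, t ≤ ω.arrival (j + 1) → ∀ s, 0 ≤ s → s ≤ E.serviceLength m (ω.loc j) →
    E.speed * (t - ω.arrival j) = E.approachLength m c i (ω.arrival j) (ω.loc j) + s →
    π.pos ω i t = ((E.loiterPose m (E.departure m (ω.loc j))).advance
      (E.serviceCurvature m (ω.loc j)) s).point
  /-- However the requests appear, the time it takes to deal with `n` of them is at most `K * n`. -/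
  bounded_wait : ∀ ω : RequestSeq, ω.Proper E → ∀ j : ℕ,
    π.waitTime j ω ≤ ENNReal.ofReal (K * (j + 1))

/-- The policy implements the Strip Loitering algorithm. -/
def IsStripLoitering (E : Setting) (m : ℕ) (π : Policy E m) : Prop :=
  ∃ c R K : ℝ, IsStripLoiteringWith E m π c R K

end StripLoitering

end

noncomputable section

namespace StripLoitering

/-! ### Paths of constant curvature -/

/-! Three arguments are combined.

Existence (`isStripLoiteringWith_queuePolicy`). Requests are served one after the other in order of
arrival, each with a fixed amount of time set aside. The responsible robot leaves the loop at the
point of departure, runs through a full circle of radius ρ on which the target lies, and then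
through a second full circle, so long that both together are an integer multiple of the length of
the loop. When it is back at the point of departure, its own place in the pattern is just passing
there, and it resumes loitering. A motion made locally of arcs that join without kinks (`Steers`) is
admissible for a double integrator: its velocity is continuous, and the right derivative of the
velocity serves as control (`Steers.isDIMotion`).

Cost of any implementing policy (`IsStripLoiteringWith.tendsto_expectedWait`). A request that is
well separated from the others almost surely waits exactly for the approach and the arc
(`IsStripLoiteringWith.waitTime_eq`). The smallest of `m` equally spaced phases is a fractional part
divided by `m`. The phase at an exponential time of small rate is nearly uniform
(`lintegral_fract_expMeasure`), and requests in quick succession have probability O(r), while the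
wait of the `j`-th request stays bounded. So for every `j` the limit is half the spacing of the
robots plus the mean length of the arc, divided by the speed; this is `loiterCost`. For width w the
loop has length about B/w with B = A + 10.38ρ√A, and the mean arc length is of order √(ρw). With w
of order m^(-2/3) both contributions are of order m^(-1/3) (`eventually_loiterCost_le`).

Lower bound (`eventually_le_optimalCost`). During a time 2h, a double integrator stays within O(h²)
of the straight extrapolation of its motion. The points it can reach are thus covered by O(1/h)
discs of radius O(h²), of total area O(h³). The location of a request is independent of the past, by
causality of the policy. If h is a small multiple of m^(-1/3), the discs of all robots cover at most
half of the square, and the expected wait is at least h/2. -/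

/-- The unit vector of a given heading. -/
def direction (φ : ℝ) : Plane := !₂[Real.cos φ, Real.sin φ]

theorem norm_direction (φ : ℝ) : ‖direction φ‖ = 1 := by
  simp [direction, EuclideanSpace.norm_eq, Fin.sum_univ_two]

theorem direction_add_int_mul (φ : ℝ) (k : ℤ) :
    direction (φ + k * (2 * Real.pi)) = direction φ := by
  simp [direction, Real.cos_add_int_mul_two_pi, Real.sin_add_int_mul_two_pi]

theorem hasDerivAt_plane {f g : ℝ → ℝ} {f' g' t : ℝ} (hf : HasDerivAt f f' t)
    (hg : HasDerivAt g g' t) : HasDerivAt (fun s => (!₂[f s, g s] : Plane)) !₂[f', g'] t := by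
  have h : HasDerivAt (fun s => ![f s, g s]) ![f', g'] t := by
    rw [hasDerivAt_pi]
    intro i
    fin_cases i
    · simpa using hf
    · simpa using hg
  exact ((PiLp.continuousLinearEquiv 2 ℝ (fun _ : Fin 2 => ℝ)).symm.hasFDerivAt.comp_hasDerivAt t h)

theorem hasDerivAt_direction (φ : ℝ) :
    HasDerivAt direction (direction (φ + Real.pi / 2)) φ := by
  have := hasDerivAt_plane (Real.hasDerivAt_cos φ) (Real.hasDerivAt_sin φ)
  simp only [direction, Real.cos_add_pi_div_two, Real.sin_add_pi_div_two]
  exact this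

namespace Pose

theorem ext' {g g' : Pose} (hx : g.x = g'.x) (hy : g.y = g'.y) (hh : g.heading = g'.heading) :
    g = g' := by
  cases g; cases g'; simp_all

@[simp] theorem advance_zero (κ : ℝ) (g : Pose) : g.advance κ 0 = g := by
  apply ext' <;> simp [advance]

theorem advance_advance (κ : ℝ) (g : Pose) (a b : ℝ) :
    (g.advance κ a).advance κ b = g.advance κ (a + b) := by
  have key : ∀ f : ℝ → ℝ, Continuous f →
      (∫ r in (0 : ℝ)..a, f (g.heading + κ * r)) + ∫ r in (0 : ℝ)..b, f (g.heading + κ * a + κ * r) =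
        ∫ r in (0 : ℝ)..(a + b), f (g.heading + κ * r) := by
    intro f hf
    have h1 : (∫ r in (0 : ℝ)..b, f (g.heading + κ * a + κ * r)) =
        ∫ r in a..(a + b), f (g.heading + κ * r) := by
      have := intervalIntegral.integral_comp_add_left (a := 0) (b := b)
        (fun r => f (g.heading + κ * r)) a
      simp only [add_zero] at this
      rw [← this]
      congr 1; ext r; ring_nf
    rw [h1]
    apply intervalIntegral.integral_add_adjacent_intervals <;>
    exact Continuous.intervalIntegrable (by fun_prop) _ _
  apply ext'
  · simp only [advance, add_assoc, ← key _ Real.continuous_cos]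
  · simp only [advance, add_assoc, ← key _ Real.continuous_sin]
  · simp only [advance]; ring

/-- The displacement along an arc of nonzero curvature. -/
theorem advance_of_ne_zero {κ : ℝ} (hκ : κ ≠ 0) (g : Pose) (s : ℝ) :
    g.advance κ s = ⟨g.x + (Real.sin (g.heading + κ * s) - Real.sin g.heading) / κ,
      g.y - (Real.cos (g.heading + κ * s) - Real.cos g.heading) / κ, g.heading + κ * s⟩ := by
  apply ext'
  · simp only [advance]
    rw [intervalIntegral.integral_comp_add_mul (fun x => Real.cos x) hκ]
    simp [div_eq_inv_mul]
  · simp only [advance]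
    rw [intervalIntegral.integral_comp_add_mul (fun x => Real.sin x) hκ]
    simp only [mul_zero, add_zero, integral_sin, smul_eq_mul]
    ring
  · rfl

theorem advance_zero_curvature (g : Pose) (s : ℝ) :
    g.advance 0 s = ⟨g.x + s * Real.cos g.heading, g.y + s * Real.sin g.heading, g.heading⟩ := by
  apply ext' <;> simp [advance]

/-- Two poses agree, up to full turns of the heading. -/
def Equiv (g g' : Pose) : Prop :=
  g.x = g'.x ∧ g.y = g'.y ∧ ∃ k : ℤ, g'.heading = g.heading + k * (2 * Real.pi)

theorem Equiv.refl (g : Pose) : g.Equiv g := ⟨rfl, rfl, 0, by simp⟩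

theorem Equiv.symm {g g' : Pose} (h : g.Equiv g') : g'.Equiv g := by
  obtain ⟨hx, hy, k, hk⟩ := h
  exact ⟨hx.symm, hy.symm, -k, by rw [hk]; push_cast; ring⟩

theorem Equiv.advance {g g' : Pose} (h : g.Equiv g') (κ s : ℝ) :
    (g.advance κ s).Equiv (g'.advance κ s) := by
  obtain ⟨hx, hy, k, hk⟩ := h
  refine ⟨?_, ?_, k, ?_⟩
  · simp only [Pose.advance, hx, hk, add_right_comm _ _ (κ * _), Real.cos_add_int_mul_two_pi]
  · simp only [Pose.advance, hy, hk, add_right_comm _ _ (κ * _), Real.sin_add_int_mul_two_pi]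
  · simp only [Pose.advance, hk]; ring

theorem Equiv.point {g g' : Pose} (h : g.Equiv g') : g.point = g'.point := by
  simp [Pose.point, h.1, h.2.1]

theorem Equiv.direction {g g' : Pose} (h : g.Equiv g') :
    direction g.heading = direction g'.heading := by
  obtain ⟨_, _, k, hk⟩ := h
  rw [hk, direction_add_int_mul]

/-- A full circle leads back to its beginning. -/
theorem advance_full_circle {κ s : ℝ} (g : Pose) (k : ℤ) (hk : k ≠ 0)
    (hs : κ * s = k * (2 * Real.pi)) : g.Equiv (g.advance κ s) := by
  have hκ : κ ≠ 0 := by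
    rintro rfl
    simp only [zero_mul] at hs
    have := Real.pi_pos
    have hk' : (k : ℝ) ≠ 0 := by exact_mod_cast hk
    have : (k : ℝ) * (2 * Real.pi) ≠ 0 := by positivity
    exact this hs.symm
  rw [advance_of_ne_zero hκ, hs]
  refine ⟨?_, ?_, k, rfl⟩
  · simp [Real.sin_add_int_mul_two_pi]
  · simp [Real.cos_add_int_mul_two_pi]

theorem hasDerivAt_advance (κ : ℝ) (g : Pose) (s : ℝ) :
    HasDerivAt (fun s => (g.advance κ s).point) (direction (g.advance κ s).heading) s := by
  have h : ∀ f : ℝ → ℝ, Continuous f → HasDerivAt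
      (fun s => ∫ r in (0 : ℝ)..s, f (g.heading + κ * r)) (f (g.heading + κ * s)) s := by
    intro f hf
    have hc : Continuous fun r => f (g.heading + κ * r) := by fun_prop
    exact intervalIntegral.integral_hasDerivAt_right (hc.intervalIntegrable _ _)
      hc.stronglyMeasurable.stronglyMeasurableAtFilter hc.continuousAt
  exact hasDerivAt_plane ((h _ Real.continuous_cos).const_add _)
    ((h _ Real.continuous_sin).const_add _)

end Pose

/-! ### Motions of bounded curvature -/

/-- Just after time `t`, the motion `x` of speed `v` continues from the pose `g` along a path of
constant curvature at most `k`. -/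
def SteersAfter (v k : ℝ) (x : ℝ → Plane) (t : ℝ) (g : Pose) : Prop :=
  ∃ κ, |κ| ≤ k ∧ ∀ᶠ s in 𝓝[≥] t, x s = (g.advance κ (v * (s - t))).point

/-- Just before time `t`, the motion `x` of speed `v` leads to the pose `g` along a path of
constant curvature at most `k`. -/
def SteersBefore (v k : ℝ) (x : ℝ → Plane) (t : ℝ) (g : Pose) : Prop :=
  ∃ κ, |κ| ≤ k ∧ ∀ᶠ s in 𝓝[≤] t, x s = (g.advance κ (v * (s - t))).point

/-- The motion `x` has constant speed `v` and consists, locally, of arcs of curvature at most `k`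
that join without kinks. -/
def Steers (v k : ℝ) (x : ℝ → Plane) : Prop :=
  ∀ t, ∃ g, SteersAfter v k x t g ∧ SteersBefore v k x t g

section

variable {v k : ℝ} {x y : ℝ → Plane} {t : ℝ} {g g' : Pose}

theorem SteersBefore.congr_pose (h : SteersBefore v k x t g) (hg : g.Equiv g') :
    SteersBefore v k x t g' := by
  obtain ⟨κ, hκ, h⟩ := h
  exact ⟨κ, hκ, h.mono fun s hs => hs.trans (hg.advance _ _).point⟩

theorem SteersAfter.congr (h : SteersAfter v k x t g) (hxy : ∀ᶠ s in 𝓝[≥] t, y s = x s) :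
    SteersAfter v k y t g := by
  obtain ⟨κ, hκ, h⟩ := h
  exact ⟨κ, hκ, h.mp (hxy.mono fun s hs hs' => hs.trans hs')⟩

theorem SteersBefore.congr (h : SteersBefore v k x t g) (hxy : ∀ᶠ s in 𝓝[≤] t, y s = x s) :
    SteersBefore v k y t g := by
  obtain ⟨κ, hκ, h⟩ := h
  exact ⟨κ, hκ, h.mp (hxy.mono fun s hs hs' => hs.trans hs')⟩

/-- Advancing is additive, so an arc parametrized from a base time `t₀` can be rebased at `t`. In
this way explicit formulas for a motion become steering data. -/
theorem steersAfter_advance {κ : ℝ} (hκ : |κ| ≤ k) (t₀ : ℝ)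
    (h : ∀ᶠ s in 𝓝[≥] t, x s = (g.advance κ (v * (s - t₀))).point) :
    SteersAfter v k x t (g.advance κ (v * (t - t₀))) := by
  refine ⟨κ, hκ, h.mono fun s hs => ?_⟩
  rw [hs, Pose.advance_advance]
  congr 2; ring

theorem steersBefore_advance {κ : ℝ} (hκ : |κ| ≤ k) (t₀ : ℝ)
    (h : ∀ᶠ s in 𝓝[≤] t, x s = (g.advance κ (v * (s - t₀))).point) :
    SteersBefore v k x t (g.advance κ (v * (t - t₀))) := by
  refine ⟨κ, hκ, h.mono fun s hs => ?_⟩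
  rw [hs, Pose.advance_advance]
  congr 2; ring

theorem hasDerivAt_advance_comp (κ v t₀ : ℝ) (g : Pose) (s : ℝ) :
    HasDerivAt (fun s => (g.advance κ (v * (s - t₀))).point)
      (v • direction (g.heading + κ * (v * (s - t₀)))) s := by
  have h1 : HasDerivAt (fun s : ℝ => v * (s - t₀)) v s := by
    simpa using ((hasDerivAt_id s).sub_const t₀).const_mul v
  exact (Pose.hasDerivAt_advance κ g _).scomp s h1

theorem hasDerivAt_velocity (κ v t₀ φ s : ℝ) :
    HasDerivAt (fun s => v • direction (φ + κ * (v * (s - t₀))))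
      (v • (κ * v) • direction (φ + κ * (v * (s - t₀)) + Real.pi / 2)) s := by
  have h1 : HasDerivAt (fun s : ℝ => φ + κ * (v * (s - t₀))) (κ * v) s := by
    have := (((hasDerivAt_id s).sub_const t₀).const_mul v).const_mul κ
    simpa using this.const_add φ
  exact ((hasDerivAt_direction _).scomp s h1).const_smul v

theorem SteersAfter.hasDerivWithinAt (h : SteersAfter v k x t g) :
    HasDerivWithinAt x (v • direction g.heading) (Set.Ici t) t := by
  obtain ⟨κ, -, h⟩ := h
  have h1 := (hasDerivAt_advance_comp κ v t g t).hasDerivWithinAt (s := Set.Ici t)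
  simp only [sub_self, mul_zero, add_zero] at h1
  exact h1.congr_of_eventuallyEq h (h.self_of_nhdsWithin Set.self_mem_Ici)

theorem SteersBefore.hasDerivWithinAt (h : SteersBefore v k x t g) :
    HasDerivWithinAt x (v • direction g.heading) (Set.Iic t) t := by
  obtain ⟨κ, -, h⟩ := h
  have h1 := (hasDerivAt_advance_comp κ v t g t).hasDerivWithinAt (s := Set.Iic t)
  simp only [sub_self, mul_zero, add_zero] at h1
  exact h1.congr_of_eventuallyEq h (h.self_of_nhdsWithin Set.self_mem_Iic)

/-- Both arcs pass through the same pose, so the two one-sided derivatives agree. -/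
theorem hasDerivAt_of_steers (h₁ : SteersAfter v k x t g) (h₂ : SteersBefore v k x t g) :
    HasDerivAt x (v • direction g.heading) t := by
  have := h₂.hasDerivWithinAt.union h₁.hasDerivWithinAt
  rwa [Set.Iic_union_Ici, hasDerivWithinAt_univ] at this

theorem Steers.norm_deriv (h : Steers v k x) (hv : 0 ≤ v) (t : ℝ) : ‖deriv x t‖ = v := by
  obtain ⟨g, h₁, h₂⟩ := h t
  rw [(hasDerivAt_of_steers h₁ h₂).deriv, norm_smul, norm_direction, mul_one, Real.norm_of_nonneg hv]

theorem Steers.differentiable (h : Steers v k x) : Differentiable ℝ x := fun t => by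
  obtain ⟨g, h₁, h₂⟩ := h t
  exact (hasDerivAt_of_steers h₁ h₂).differentiableAt

/-- To the right of `t` the motion coincides with the arc on an open set, which determines the
derivative there. At `t` itself it coincides on one side only, so the derivative at `t` has to be
supplied by `ht`. -/
theorem eventually_deriv_after {κ : ℝ}
    (hx : ∀ᶠ s in 𝓝[≥] t, x s = (g.advance κ (v * (s - t))).point)
    (ht : deriv x t = v • direction g.heading) :
    ∀ᶠ s in 𝓝[≥] t, deriv x s = v • direction (g.heading + κ * (v * (s - t))) := by
  have h1 : ∀ᶠ s in 𝓝[>] t, deriv x s = v • direction (g.heading + κ * (v * (s - t))) := by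
    have h2 : ∀ᶠ s in 𝓝[>] t, x s = (g.advance κ (v * (s - t))).point :=
      hx.filter_mono (nhdsWithin_mono _ Set.Ioi_subset_Ici_self)
    filter_upwards [eventually_eventually_nhdsWithin.2 h2, self_mem_nhdsWithin] with s hs hst
    have hs' : ∀ᶠ r in 𝓝 s, x r = (g.advance κ (v * (r - t))).point := by
      rwa [IsOpen.nhdsWithin_eq isOpen_Ioi hst] at hs
    rw [Filter.EventuallyEq.deriv_eq hs', (hasDerivAt_advance_comp κ v t g s).deriv]
  rw [← Set.Ioi_union_left, nhdsWithin_union, Filter.eventually_sup]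
  refine ⟨h1, ?_⟩
  simp [ht]

theorem eventually_deriv_before {κ : ℝ}
    (hx : ∀ᶠ s in 𝓝[≤] t, x s = (g.advance κ (v * (s - t))).point)
    (ht : deriv x t = v • direction g.heading) :
    ∀ᶠ s in 𝓝[≤] t, deriv x s = v • direction (g.heading + κ * (v * (s - t))) := by
  have h1 : ∀ᶠ s in 𝓝[<] t, deriv x s = v • direction (g.heading + κ * (v * (s - t))) := by
    have h2 : ∀ᶠ s in 𝓝[<] t, x s = (g.advance κ (v * (s - t))).point :=
      hx.filter_mono (nhdsWithin_mono _ Set.Iio_subset_Iic_self)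
    filter_upwards [eventually_eventually_nhdsWithin.2 h2, self_mem_nhdsWithin] with s hs hst
    have hs' : ∀ᶠ r in 𝓝 s, x r = (g.advance κ (v * (r - t))).point := by
      rwa [IsOpen.nhdsWithin_eq isOpen_Iio hst] at hs
    rw [Filter.EventuallyEq.deriv_eq hs', (hasDerivAt_advance_comp κ v t g s).deriv]
  rw [← Set.Iio_union_right, nhdsWithin_union, Filter.eventually_sup]
  refine ⟨h1, ?_⟩
  simp [ht]

/-- On an arc of curvature κ the acceleration is centripetal, of norm v²|κ|. Curvature may jump
where arcs meet, so only one-sided derivatives of the velocity are available. -/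
theorem Steers.hasDerivWithinAt_deriv (h : Steers v k x) (hv : 0 ≤ v) (t : ℝ) :
    ∃ u : Plane, HasDerivWithinAt (deriv x) u (Set.Ici t) t ∧ ‖u‖ ≤ v ^ 2 * k := by
  obtain ⟨g, h₁, h₂⟩ := h t
  have hd := (hasDerivAt_of_steers h₁ h₂).deriv
  obtain ⟨κ, hκ, hx⟩ := h₁
  have h3 := eventually_deriv_after hx hd
  have h4 := (hasDerivAt_velocity κ v t g.heading t).hasDerivWithinAt (s := Set.Ici t)
  refine ⟨_, h4.congr_of_eventuallyEq h3 (h3.self_of_nhdsWithin Set.self_mem_Ici), ?_⟩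
  rw [norm_smul, norm_smul, norm_direction, Real.norm_of_nonneg hv, norm_mul, Real.norm_of_nonneg hv,
    Real.norm_eq_abs]
  nlinarith [mul_le_mul_of_nonneg_right hκ (mul_nonneg hv hv)]

theorem Steers.continuous_deriv (h : Steers v k x) : Continuous (deriv x) := by
  rw [continuous_iff_continuousAt]
  intro t
  obtain ⟨g, h₁, h₂⟩ := h t
  have hd := (hasDerivAt_of_steers h₁ h₂).deriv
  obtain ⟨κ, -, hx⟩ := h₁
  obtain ⟨κ', -, hx'⟩ := h₂
  have h3 := eventually_deriv_after hx hd
  have h3' := eventually_deriv_before hx' hd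
  have h4 := (hasDerivAt_velocity κ v t g.heading t).continuousAt.continuousWithinAt (s := Set.Ici t)
  have h4' := (hasDerivAt_velocity κ' v t g.heading t).continuousAt.continuousWithinAt (s := Set.Iic t)
  exact continuousAt_iff_continuous_left_right.2
    ⟨h4'.congr_of_eventuallyEq h3' (h3'.self_of_nhdsWithin Set.self_mem_Iic),
     h4.congr_of_eventuallyEq h3 (h3.self_of_nhdsWithin Set.self_mem_Ici)⟩

/-- The right derivative of the velocity is a control that is defined everywhere, bounded and
measurable. The velocity is recovered from it by the fundamental theorem of calculus for continuous
functions with a right derivative. -/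
theorem Steers.isDIMotion {E : Setting} (h : Steers v k x) (hv : 0 ≤ v) (hvmax : v ≤ E.vmax)
    (hk : v ^ 2 * k ≤ E.umax) : IsDIMotion E x := by
  have key : ∀ t, ‖derivWithin (deriv x) (Set.Ici t) t‖ ≤ E.umax := by
    intro t
    obtain ⟨u, hu, hu'⟩ := h.hasDerivWithinAt_deriv hv t
    rw [hu.derivWithin (uniqueDiffOn_Ici t t Set.self_mem_Ici)]
    exact hu'.trans hk
  have hm : Measurable fun t => derivWithin (deriv x) (Set.Ici t) t := measurable_derivWithin_Ici _
  refine ⟨deriv x, fun t => derivWithin (deriv x) (Set.Ici t) t, hm, key,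
    fun t _ => (h.norm_deriv hv t).trans_le hvmax, fun t ht => ⟨?_, ?_⟩⟩
  · rw [intervalIntegral.integral_deriv_eq_sub (fun s _ => h.differentiable s)
      (h.continuous_deriv.intervalIntegrable _ _)]
    abel
  · rw [intervalIntegral.integral_eq_sub_of_hasDeriv_right h.continuous_deriv.continuousOn
      (f' := fun t => derivWithin (deriv x) (Set.Ici t) t)]
    · abel
    · intro s _
      obtain ⟨u, hu, hu'⟩ := h.hasDerivWithinAt_deriv hv s
      rw [hu.derivWithin (uniqueDiffOn_Ici s s Set.self_mem_Ici)]
      exact hu.mono Set.Ioi_subset_Ici_self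
    · refine IntervalIntegrable.mono_fun' (g := fun _ => E.umax) (by simp) hm.aestronglyMeasurable ?_
      exact Eventually.of_forall key

end

/-! ### Paths made of finitely many pieces -/

namespace Pose

/-- The pose at the end of a path. -/
def last (l : List (ℝ × ℝ)) (g : Pose) : Pose := l.foldl (fun g p => g.advance p.1 p.2) g

@[simp] theorem last_nil (g : Pose) : last [] g = g := rfl

@[simp] theorem last_cons (p : ℝ × ℝ) (l : List (ℝ × ℝ)) (g : Pose) :
    last (p :: l) g = last l (g.advance p.1 p.2) := rfl

theorem last_append (l₁ l₂ : List (ℝ × ℝ)) (g : Pose) :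
    last (l₁ ++ l₂) g = last l₂ (last l₁ g) := by
  simp [last, List.foldl_append]

theorem sum_nonneg {l : List (ℝ × ℝ)} (hl : ∀ p ∈ l, 0 ≤ p.2) : 0 ≤ (l.map Prod.snd).sum := by
  apply List.sum_nonneg
  simpa using fun x y h => hl _ h

theorem follow_zero {l : List (ℝ × ℝ)} (hl : ∀ p ∈ l, 0 ≤ p.2) (g : Pose) : follow l g 0 = g := by
  match l with
  | [] => rfl
  | (κ, a) :: rest =>
    have : (0 : ℝ) ≤ a := hl (κ, a) (by simp)
    simp [follow, this]

/-- At `s = a` the definition still uses the first piece; the end of that piece is the beginning of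
the remaining path, provided that lengths are nonnegative. -/
theorem follow_cons_of_le {κ a : ℝ} {l : List (ℝ × ℝ)} (hl : ∀ p ∈ l, 0 ≤ p.2) (g : Pose) {s : ℝ}
    (hs : a ≤ s) : follow ((κ, a) :: l) g s = follow l (g.advance κ a) (s - a) := by
  rcases hs.eq_or_lt with rfl | hs
  · simp [follow, follow_zero hl]
  · simp [follow, not_le.2 hs]

theorem follow_append_of_le {l₁ l₂ : List (ℝ × ℝ)} (hl₁ : ∀ p ∈ l₁, 0 ≤ p.2)
    (hl₂ : ∀ p ∈ l₂, 0 ≤ p.2) (g : Pose) {s : ℝ} (hs : (l₁.map Prod.snd).sum ≤ s) :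
    follow (l₁ ++ l₂) g s = follow l₂ (last l₁ g) (s - (l₁.map Prod.snd).sum) := by
  induction l₁ generalizing g s with
  | nil => simp
  | cons p l ih =>
    obtain ⟨κ, a⟩ := p
    have hl : ∀ p ∈ l, 0 ≤ p.2 := fun p hp => hl₁ p (by simp [hp])
    have h0 := sum_nonneg hl
    simp only [List.map_cons, List.sum_cons] at hs ⊢
    rw [List.cons_append, follow_cons_of_le _ _ (by linarith), ih hl _ (by linarith), last_cons,
      sub_sub]
    intro p hp
    rcases List.mem_append.1 hp with hp | hp
    exacts [hl p hp, hl₂ p hp]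

theorem follow_sum {l : List (ℝ × ℝ)} (hl : ∀ p ∈ l, 0 ≤ p.2) (g : Pose) :
    follow l g (l.map Prod.snd).sum = last l g := by
  have := follow_append_of_le (l₂ := []) hl (by simp) g le_rfl
  simpa [follow] using this

/-- After any of its points but the last, the path continues along a path of constant curvature. -/
theorem follow_after {k : ℝ} {l : List (ℝ × ℝ)} (hl : ∀ p ∈ l, 0 ≤ p.2) (hk : ∀ p ∈ l, |p.1| ≤ k)
    (g : Pose) {s : ℝ} (h0 : 0 ≤ s) (hs : s < (l.map Prod.snd).sum) :
    ∃ κ, |κ| ≤ k ∧ ∀ᶠ r in 𝓝[≥] s, follow l g r = (follow l g s).advance κ (r - s) := by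
  induction l generalizing g s with
  | nil => simp at hs; linarith
  | cons p l ih =>
    obtain ⟨κ, a⟩ := p
    have hl' : ∀ p ∈ l, 0 ≤ p.2 := fun p hp => hl p (by simp [hp])
    rcases lt_or_ge s a with hsa | hsa
    · refine ⟨κ, hk (κ, a) (by simp), ?_⟩
      filter_upwards [mem_nhdsWithin_of_mem_nhds (Iio_mem_nhds hsa)] with r hr
      have hr : r < a := hr
      simp only [follow, hr.le, hsa.le, if_true]
      rw [advance_advance]; congr 1; ring
    · simp only [List.map_cons, List.sum_cons] at hs
      obtain ⟨κ', hκ', h⟩ := ih hl' (fun p hp => hk p (by simp [hp])) (g.advance κ a) (s := s - a)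
        (by linarith) (by linarith)
      refine ⟨κ', hκ', ?_⟩
      have ht : Tendsto (fun r => r - a) (𝓝[≥] s) (𝓝[≥] (s - a)) := by
        refine tendsto_nhdsWithin_iff.2 ⟨((continuous_id.sub continuous_const).tendsto _).mono_left
          nhdsWithin_le_nhds, ?_⟩
        filter_upwards [self_mem_nhdsWithin] with r hr
        have hr : s ≤ r := hr
        simp [hr]
      filter_upwards [ht.eventually h, self_mem_nhdsWithin] with r hr hsr
      have hsr : s ≤ r := hsr
      rw [follow_cons_of_le hl' _ hsa, follow_cons_of_le hl' _ (hsa.trans hsr), hr]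
      congr 1; ring

/-- To any of its points but the first, the path leads along a path of constant curvature. -/
theorem follow_before {k : ℝ} {l : List (ℝ × ℝ)} (hl : ∀ p ∈ l, 0 ≤ p.2) (hk : ∀ p ∈ l, |p.1| ≤ k)
    (g : Pose) {s : ℝ} (h0 : 0 < s) (hs : s ≤ (l.map Prod.snd).sum) :
    ∃ κ, |κ| ≤ k ∧ ∀ᶠ r in 𝓝[≤] s, follow l g r = (follow l g s).advance κ (r - s) := by
  induction l generalizing g s with
  | nil => simp at hs; linarith
  | cons p l ih =>
    obtain ⟨κ, a⟩ := p
    have hl' : ∀ p ∈ l, 0 ≤ p.2 := fun p hp => hl p (by simp [hp])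
    rcases le_or_gt s a with hsa | hsa
    · refine ⟨κ, hk (κ, a) (by simp), ?_⟩
      filter_upwards [self_mem_nhdsWithin] with r hr
      have hr : r ≤ s := hr
      simp only [follow, hr.trans hsa, hsa, if_true]
      rw [advance_advance]; congr 1; ring
    · simp only [List.map_cons, List.sum_cons] at hs
      obtain ⟨κ', hκ', h⟩ := ih hl' (fun p hp => hk p (by simp [hp])) (g.advance κ a) (s := s - a)
        (by linarith) (by linarith)
      refine ⟨κ', hκ', ?_⟩
      have ht : Tendsto (fun r => r - a) (𝓝[≤] s) (𝓝[≤] (s - a)) := by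
        refine tendsto_nhdsWithin_iff.2 ⟨((continuous_id.sub continuous_const).tendsto _).mono_left
          nhdsWithin_le_nhds, ?_⟩
        filter_upwards [self_mem_nhdsWithin] with r hr
        have hr : r ≤ s := hr
        simp [hr]
      filter_upwards [ht.eventually h, mem_nhdsWithin_of_mem_nhds (Ioi_mem_nhds hsa)] with r hr hsr
      have hsr : a < r := hsr
      rw [follow_cons_of_le hl' _ hsa.le, follow_cons_of_le hl' _ hsr.le, hr]
      congr 1; ring

/-- The initial pose is allowed to depend on the parameter so that the induction over the pieces
goes through. -/
theorem measurable_follow (l : List (ℝ × ℝ)) {α : Type*} [MeasurableSpace α] {X Y H S : α → ℝ}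
    (hX : Measurable X) (hY : Measurable Y) (hH : Measurable H) (hS : Measurable S) :
    (Measurable fun a => (follow l ⟨X a, Y a, H a⟩ (S a)).x) ∧
    (Measurable fun a => (follow l ⟨X a, Y a, H a⟩ (S a)).y) ∧
    (Measurable fun a => (follow l ⟨X a, Y a, H a⟩ (S a)).heading) := by
  induction l generalizing X Y H S with
  | nil => exact ⟨hX, hY, hH⟩
  | cons p l ih =>
    obtain ⟨κ, b⟩ := p
    have key : ∀ T : α → ℝ, Measurable T →
        (Measurable fun a => (Pose.advance κ ⟨X a, Y a, H a⟩ (T a)).x) ∧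
        (Measurable fun a => (Pose.advance κ ⟨X a, Y a, H a⟩ (T a)).y) ∧
        (Measurable fun a => (Pose.advance κ ⟨X a, Y a, H a⟩ (T a)).heading) := by
      intro T hT
      by_cases hκ : κ = 0
      · subst hκ
        simp only [advance_zero_curvature]
        refine ⟨?_, ?_, ?_⟩ <;> fun_prop
      · simp only [advance_of_ne_zero hκ]
        refine ⟨?_, ?_, ?_⟩ <;> fun_prop
    obtain ⟨h1, h2, h3⟩ := key S hS
    obtain ⟨k1, k2, k3⟩ := key (fun _ => b) measurable_const
    obtain ⟨i1, i2, i3⟩ := ih k1 k2 k3 (hS.sub_const b)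
    have hset : MeasurableSet {a | S a ≤ b} := measurableSet_le hS measurable_const
    simp only [follow]
    refine ⟨?_, ?_, ?_⟩
    · simp only [apply_ite Pose.x]; exact Measurable.ite hset h1 i1
    · simp only [apply_ite Pose.y]; exact Measurable.ite hset h2 i2
    · simp only [apply_ite Pose.heading]; exact Measurable.ite hset h3 i3

end Pose

/-! ### The geometry of the loitering path -/

namespace Setting

variable (E : Setting) (m : ℕ)

theorem side_pos : 0 < E.side := Real.sqrt_pos.2 E.area_pos

theorem side_sq : E.side ^ 2 = E.area := Real.sq_sqrt E.area_pos.le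

theorem speed_pos : 0 < E.speed := by
  have h1 := E.umax_pos
  have h2 := E.side_pos
  have h3 : 0 < √(√E.area * E.umax) := Real.sqrt_pos.2 (mul_pos h2 h1)
  exact lt_min E.vmax_pos (by positivity)

theorem speed_le : E.speed ≤ E.vmax := min_le_left _ _

theorem radius_pos : 0 < E.radius := div_pos (pow_pos E.speed_pos 2) E.umax_pos

theorem speed_sq : E.speed ^ 2 * (1 / E.radius) = E.umax := by
  have h1 := E.umax_pos
  have h2 := E.speed_pos
  unfold radius
  field_simp

/-- The constant 3.22 in the speed enters here, through 3.22² ≥ 10. -/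
theorem ten_radius_le_side : 10 * E.radius ≤ E.side := by
  have h1 := E.umax_pos
  have h2 := E.side_pos
  have h3 : E.speed ^ 2 ≤ E.side * E.umax / 3.22 ^ 2 := by
    have h4 : E.speed ≤ √(√E.area * E.umax) / 3.22 := min_le_right _ _
    calc E.speed ^ 2 ≤ (√(√E.area * E.umax) / 3.22) ^ 2 := by
          have := E.speed_pos
          gcongr
      _ = E.side * E.umax / 3.22 ^ 2 := by
          rw [div_pow, Real.sq_sqrt (show 0 ≤ √E.area * E.umax from (mul_pos h2 h1).le)]; rfl
  unfold radius
  rw [mul_div_assoc', div_le_iff₀ h1]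
  have h5 : 0 < E.side * E.umax := mul_pos h2 h1
  norm_num at h3
  linarith

theorem runLength_pos : 0 < E.runLength := by
  have := E.side_pos; have := E.radius_pos
  unfold runLength; linarith

theorem width_le : E.width m ≤ 2 * E.radius := min_le_right _ _

variable {m}

theorem width_pos (hm : 1 ≤ m) : 0 < E.width m := by
  have h1 := E.side_pos; have h2 := E.radius_pos; have h3 := E.area_pos
  have h4 : (0 : ℝ) < m := by exact_mod_cast hm
  have h5 : 0 < √E.area := h1
  have h6 : 0 < √E.radius := Real.sqrt_pos.2 h2
  apply lt_min
  · positivity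
  · positivity

theorem side_le (hm : 1 ≤ m) : E.side ≤ E.numStrips m * E.width m := by
  have := Nat.le_ceil (E.side / E.width m)
  rwa [div_le_iff₀ (E.width_pos hm)] at this

theorem numStrips_pos (hm : 1 ≤ m) : 0 < E.numStrips m :=
  Nat.ceil_pos.2 (div_pos E.side_pos (E.width_pos hm))

theorem cast_numStrips_sub_one (hm : 1 ≤ m) :
    ((E.numStrips m - 1 : ℕ) : ℝ) = E.numStrips m - 1 := by
  rw [Nat.cast_sub (E.numStrips_pos hm)]; simp

theorem numStrips_sub_one_mul_lt (hm : 1 ≤ m) : (E.numStrips m - 1) * E.width m < E.side := by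
  have := Nat.ceil_lt_add_one (div_pos E.side_pos (E.width_pos hm)).le
  rw [← lt_div_iff₀ (E.width_pos hm)]
  unfold numStrips
  linarith

/-- The strips without the last one have total width at least side − w ≥ 10ρ − 2ρ. Consequently the
vertical segment of the closing piece, which two quarter turns shorten by 2ρ, has nonnegative
length. -/
theorem four_radius_le (hm : 1 ≤ m) : 4 * E.radius ≤ (E.numStrips m - 1) * E.width m := by
  have h1 := E.side_le hm
  have h2 := E.width_le m
  have h3 := E.ten_radius_le_side
  have h4 := E.radius_pos
  linarith

theorem uTurnAngle_nonneg : 0 ≤ E.uTurnAngle m := Real.arccos_nonneg _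

theorem cos_uTurnAngle (hm : 1 ≤ m) :
    Real.cos (E.uTurnAngle m) = 1 / 2 + E.width m / (4 * E.radius) := by
  have h1 := E.width_pos hm
  have h2 := E.width_le m
  have h3 := E.radius_pos
  apply Real.cos_arccos
  · have : 0 < E.width m / (4 * E.radius) := by positivity
    linarith
  · have : E.width m / (4 * E.radius) ≤ 1 / 2 := by
      rw [div_le_iff₀ (by positivity)]; linarith
    linarith

theorem uTurnLength_pos : 0 < E.uTurnLength m := by
  have := E.radius_pos
  have := E.uTurnAngle_nonneg (m := m)
  have := Real.pi_pos
  unfold uTurnLength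
  positivity

/-- The beginning of the run along strip `k`. -/
def stripStart (m : ℕ) (k : ℕ) : Pose :=
  ⟨if Even k then -E.radius else E.side + E.radius, E.bisector m k, if Even k then 0 else -Real.pi⟩

/-- The end of the run along strip `k`. -/
def stripEnd (m : ℕ) (k : ℕ) : Pose :=
  ⟨if Even k then E.side + E.radius else -E.radius, E.bisector m k, if Even k then 0 else -Real.pi⟩

theorem stripStart_advance (k : ℕ) (s : ℝ) : (E.stripStart m k).advance 0 s =
    ⟨if Even k then -E.radius + s else E.side + E.radius - s, E.bisector m k,
      if Even k then 0 else -Real.pi⟩ := by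
  rw [Pose.advance_zero_curvature]
  by_cases hk : Even k <;> simp [stripStart, hk, sub_eq_add_neg]

theorem stripStart_advance_runLength (k : ℕ) :
    (E.stripStart m k).advance 0 E.runLength = E.stripEnd m k := by
  rw [stripStart_advance]
  by_cases hk : Even k <;> simp [stripEnd, hk, runLength] <;> ring

/-- The three turns add up to a half turn without net motion along the strip, and the sideways
displacement is ρ(4 cos α − 2), which the choice of α makes equal to the width. With −π rather than
π as the heading on odd strips, the poses match exactly and not just up to full turns. -/
theorem last_uTurn (hm : 1 ≤ m) (k : ℕ) :
    Pose.last (E.uTurn m k) (E.stripEnd m k) = E.stripStart m (k + 1) := by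
  have hρ := E.radius_pos
  have hρ' : (1 / E.radius) ≠ 0 := by positivity
  have hρ'' : (-1 / E.radius) ≠ 0 := by rw [neg_div]; exact neg_ne_zero.2 hρ'
  have hc := E.cos_uTurnAngle hm
  have e1 : ∀ β, 1 / E.radius * (E.radius * β) = β := fun β => by field_simp
  have e2 : ∀ β, -1 / E.radius * (E.radius * β) = -β := fun β => by field_simp
  set α := E.uTurnAngle m with hα
  have hw : E.width m = E.radius * (4 * Real.cos α - 2) := by
    rw [hc]; field_simp; ring
  have hb : E.bisector m (k + 1) = E.bisector m k - E.width m := by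
    unfold bisector; push_cast; ring
  by_cases hk : Even k
  · have hk' : ¬ Even (k + 1) := by simpa [Nat.even_add_one] using hk
    simp only [uTurn, Pose.last_cons, Pose.last_nil, stripEnd, stripStart, turnSign, hk, hk', if_true,
      if_false, Pose.advance_of_ne_zero hρ', Pose.advance_of_ne_zero hρ'', e1, e2, hb, hw, ← hα]
    have a1 : (0 : ℝ) + α + -(Real.pi + 2 * α) = -(α + Real.pi) := by ring
    have a2 : -(α + Real.pi) + α = -Real.pi := by ring
    rw [a1, a2]
    simp only [Real.sin_neg, Real.cos_neg, Real.sin_add_pi, Real.cos_add_pi, Real.cos_pi, Real.sin_pi,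
      zero_add, Real.sin_zero, Real.cos_zero]
    apply Pose.ext'
    · field_simp; ring
    · field_simp; ring
    · rfl
  · have hk' : Even (k + 1) := by simpa [Nat.even_add_one] using hk
    simp only [uTurn, Pose.last_cons, Pose.last_nil, stripEnd, stripStart, turnSign, hk, hk', if_true,
      if_false, neg_neg, Pose.advance_of_ne_zero hρ', Pose.advance_of_ne_zero hρ'', e1, e2, hb, hw,
      ← hα]
    have a0 : -Real.pi + -α = -(α + Real.pi) := by ring
    have a1 : -(α + Real.pi) + (Real.pi + 2 * α) = α := by ring
    rw [a0, a1, add_neg_cancel]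
    simp only [Real.sin_neg, Real.cos_neg, Real.sin_add_pi, Real.cos_add_pi, Real.cos_pi, Real.sin_pi,
      Real.sin_zero, Real.cos_zero]
    apply Pose.ext'
    · field_simp; ring
    · field_simp; ring
    · rfl

/-- The runs along the first `k` strips, with the U-turns after them. -/
def firstStrips (m k : ℕ) : List (ℝ × ℝ) :=
  (List.range k).flatMap fun k => (0, E.runLength) :: E.uTurn m k

theorem firstStrips_succ (k : ℕ) :
    E.firstStrips m (k + 1) = E.firstStrips m k ++ (0, E.runLength) :: E.uTurn m k := by
  simp [firstStrips, List.range_succ, List.flatMap_append]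

theorem last_firstStrips (hm : 1 ≤ m) (k : ℕ) :
    Pose.last (E.firstStrips m k) (E.loiterStart m) = E.stripStart m k := by
  induction k with
  | zero => simp [firstStrips, loiterStart, stripStart]
  | succ k ih =>
    rw [firstStrips_succ, Pose.last_append, ih, Pose.last_cons, stripStart_advance_runLength,
      E.last_uTurn hm]

theorem sum_uTurn (k : ℕ) : ((E.uTurn m k).map Prod.snd).sum = E.uTurnLength m := by
  simp [uTurn, uTurnLength]; ring

theorem sum_firstStrips (k : ℕ) :
    ((E.firstStrips m k).map Prod.snd).sum = k * (E.runLength + E.uTurnLength m) := by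
  induction k with
  | zero => simp [firstStrips]
  | succ k ih =>
    rw [firstStrips_succ, List.map_append, List.sum_append, ih, List.map_cons, List.sum_cons, sum_uTurn]
    push_cast; ring

/-- A curvature and a length that a robot can handle. -/
def Feasible (p : ℝ × ℝ) : Prop := 0 ≤ p.2 ∧ |p.1| ≤ 1 / E.radius

theorem feasible_run : E.Feasible (0, E.runLength) :=
  ⟨E.runLength_pos.le, by simpa using E.radius_pos.le⟩

theorem feasible_uTurn (k : ℕ) : ∀ p ∈ E.uTurn m k, E.Feasible p := by
  have hρ := E.radius_pos
  have hα := E.uTurnAngle_nonneg (m := m)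
  have hπ := Real.pi_pos
  have h1 : |turnSign k| = 1 := by unfold turnSign; split_ifs <;> simp
  intro p hp
  simp only [uTurn, List.mem_cons, List.not_mem_nil, or_false] at hp
  rcases hp with rfl | rfl | rfl <;> constructor <;>
    first | positivity | (simp [abs_div, h1, abs_of_pos hρ])

theorem feasible_closure (hm : 1 ≤ m) : ∀ p ∈ E.closure m, E.Feasible p := by
  have hρ := E.radius_pos
  have hπ := Real.pi_pos
  have h4 := E.four_radius_le hm
  have hr := E.runLength_pos
  have h5 : 0 ≤ E.radius * (Real.pi / 2) := by positivity
  have h6 : 0 ≤ E.radius * Real.pi := by positivity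
  have h7 : |1 / E.radius| ≤ 1 / E.radius := (abs_of_pos (by positivity)).le
  have h8 : |-1 / E.radius| ≤ 1 / E.radius := by rw [neg_div, abs_neg]; exact h7
  have h9 : |(0 : ℝ)| ≤ 1 / E.radius := by simpa using hρ.le
  intro p hp
  unfold Setting.closure at hp
  split_ifs at hp
  · simp only [List.mem_cons, List.not_mem_nil, or_false] at hp
    rcases hp with rfl | rfl | rfl
    exacts [⟨h5, h8⟩, ⟨by simp only; linarith, h9⟩, ⟨h5, h8⟩]
  · simp only [List.mem_cons, List.not_mem_nil, or_false] at hp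
    rcases hp with rfl | rfl | rfl | rfl | rfl
    exacts [⟨h5, h7⟩, ⟨by simp only; linarith, h9⟩, ⟨h5, h7⟩, ⟨hr.le, h9⟩, ⟨h6, h7⟩]

theorem feasible_loiterPieces (hm : 1 ≤ m) : ∀ p ∈ E.loiterPieces m, E.Feasible p := by
  intro p hp
  simp only [loiterPieces, List.mem_append, List.mem_flatMap, List.mem_cons] at hp
  rcases hp with ⟨j, -, rfl | hp⟩ | hp
  · exact E.feasible_run
  · split_ifs at hp
    · exact E.feasible_uTurn j p hp
    · simp at hp
  · exact E.feasible_closure hm p hp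

theorem loiterPieces_eq (hm : 1 ≤ m) : E.loiterPieces m =
    E.firstStrips m (E.numStrips m - 1) ++ (0, E.runLength) :: E.closure m := by
  obtain ⟨n, hn⟩ : ∃ n, E.numStrips m = n + 1 := ⟨_, (Nat.succ_pred_eq_of_pos (E.numStrips_pos hm)).symm⟩
  have h : (List.range n).flatMap (fun k => (0, E.runLength) ::
      if k + 1 < n + 1 then E.uTurn m k else []) = E.firstStrips m n := by
    unfold firstStrips
    rw [List.flatMap_def, List.flatMap_def]
    congr 1
    apply List.map_congr_left
    intro k hk
    simp [List.mem_range.1 hk]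
  rw [loiterPieces, hn, Nat.add_sub_cancel, List.range_succ, List.flatMap_append, h]
  simp

theorem firstStrips_add (k d : ℕ) : ∃ l, E.firstStrips m (k + 1 + d) =
    E.firstStrips m k ++ (0, E.runLength) :: l := by
  induction d with
  | zero => exact ⟨_, E.firstStrips_succ k⟩
  | succ d ih =>
    obtain ⟨l, hl⟩ := ih
    refine ⟨l ++ (0, E.runLength) :: E.uTurn m (k + 1 + d), ?_⟩
    rw [← add_assoc, firstStrips_succ, hl, List.append_assoc, List.cons_append]

/-- Exhibits the run along strip `k` as a piece of the loop, uniformly for the last strip and the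
others; positions on it can then be computed. -/
theorem exists_loiterPieces_eq (hm : 1 ≤ m) {k : ℕ} (hk : k < E.numStrips m) :
    ∃ l, E.loiterPieces m = E.firstStrips m k ++ (0, E.runLength) :: l := by
  rw [E.loiterPieces_eq hm]
  rcases (Nat.le_sub_one_of_lt hk).eq_or_lt with h | h
  · exact ⟨_, by rw [← h]⟩
  · obtain ⟨d, hd⟩ := Nat.exists_eq_add_of_le (Nat.succ_le_of_lt h)
    obtain ⟨l, hl⟩ := E.firstStrips_add (m := m) k d
    rw [hd, Nat.succ_eq_add_one, hl]
    exact ⟨l ++ (0, E.runLength) :: E.closure m, by simp⟩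

/-- The length of the way back from the last strip to the first one. -/
def closureLength (m : ℕ) : ℝ := ((E.closure m).map Prod.snd).sum

theorem closureLength_pos (hm : 1 ≤ m) : 0 < E.closureLength m := by
  have h4 := E.four_radius_le hm
  have hρ := E.radius_pos
  have hπ := mul_pos hρ Real.pi_pos
  have hr := E.runLength_pos
  unfold closureLength Setting.closure
  split_ifs <;> simp <;> linarith

/-- The bound covers both parities and does not depend on `m`; hence the closing piece is negligible
in the limit. -/
theorem closureLength_le (hm : 1 ≤ m) :
    E.closureLength m ≤ 2 * Real.pi * E.radius + E.side + E.runLength := by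
  have h4 := (E.numStrips_sub_one_mul_lt hm).le
  have hρ := E.radius_pos
  have hπ := mul_pos hρ Real.pi_pos
  have hr := E.runLength_pos
  unfold closureLength Setting.closure
  split_ifs <;> simp <;> linarith

theorem loiterLength_eq (hm : 1 ≤ m) : E.loiterLength m =
    (E.numStrips m - 1) * (E.runLength + E.uTurnLength m) + E.runLength + E.closureLength m := by
  rw [loiterLength, E.loiterPieces_eq hm, List.map_append, List.sum_append, sum_firstStrips,
    List.map_cons, List.sum_cons, E.cast_numStrips_sub_one hm, closureLength, add_assoc]

theorem loiterLength_pos (hm : 1 ≤ m) : 0 < E.loiterLength m := by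
  rw [E.loiterLength_eq hm]
  have h1 : (1 : ℝ) ≤ E.numStrips m := by exact_mod_cast E.numStrips_pos hm
  have h2 := E.runLength_pos
  have h3 := E.uTurnLength_pos (m := m)
  have h4 := E.closureLength_pos hm
  have h5 : 0 ≤ (E.numStrips m - 1) * (E.runLength + E.uTurnLength m) :=
    mul_nonneg (by linarith) (by linarith)
  linarith

/-- The heading returns as −2π (even number of strips) or 2π (odd number) instead of 0. This is why
closedness is expressed by `Pose.Equiv`. -/
theorem last_closure (hm : 1 ≤ m) : (E.loiterStart m).Equiv
    (Pose.last (E.closure m) (E.stripEnd m (E.numStrips m - 1))) := by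
  have hρ := E.radius_pos
  have hρ' : (1 / E.radius) ≠ 0 := by positivity
  have hρ'' : (-1 / E.radius) ≠ 0 := by rw [neg_div]; exact neg_ne_zero.2 hρ'
  have e1 : ∀ β, 1 / E.radius * (E.radius * β) = β := fun β => by field_simp
  have e2 : ∀ β, -1 / E.radius * (E.radius * β) = -β := fun β => by field_simp
  have hb : E.bisector m (E.numStrips m - 1 : ℕ) =
      E.bisector m 0 - (E.numStrips m - 1) * E.width m := by
    unfold bisector; rw [E.cast_numStrips_sub_one hm]; push_cast; ring
  by_cases hk : Even (E.numStrips m)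
  · have hk' : ¬ Even (E.numStrips m - 1) := by
      rw [Nat.even_sub (E.numStrips_pos hm)]; simp [hk]
    simp only [Setting.closure, Pose.last_cons, Pose.last_nil, stripEnd, loiterStart, hk, hk', if_true,
      if_false, Pose.advance_of_ne_zero hρ'', Pose.advance_zero_curvature, e2, hb]
    have a0 : -Real.pi + -(Real.pi / 2) = -(Real.pi / 2 + Real.pi) := by ring
    have a1 : -(Real.pi / 2 + Real.pi) + -(Real.pi / 2) = -(2 * Real.pi) := by ring
    rw [a0, a1]
    simp only [Real.sin_neg, Real.cos_neg, Real.sin_add_pi, Real.cos_add_pi, Real.cos_pi, Real.sin_pi,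
      Real.sin_pi_div_two, Real.cos_pi_div_two, Real.sin_two_pi, Real.cos_two_pi]
    refine ⟨?_, ?_, -1, ?_⟩
    · field_simp; ring
    · field_simp; ring
    · push_cast; ring
  · have hk' : Even (E.numStrips m - 1) := by
      rw [Nat.even_sub (E.numStrips_pos hm)]; simp [hk]
    simp only [Setting.closure, Pose.last_cons, Pose.last_nil, stripEnd, loiterStart, hk, hk', if_true,
      if_false, Pose.advance_of_ne_zero hρ', Pose.advance_zero_curvature, e1, hb]
    have a0 : (0 : ℝ) + Real.pi / 2 = Real.pi / 2 := by ring
    have a1 : Real.pi / 2 + Real.pi / 2 = Real.pi := by ring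
    have a2 : Real.pi + Real.pi = 2 * Real.pi := by ring
    rw [a0, a1, a2]
    simp only [Real.cos_pi, Real.sin_pi, Real.sin_zero, Real.cos_zero,
      Real.sin_pi_div_two, Real.cos_pi_div_two, Real.sin_two_pi, Real.cos_two_pi]
    refine ⟨?_, ?_, 1, ?_⟩
    · field_simp; unfold runLength; ring
    · field_simp; ring
    · push_cast; ring

/-- The loitering path is closed. -/
theorem last_loiterPieces (hm : 1 ≤ m) :
    (E.loiterStart m).Equiv (Pose.last (E.loiterPieces m) (E.loiterStart m)) := by
  rw [E.loiterPieces_eq hm, Pose.last_append, E.last_firstStrips hm, Pose.last_cons,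
    stripStart_advance_runLength]
  exact E.last_closure hm

theorem loiterPose_eq (hm : 1 ≤ m) {s : ℝ} (h0 : 0 ≤ s) (hs : s < E.loiterLength m) :
    E.loiterPose m s = Pose.follow (E.loiterPieces m) (E.loiterStart m) s := by
  have hL := E.loiterLength_pos hm
  rw [loiterPose, Int.fract_eq_self.2 ⟨by positivity, (div_lt_one hL).2 hs⟩]
  congr 1
  field_simp

theorem loiterPose_add (hm : 1 ≤ m) (s : ℝ) (k : ℤ) :
    E.loiterPose m (s + k * E.loiterLength m) = E.loiterPose m s := by
  have hL := (E.loiterLength_pos hm).ne'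
  rw [loiterPose, loiterPose, add_div, mul_div_cancel_right₀ _ hL, Int.fract_add_intCast]

theorem loiterPose_strip (hm : 1 ≤ m) {k : ℕ} (hk : k < E.numStrips m) {s : ℝ} (h0 : 0 ≤ s)
    (hs : s ≤ E.runLength) : E.loiterPose m (k * (E.runLength + E.uTurnLength m) + s) =
      (E.stripStart m k).advance 0 s := by
  have h1 := E.runLength_pos
  have h2 := E.uTurnLength_pos (m := m)
  have h3 := E.closureLength_pos hm
  have hk' : (k : ℝ) ≤ E.numStrips m - 1 := by
    rw [← E.cast_numStrips_sub_one hm]; exact_mod_cast Nat.le_sub_one_of_lt hk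
  have h4 : k * (E.runLength + E.uTurnLength m) ≤
      (E.numStrips m - 1) * (E.runLength + E.uTurnLength m) := by gcongr
  rw [E.loiterPose_eq hm (by positivity) (by rw [E.loiterLength_eq hm]; linarith)]
  obtain ⟨l, hl⟩ := E.exists_loiterPieces_eq hm hk
  have hf := E.feasible_loiterPieces hm
  rw [hl] at hf ⊢
  rw [Pose.follow_append_of_le (fun p hp => (hf p (by simp [hp])).1)
    (fun p hp => (hf p (List.mem_append_right _ hp)).1) _
    (by rw [sum_firstStrips]; linarith), sum_firstStrips, E.last_firstStrips hm]
  simp [Pose.follow, hs]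

/-- After each of its points, the loitering path continues along a path of constant curvature. -/
theorem loiterPose_after (hm : 1 ≤ m) (s : ℝ) : ∃ κ, |κ| ≤ 1 / E.radius ∧
    ∀ᶠ r in 𝓝[≥] s, (E.loiterPose m r).Equiv ((E.loiterPose m s).advance κ (r - s)) := by
  have hL := E.loiterLength_pos hm
  have hf := E.feasible_loiterPieces hm
  set L := E.loiterLength m with hLdef
  have key : ∀ k : ℤ, ∀ r, k * L ≤ r → r < (k + 1) * L →
      E.loiterPose m r = Pose.follow (E.loiterPieces m) (E.loiterStart m) (r - k * L) := by
    intro k r h1 h2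
    rw [← E.loiterPose_eq hm (by linarith) (by linarith), ← E.loiterPose_add hm (r - k * L) k,
      ← hLdef, sub_add_cancel]
  have h1 : ⌊s / L⌋ * L ≤ s := (le_div_iff₀ hL).1 (Int.floor_le _)
  have h2 : s < (⌊s / L⌋ + 1) * L := (div_lt_iff₀ hL).1 (Int.lt_floor_add_one _)
  set k := ⌊s / L⌋
  obtain ⟨κ, hκ, h⟩ := Pose.follow_after (fun p hp => (hf p hp).1) (fun p hp => (hf p hp).2)
    (E.loiterStart m) (s := s - k * L) (by linarith) (by change _ < L; linarith)
  refine ⟨κ, hκ, ?_⟩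
  have ht : Tendsto (fun r => r - k * L) (𝓝[≥] s) (𝓝[≥] (s - k * L)) := by
    refine tendsto_nhdsWithin_iff.2 ⟨((continuous_id.sub continuous_const).tendsto _).mono_left
      nhdsWithin_le_nhds, ?_⟩
    filter_upwards [self_mem_nhdsWithin] with r hr
    have hr : s ≤ r := hr
    simp [hr]
  filter_upwards [ht.eventually h, self_mem_nhdsWithin,
    mem_nhdsWithin_of_mem_nhds (Iio_mem_nhds h2)] with r hr hsr hr2
  have hsr : s ≤ r := hsr
  rw [key k r (by linarith) hr2, hr, key k s h1 h2]
  rw [show r - k * L - (s - k * L) = r - s by ring]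
  exact Pose.Equiv.refl _

/-- To each of its points, the loitering path leads along a path of constant curvature. -/
theorem loiterPose_before (hm : 1 ≤ m) (s : ℝ) : ∃ κ, |κ| ≤ 1 / E.radius ∧
    ∀ᶠ r in 𝓝[≤] s, (E.loiterPose m r).Equiv ((E.loiterPose m s).advance κ (r - s)) := by
  have hL := E.loiterLength_pos hm
  have hf := E.feasible_loiterPieces hm
  set L := E.loiterLength m with hLdef
  have key : ∀ k : ℤ, ∀ r, k * L ≤ r → r ≤ (k + 1) * L → (E.loiterPose m r).Equiv
      (Pose.follow (E.loiterPieces m) (E.loiterStart m) (r - k * L)) := by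
    intro k r h1 h2
    rcases h2.eq_or_lt with h2 | h2
    · rw [h2, show (k + 1) * L - k * L = L by ring]
      have e1 : E.loiterPose m ((k + 1) * L) = E.loiterStart m := by
        have := E.loiterPose_add hm 0 (k + 1)
        rw [zero_add] at this
        push_cast at this
        rw [this, E.loiterPose_eq hm le_rfl hL, Pose.follow_zero (fun p hp => (hf p hp).1)]
      rw [e1]
      change Pose.Equiv _ (Pose.follow _ _ ((E.loiterPieces m).map Prod.snd).sum)
      rw [Pose.follow_sum (fun p hp => (hf p hp).1)]
      exact E.last_loiterPieces hm
    · rw [← E.loiterPose_eq hm (by linarith) (by linarith), ← E.loiterPose_add hm (r - k * L) k,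
        ← hLdef, sub_add_cancel]
      exact Pose.Equiv.refl _
  -- Periods are taken open on the left, so that the point where the path closes is approached
  -- through the end of the list of pieces. There the pose agrees with the initial one only up to a
  -- full turn.
  have h1 : (⌈s / L⌉ - 1) * L < s := (lt_div_iff₀ hL).1 (by linarith [Int.ceil_lt_add_one (s / L)])
  have h2 : s ≤ (⌈s / L⌉ - 1 + 1) * L := (div_le_iff₀ hL).1 (by linarith [Int.le_ceil (s / L)])
  obtain ⟨k, hk⟩ : ∃ k : ℤ, (k : ℝ) = ⌈s / L⌉ - 1 := ⟨⌈s / L⌉ - 1, by push_cast; rfl⟩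
  rw [← hk] at h1 h2
  obtain ⟨κ, hκ, h⟩ := Pose.follow_before (fun p hp => (hf p hp).1) (fun p hp => (hf p hp).2)
    (E.loiterStart m) (s := s - k * L) (by linarith) (by change _ ≤ L; linarith)
  refine ⟨κ, hκ, ?_⟩
  have ht : Tendsto (fun r => r - k * L) (𝓝[≤] s) (𝓝[≤] (s - k * L)) := by
    refine tendsto_nhdsWithin_iff.2 ⟨((continuous_id.sub continuous_const).tendsto _).mono_left
      nhdsWithin_le_nhds, ?_⟩
    filter_upwards [self_mem_nhdsWithin] with r hr
    have hr : r ≤ s := hr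
    simp [hr]
  filter_upwards [ht.eventually h, self_mem_nhdsWithin,
    mem_nhdsWithin_of_mem_nhds (Ioi_mem_nhds h1)] with r hr hsr hr2
  have hsr : r ≤ s := hsr
  have hr2 : k * L < r := hr2
  have e := key k r hr2.le (hsr.trans h2)
  rw [hr, show r - k * L - (s - k * L) = r - s by ring] at e
  have e' := (key k s h1.le h2).advance κ (r - s)
  obtain ⟨x1, y1, a, ha⟩ := e
  obtain ⟨x2, y2, b, hb⟩ := e'
  refine ⟨x1.trans x2.symm, y1.trans y2.symm, a - b, ?_⟩
  push_cast
  linarith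

end Setting

theorem measurable_plane_mk {α : Type*} [MeasurableSpace α] {f g : α → ℝ} (hf : Measurable f)
    (hg : Measurable g) : Measurable fun a => (!₂[f a, g a] : Plane) := by
  have h : Measurable fun a => ![f a, g a] := by
    rw [measurable_pi_iff]
    intro i
    fin_cases i
    · simpa using hf
    · simpa using hg
  exact (MeasurableEquiv.toLp 2 (Fin 2 → ℝ)).measurable.comp h

theorem measurable_coord (i : Fin 2) : Measurable fun q : Plane => q i :=
  (PiLp.continuous_apply 2 _ i).measurable

namespace Setting

variable (E : Setting) {m : ℕ}

/-! ### The arc to the target -/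

theorem stripOf_lt (hm : 1 ≤ m) (q : Plane) : E.stripOf m q < E.numStrips m :=
  (min_le_right _ _).trans_lt (Nat.sub_lt (E.numStrips_pos hm) one_pos)

/-- The minimum in `stripOf` matters only on the lower side of the square, when the strips fill the
square exactly; the target then belongs to the last strip. -/
theorem stripOf_bounds (hm : 1 ≤ m) {q : Plane} (hq : q ∈ E.square) :
    E.stripOf m q * E.width m ≤ E.side - q 1 ∧ E.side - q 1 ≤ (E.stripOf m q + 1) * E.width m := by
  have hw := E.width_pos hm
  have h0 : 0 ≤ (E.side - q 1) / E.width m := div_nonneg (by linarith [(hq 1).2]) hw.le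
  constructor
  · rw [← le_div_iff₀ hw]
    refine le_trans ?_ (Nat.floor_le h0)
    exact_mod_cast min_le_left _ _
  · unfold stripOf
    rcases le_total ⌊(E.side - q 1) / E.width m⌋₊ (E.numStrips m - 1) with h | h
    · rw [min_eq_left h, ← div_le_iff₀ hw]
      exact (Nat.lt_floor_add_one _).le
    · rw [min_eq_right h, E.cast_numStrips_sub_one hm, sub_add_cancel]
      linarith [E.side_le hm, (hq 1).1]

theorem offset_nonneg (q : Plane) : 0 ≤ E.offset m q := abs_nonneg _

theorem offset_le (hm : 1 ≤ m) {q : Plane} (hq : q ∈ E.square) :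
    E.offset m q ≤ E.width m / 2 := by
  obtain ⟨h1, h2⟩ := E.stripOf_bounds hm hq
  unfold offset bisector
  rw [abs_le]
  constructor <;> linarith

/-- The angle of the arc to the target. -/
def serviceAngle (m : ℕ) (q : Plane) : ℝ := 2 * Real.arcsin √(E.offset m q / (2 * E.radius))

theorem serviceLength_eq (q : Plane) : E.serviceLength m q = E.radius * E.serviceAngle m q := by
  unfold serviceLength serviceAngle; ring

theorem serviceAngle_nonneg (q : Plane) : 0 ≤ E.serviceAngle m q :=
  mul_nonneg zero_le_two (Real.arcsin_nonneg.2 (Real.sqrt_nonneg _))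

theorem serviceAngle_le_pi (q : Plane) : E.serviceAngle m q ≤ Real.pi := by
  have := Real.arcsin_le_pi_div_two √(E.offset m q / (2 * E.radius))
  unfold serviceAngle; linarith

theorem serviceLength_nonneg (q : Plane) : 0 ≤ E.serviceLength m q := by
  rw [serviceLength_eq]
  exact mul_nonneg E.radius_pos.le (E.serviceAngle_nonneg q)

theorem serviceLength_le (q : Plane) : E.serviceLength m q ≤ 2 * Real.pi * E.radius := by
  rw [serviceLength_eq]
  have := E.serviceAngle_le_pi (m := m) q
  have h1 := E.radius_pos
  have h2 := Real.pi_pos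
  nlinarith

/-- By the half-angle formula. An arc of radius ρ and angle φ that leaves a line tangentially ends
at distance ρ(1 − cos φ) from it, so this is the angle that leads to the target. -/
theorem cos_serviceAngle (hm : 1 ≤ m) {q : Plane} (hq : q ∈ E.square) :
    Real.cos (E.serviceAngle m q) = 1 - E.offset m q / E.radius := by
  have h1 := E.offset_le hm hq
  have h2 := E.width_le m
  have h3 := E.radius_pos
  have h4 := E.offset_nonneg (m := m) q
  have h5 : E.offset m q / (2 * E.radius) ≤ 1 := by rw [div_le_one (by positivity)]; linarith
  rw [serviceAngle, Real.cos_two_mul', Real.cos_sq', Real.sin_arcsin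
    (by linarith [Real.sqrt_nonneg (E.offset m q / (2 * E.radius))]) (Real.sqrt_le_one.2 h5),
    Real.sq_sqrt (by positivity)]
  field_simp; ring

/-- The offset is at most w/2 ≤ ρ, so the cosine is nonnegative. On this range of angles the sine is
injective, which `point_advance_ne` needs. -/
theorem serviceAngle_le (hm : 1 ≤ m) {q : Plane} (hq : q ∈ E.square) :
    E.serviceAngle m q ≤ Real.pi / 2 := by
  by_contra! h
  have h1 := Real.cos_neg_of_pi_div_two_lt_of_lt h
    (by linarith [E.serviceAngle_le_pi (m := m) q, Real.pi_pos])
  rw [E.cos_serviceAngle hm hq] at h1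
  have h2 := E.offset_le hm hq
  have h3 := E.width_le m
  have h4 : E.offset m q / E.radius ≤ 1 := by rw [div_le_one E.radius_pos]; linarith
  linarith

theorem departure_eq (q : Plane) : E.departure m q =
    E.stripOf m q * (E.runLength + E.uTurnLength m) +
      ((if Even (E.stripOf m q) then q 0 + E.radius else E.side + E.radius - q 0)
        - E.radius * Real.sin (E.serviceAngle m q)) := by
  rw [departure, serviceLength_eq, mul_div_cancel_left₀ _ E.radius_pos.ne']
  ring

/-- The arc begins at most ρ before the target, and each run begins ρ before the square; so the
point of departure lies on the run along the strip of the target. -/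
theorem loiterPose_departure (hm : 1 ≤ m) {q : Plane} (hq : q ∈ E.square) :
    E.loiterPose m (E.departure m q) =
      ⟨if Even (E.stripOf m q) then q 0 - E.radius * Real.sin (E.serviceAngle m q)
        else q 0 + E.radius * Real.sin (E.serviceAngle m q), E.bisector m (E.stripOf m q),
        if Even (E.stripOf m q) then 0 else -Real.pi⟩ := by
  have h1 := Real.sin_nonneg_of_nonneg_of_le_pi (E.serviceAngle_nonneg q) (E.serviceAngle_le_pi (m := m) q)
  have h2 := Real.sin_le_one (E.serviceAngle m q)
  have h3 := E.radius_pos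
  have h4 : 0 ≤ E.radius * Real.sin (E.serviceAngle m q) := by positivity
  have h5 : E.radius * Real.sin (E.serviceAngle m q) ≤ E.radius := by nlinarith
  have h6 := hq 0
  rw [departure_eq, E.loiterPose_strip hm (E.stripOf_lt hm q), stripStart_advance]
  · by_cases h : Even (E.stripOf m q) <;> simp only [h, if_true, if_false] <;> congr 1 <;> ring
  · split_ifs <;> linarith
  · unfold runLength
    split_ifs <;> linarith

/-- The side of the bisector on which the target lies. -/
def targetSide (m : ℕ) (q : Plane) : ℝ := if E.bisector m (E.stripOf m q) ≤ q 1 then 1 else -1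

theorem targetSide_mul_offset (q : Plane) :
    E.targetSide m q * E.offset m q = q 1 - E.bisector m (E.stripOf m q) := by
  unfold targetSide offset
  split_ifs with h
  · rw [abs_of_nonneg (by linarith)]; ring
  · rw [abs_of_neg (by linarith)]; ring

theorem serviceCurvature_eq_or (q : Plane) :
    E.serviceCurvature m q = 1 / E.radius ∨ E.serviceCurvature m q = -1 / E.radius := by
  unfold serviceCurvature turnSign
  split_ifs <;> simp

theorem serviceCurvature_ne_zero (q : Plane) : E.serviceCurvature m q ≠ 0 := by
  have := E.radius_pos
  rcases E.serviceCurvature_eq_or (m := m) q with h | h <;> rw [h]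
  · positivity
  · rw [neg_div]; exact neg_ne_zero.2 (by positivity)

theorem abs_serviceCurvature (q : Plane) : |E.serviceCurvature m q| = 1 / E.radius := by
  have := E.radius_pos
  rcases E.serviceCurvature_eq_or (m := m) q with h | h <;> rw [h]
  · exact abs_of_pos (by positivity)
  · rw [neg_div, abs_neg]; exact abs_of_pos (by positivity)

theorem point_advance_departure (hm : 1 ≤ m) {q : Plane} (hq : q ∈ E.square) (s : ℝ) :
    ((E.loiterPose m (E.departure m q)).advance (E.serviceCurvature m q) s).point =
      !₂[q 0 + turnSign (E.stripOf m q) *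
          (E.radius * (Real.sin (s / E.radius) - Real.sin (E.serviceAngle m q))),
        E.bisector m (E.stripOf m q) +
          E.targetSide m q * (E.radius * (1 - Real.cos (s / E.radius)))] := by
  have hρ := E.radius_pos
  have hκ := E.serviceCurvature_ne_zero (m := m) q
  have h1 : -1 / E.radius * s = -(s / E.radius) := by ring
  have h2 : 1 / E.radius * s = s / E.radius := by ring
  rw [Pose.advance_of_ne_zero hκ, E.loiterPose_departure hm hq, Pose.point]
  unfold serviceCurvature targetSide turnSign
  by_cases ha : Even (E.stripOf m q) <;> by_cases hb : E.bisector m (E.stripOf m q) ≤ q 1 <;>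
    simp only [ha, hb, if_true, if_false, one_mul, mul_one, neg_mul, neg_neg, h1, h2, Real.sin_neg,
      Real.cos_neg, zero_add, Real.sin_zero, Real.cos_zero, Real.sin_pi, Real.cos_pi,
      Real.sin_add, Real.cos_add] <;>
    congr 2 <;> field_simp <;> ring_nf

theorem point_advance_serviceLength (hm : 1 ≤ m) {q : Plane} (hq : q ∈ E.square) :
    ((E.loiterPose m (E.departure m q)).advance (E.serviceCurvature m q)
      (E.serviceLength m q)).point = q := by
  have hρ := E.radius_pos
  have h1 := E.targetSide_mul_offset (m := m) q
  rw [E.point_advance_departure hm hq, serviceLength_eq, mul_div_cancel_left₀ _ hρ.ne',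
    E.cos_serviceAngle hm hq]
  have h2 : E.radius * (1 - (1 - E.offset m q / E.radius)) = E.offset m q := by field_simp; ring
  rw [h2, h1]
  ext i
  fin_cases i <;> simp

/-- Along the arc the horizontal coordinate is strictly monotone, since the sine increases up to the
quarter turn; the target is met only at the end. -/
theorem point_advance_ne (hm : 1 ≤ m) {q : Plane} (hq : q ∈ E.square) {s : ℝ} (h0 : 0 ≤ s)
    (hs : s < E.serviceLength m q) :
    ((E.loiterPose m (E.departure m q)).advance (E.serviceCurvature m q) s).point ≠ q := by
  have hρ := E.radius_pos
  rw [E.point_advance_departure hm hq]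
  intro h
  have h' := congrArg (fun p : Plane => p 0) h
  have h1 : s / E.radius < E.serviceAngle m q := by
    rwa [div_lt_iff₀ hρ, mul_comm, ← serviceLength_eq]
  have h2 : Real.sin (s / E.radius) < Real.sin (E.serviceAngle m q) := by
    apply Real.sin_lt_sin_of_lt_of_le_pi_div_two _ (E.serviceAngle_le hm hq) h1
    have : 0 ≤ s / E.radius := by positivity
    linarith [Real.pi_pos]
  have h3 : turnSign (E.stripOf m q) ≠ 0 := by unfold turnSign; split_ifs <;> simp
  simp [h3, hρ.ne', sub_eq_zero] at h'
  exact h2.ne h'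

/-! ### The responsible robot -/

theorem approachLength_nonneg (hm : 1 ≤ m) (c : ℝ) (i : Fin m) (t : ℝ) (q : Plane) :
    0 ≤ E.approachLength m c i t q :=
  mul_nonneg (E.loiterLength_pos hm).le (Int.fract_nonneg _)

theorem approachLength_lt (hm : 1 ≤ m) (c : ℝ) (i : Fin m) (t : ℝ) (q : Plane) :
    E.approachLength m c i t q < E.loiterLength m := by
  have := mul_lt_mul_of_pos_left (Int.fract_lt_one ((E.departure m q - E.place m c i t) /
    E.loiterLength m)) (E.loiterLength_pos hm)
  rwa [mul_one] at this

theorem exists_responsible (hm : 1 ≤ m) (c t : ℝ) (q : Plane) : ∃ i, E.Responsible m c i t q := by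
  have : Nonempty (Fin m) := ⟨⟨0, hm⟩⟩
  exact Finite.exists_min fun i => E.approachLength m c i t q

/-- A robot that has followed the loitering path over the length of the approach is at the point of
departure. -/
theorem loiterPose_place_eq_departure (hm : 1 ≤ m) {c : ℝ} {i : Fin m} {S t : ℝ} {q : Plane} {j : ℕ}
    (h : E.speed * (t - S) - E.approachLength m c i S q = j * E.loiterLength m) :
    E.loiterPose m (E.place m c i t) = E.loiterPose m (E.departure m q) := by
  have hL := E.loiterLength_pos hm
  have h1 : E.place m c i t = E.departure m q +
      ((j - ⌊(E.departure m q - E.place m c i S) / E.loiterLength m⌋ : ℤ) : ℝ) *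
        E.loiterLength m := by
    have h2 : E.place m c i t = E.place m c i S + E.speed * (t - S) := by unfold place; ring
    have h3 : E.speed * (t - S) = j * E.loiterLength m + E.approachLength m c i S q := by linarith
    rw [h2, h3, approachLength, Int.fract]
    push_cast
    field_simp
    ring
  rw [h1, E.loiterPose_add hm]

/-! ### Excursions from the loitering path -/

/-- An excursion consists of a full circle through the target and another one; together they are
this many times as long as the loitering path. -/
def excursionTurns (m : ℕ) : ℕ := ⌈4 * Real.pi * E.radius / E.loiterLength m⌉₊

/-- The length of an excursion. -/
def excursionLength (m : ℕ) : ℝ := E.excursionTurns m * E.loiterLength m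

theorem le_excursionLength (hm : 1 ≤ m) : 4 * Real.pi * E.radius ≤ E.excursionLength m := by
  have := Nat.le_ceil (4 * Real.pi * E.radius / E.loiterLength m)
  rwa [div_le_iff₀ (E.loiterLength_pos hm)] at this

/-- The motion of robot `i` when it stays at its place. -/
def loiter (m : ℕ) (i : Fin m) (t : ℝ) : Plane := (E.loiterPose m (E.place m 0 i t)).point

/-- The length of the path of robot `i`, since time `S`, beyond the point of departure. -/
def excess (m : ℕ) (i : Fin m) (S : ℝ) (q : Plane) (t : ℝ) : ℝ :=
  E.speed * (t - S) - E.approachLength m 0 i S q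

/-- The curvature of the second circle of an excursion. -/
def idleCurvature (m : ℕ) : ℝ := 2 * Real.pi / (E.excursionLength m - 2 * Real.pi * E.radius)

open Classical in
/-- The motion of robot `i` that serves the target `q` from time `S` on if it is responsible. -/
def excursion (m : ℕ) (i : Fin m) (S : ℝ) (q : Plane) (t : ℝ) : Plane :=
  if E.Responsible m 0 i S q ∧ 0 < E.excess m i S q t ∧ E.excess m i S q t < E.excursionLength m then
    if E.excess m i S q t ≤ 2 * Real.pi * E.radius then
      ((E.loiterPose m (E.departure m q)).advance (E.serviceCurvature m q)
        (E.excess m i S q t)).point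
    else
      ((E.loiterPose m (E.departure m q)).advance (E.idleCurvature m)
        (E.excess m i S q t - 2 * Real.pi * E.radius)).point
  else E.loiter m i t

theorem idleCurvature_pos (hm : 1 ≤ m) : 0 < E.idleCurvature m := by
  have h1 := E.le_excursionLength hm
  have h2 := mul_pos Real.pi_pos E.radius_pos
  exact div_pos (by linarith [Real.pi_pos]) (by linarith)

/-- The second circle is at least 2πρ long because the whole excursion is at least 4πρ long; so its
radius is at least ρ. -/
theorem abs_idleCurvature (hm : 1 ≤ m) : |E.idleCurvature m| ≤ 1 / E.radius := by
  have h1 := E.le_excursionLength hm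
  have h2 := mul_pos Real.pi_pos E.radius_pos
  rw [abs_of_pos (E.idleCurvature_pos hm), idleCurvature,
    div_le_div_iff₀ (by linarith) E.radius_pos]
  linarith

theorem equiv_advance_circle (q : Plane) (g : Pose) :
    g.Equiv (g.advance (E.serviceCurvature m q) (2 * Real.pi * E.radius)) := by
  have hρ := E.radius_pos
  rcases E.serviceCurvature_eq_or (m := m) q with h | h <;> rw [h]
  · apply Pose.advance_full_circle _ 1 one_ne_zero; push_cast; field_simp
  · apply Pose.advance_full_circle _ (-1) (by norm_num); push_cast; field_simp

theorem equiv_advance_idle (hm : 1 ≤ m) (g : Pose) :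
    g.Equiv (g.advance (E.idleCurvature m) (E.excursionLength m - 2 * Real.pi * E.radius)) := by
  have h1 := E.le_excursionLength hm
  have h2 := mul_pos Real.pi_pos E.radius_pos
  apply Pose.advance_full_circle _ 1 one_ne_zero
  rw [idleCurvature, div_mul_cancel₀ _ (by linarith)]
  push_cast; ring

variable {i : Fin m} {S t : ℝ} {q : Plane}

theorem excursion_of_not_responsible (h : ¬ E.Responsible m 0 i S q) (t : ℝ) :
    E.excursion m i S q t = E.loiter m i t := by
  simp [excursion, h]

theorem excursion_of_nonpos (h : E.excess m i S q t ≤ 0) :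
    E.excursion m i S q t = E.loiter m i t := by
  simp [excursion, not_lt.2 h]

theorem excursion_of_ge (h : E.excursionLength m ≤ E.excess m i S q t) :
    E.excursion m i S q t = E.loiter m i t := by
  simp [excursion, not_lt.2 h]

theorem loiterPose_place_of_excess_eq_zero (hm : 1 ≤ m) (h : E.excess m i S q t = 0) :
    E.loiterPose m (E.place m 0 i t) = E.loiterPose m (E.departure m q) :=
  E.loiterPose_place_eq_departure hm (j := 0) (by rw [← excess, h]; simp)

/-- The length of an excursion is a multiple of the length of the loop, so the place of the robot is
at the point of departure again when the excursion ends. -/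
theorem loiterPose_place_of_excess_eq (hm : 1 ≤ m) (h : E.excess m i S q t = E.excursionLength m) :
    E.loiterPose m (E.place m 0 i t) = E.loiterPose m (E.departure m q) :=
  E.loiterPose_place_eq_departure hm (j := E.excursionTurns m) (by rw [← excess, h]; rfl)

theorem excursion_first (hm : 1 ≤ m) (hr : E.Responsible m 0 i S q) (h0 : 0 ≤ E.excess m i S q t)
    (h1 : E.excess m i S q t ≤ 2 * Real.pi * E.radius) :
    E.excursion m i S q t = ((E.loiterPose m (E.departure m q)).advance (E.serviceCurvature m q)
      (E.excess m i S q t)).point := by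
  rcases h0.eq_or_lt with h0 | h0
  · rw [E.excursion_of_nonpos h0.symm.le, ← h0, Pose.advance_zero, loiter,
      E.loiterPose_place_of_excess_eq_zero hm h0.symm]
  · have h2 := E.le_excursionLength hm
    have h3 := mul_pos Real.pi_pos E.radius_pos
    rw [excursion, if_pos ⟨hr, h0, by linarith⟩, if_pos h1]

/-- At both ends of the closed interval the adjacent formulas give the same point, since each circle
closes up. This overlap allows the pieces to be joined. -/
theorem excursion_second (hm : 1 ≤ m) (hr : E.Responsible m 0 i S q)
    (h0 : 2 * Real.pi * E.radius ≤ E.excess m i S q t)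
    (h1 : E.excess m i S q t ≤ E.excursionLength m) :
    E.excursion m i S q t = ((E.loiterPose m (E.departure m q)).advance (E.idleCurvature m)
      (E.excess m i S q t - 2 * Real.pi * E.radius)).point := by
  have h3 := mul_pos Real.pi_pos E.radius_pos
  rcases h1.eq_or_lt with h1 | h1
  · rw [E.excursion_of_ge h1.symm.le, h1, loiter, E.loiterPose_place_of_excess_eq hm h1]
    exact (E.equiv_advance_idle hm _).point
  rcases h0.eq_or_lt with h0 | h0
  · rw [E.excursion_first hm hr (by linarith) h0.symm.le, ← h0, sub_self, Pose.advance_zero]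
    exact (E.equiv_advance_circle q _).point.symm
  · rw [excursion, if_pos ⟨hr, by linarith, h1⟩, if_neg (not_le.2 h0)]

theorem steersAfter_loiter (hm : 1 ≤ m) (i : Fin m) (t : ℝ) :
    SteersAfter E.speed (1 / E.radius) (E.loiter m i) t (E.loiterPose m (E.place m 0 i t)) := by
  obtain ⟨κ, hκ, h⟩ := E.loiterPose_after hm (E.place m 0 i t)
  refine ⟨κ, hκ, ?_⟩
  have hc : Continuous (E.place m 0 i) := by unfold place; fun_prop
  have ht : Tendsto (E.place m 0 i) (𝓝[≥] t) (𝓝[≥] (E.place m 0 i t)) := by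
    refine tendsto_nhdsWithin_iff.2 ⟨(hc.tendsto _).mono_left nhdsWithin_le_nhds, ?_⟩
    filter_upwards [self_mem_nhdsWithin] with r hr
    have := mul_le_mul_of_nonneg_left (show t ≤ r from hr) E.speed_pos.le
    simp only [Set.mem_Ici, place]; linarith
  filter_upwards [ht.eventually h] with r hr
  rw [loiter, hr.point, place, place]
  congr 2; ring

theorem steersBefore_loiter (hm : 1 ≤ m) (i : Fin m) (t : ℝ) :
    SteersBefore E.speed (1 / E.radius) (E.loiter m i) t (E.loiterPose m (E.place m 0 i t)) := by
  obtain ⟨κ, hκ, h⟩ := E.loiterPose_before hm (E.place m 0 i t)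
  refine ⟨κ, hκ, ?_⟩
  have hc : Continuous (E.place m 0 i) := by unfold place; fun_prop
  have ht : Tendsto (E.place m 0 i) (𝓝[≤] t) (𝓝[≤] (E.place m 0 i t)) := by
    refine tendsto_nhdsWithin_iff.2 ⟨(hc.tendsto _).mono_left nhdsWithin_le_nhds, ?_⟩
    filter_upwards [self_mem_nhdsWithin] with r hr
    have := mul_le_mul_of_nonneg_left (show r ≤ t from hr) E.speed_pos.le
    simp only [Set.mem_Iic, place]; linarith
  filter_upwards [ht.eventually h] with r hr
  rw [loiter, hr.point, place, place]
  congr 2; ring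

theorem steers_loiter (hm : 1 ≤ m) (i : Fin m) : Steers E.speed (1 / E.radius) (E.loiter m i) :=
  fun t => ⟨_, E.steersAfter_loiter hm i t, E.steersBefore_loiter hm i t⟩

theorem excess_eq (a : ℝ) (t : ℝ) : E.excess m i S q t - a =
    E.speed * (t - (S + (E.approachLength m 0 i S q + a) / E.speed)) := by
  have := E.speed_pos
  unfold excess; field_simp; ring

theorem continuous_excess : Continuous (E.excess m i S q) := by unfold excess; fun_prop

theorem excess_mono : Monotone (E.excess m i S q) := fun a b hab => by
  have := mul_le_mul_of_nonneg_left hab E.speed_pos.le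
  unfold excess; linarith

theorem steersAfter_first (hm : 1 ≤ m) (hr : E.Responsible m 0 i S q)
    (h0 : 0 ≤ E.excess m i S q t) (h1 : E.excess m i S q t < 2 * Real.pi * E.radius) :
    SteersAfter E.speed (1 / E.radius) (E.excursion m i S q) t
      ((E.loiterPose m (E.departure m q)).advance (E.serviceCurvature m q) (E.excess m i S q t)) := by
  have he := E.excess_eq (m := m) (i := i) (S := S) (q := q) 0
  simp only [sub_zero] at he
  rw [he t]
  apply steersAfter_advance (E.abs_serviceCurvature q).le
  filter_upwards [self_mem_nhdsWithin, mem_nhdsWithin_of_mem_nhds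
    (E.continuous_excess.continuousAt.eventually_lt continuousAt_const h1)] with s hs hs'
  rw [← he s]
  exact E.excursion_first hm hr (h0.trans (E.excess_mono hs)) (le_of_lt hs')

theorem steersBefore_first (hm : 1 ≤ m) (hr : E.Responsible m 0 i S q)
    (h0 : 0 < E.excess m i S q t) (h1 : E.excess m i S q t ≤ 2 * Real.pi * E.radius) :
    SteersBefore E.speed (1 / E.radius) (E.excursion m i S q) t
      ((E.loiterPose m (E.departure m q)).advance (E.serviceCurvature m q) (E.excess m i S q t)) := by
  have he := E.excess_eq (m := m) (i := i) (S := S) (q := q) 0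
  simp only [sub_zero] at he
  rw [he t]
  apply steersBefore_advance (E.abs_serviceCurvature q).le
  filter_upwards [self_mem_nhdsWithin, mem_nhdsWithin_of_mem_nhds
    (continuousAt_const.eventually_lt E.continuous_excess.continuousAt h0)] with s hs hs'
  rw [← he s]
  exact E.excursion_first hm hr (le_of_lt hs') ((E.excess_mono hs).trans h1)

theorem steersAfter_second (hm : 1 ≤ m) (hr : E.Responsible m 0 i S q)
    (h0 : 2 * Real.pi * E.radius ≤ E.excess m i S q t)
    (h1 : E.excess m i S q t < E.excursionLength m) :
    SteersAfter E.speed (1 / E.radius) (E.excursion m i S q) t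
      ((E.loiterPose m (E.departure m q)).advance (E.idleCurvature m)
        (E.excess m i S q t - 2 * Real.pi * E.radius)) := by
  have he := E.excess_eq (m := m) (i := i) (S := S) (q := q) (2 * Real.pi * E.radius)
  rw [he t]
  apply steersAfter_advance (E.abs_idleCurvature hm)
  filter_upwards [self_mem_nhdsWithin, mem_nhdsWithin_of_mem_nhds
    (E.continuous_excess.continuousAt.eventually_lt continuousAt_const h1)] with s hs hs'
  rw [← he s]
  exact E.excursion_second hm hr (h0.trans (E.excess_mono hs)) (le_of_lt hs')

theorem steersBefore_second (hm : 1 ≤ m) (hr : E.Responsible m 0 i S q)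
    (h0 : 2 * Real.pi * E.radius < E.excess m i S q t)
    (h1 : E.excess m i S q t ≤ E.excursionLength m) :
    SteersBefore E.speed (1 / E.radius) (E.excursion m i S q) t
      ((E.loiterPose m (E.departure m q)).advance (E.idleCurvature m)
        (E.excess m i S q t - 2 * Real.pi * E.radius)) := by
  have he := E.excess_eq (m := m) (i := i) (S := S) (q := q) (2 * Real.pi * E.radius)
  rw [he t]
  apply steersBefore_advance (E.abs_idleCurvature hm)
  filter_upwards [self_mem_nhdsWithin, mem_nhdsWithin_of_mem_nhds
    (continuousAt_const.eventually_lt E.continuous_excess.continuousAt h0)] with s hs hs'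
  rw [← he s]
  exact E.excursion_second hm hr (le_of_lt hs') ((E.excess_mono hs).trans h1)

theorem steersBefore_of_nonpos (hm : 1 ≤ m) (h : E.excess m i S q t ≤ 0) :
    SteersBefore E.speed (1 / E.radius) (E.excursion m i S q) t
      (E.loiterPose m (E.place m 0 i t)) := by
  apply (E.steersBefore_loiter hm i t).congr
  filter_upwards [self_mem_nhdsWithin] with s hs
  exact E.excursion_of_nonpos ((E.excess_mono hs).trans h)

theorem steersAfter_of_ge (hm : 1 ≤ m) (h : E.excursionLength m ≤ E.excess m i S q t) :
    SteersAfter E.speed (1 / E.radius) (E.excursion m i S q) t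
      (E.loiterPose m (E.place m 0 i t)) := by
  apply (E.steersAfter_loiter hm i t).congr
  filter_upwards [self_mem_nhdsWithin] with s hs
  exact E.excursion_of_ge (h.trans (E.excess_mono hs))

/-- There are three junctions: the beginning of the first circle, its end, and the end of the second
one. At each of them both sides have the pose of departure, up to full turns; elsewhere a single
formula holds on both sides. -/
theorem steers_excursion (hm : 1 ≤ m) (i : Fin m) (S : ℝ) (q : Plane) :
    Steers E.speed (1 / E.radius) (E.excursion m i S q) := by
  by_cases hr : E.Responsible m 0 i S q
  swap
  · rw [show E.excursion m i S q = E.loiter m i from funext (E.excursion_of_not_responsible hr)]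
    exact E.steers_loiter hm i
  intro t
  have hπ := mul_pos Real.pi_pos E.radius_pos
  have hl := E.le_excursionLength hm
  rcases lt_trichotomy (E.excess m i S q t) 0 with h0 | h0 | h0
  · refine ⟨_, (E.steersAfter_loiter hm i t).congr ?_, E.steersBefore_of_nonpos hm h0.le⟩
    filter_upwards [mem_nhdsWithin_of_mem_nhds
      (E.continuous_excess.continuousAt.eventually_lt continuousAt_const h0)] with s hs
    exact E.excursion_of_nonpos (le_of_lt hs)
  · refine ⟨_, ?_, E.steersBefore_of_nonpos hm h0.le⟩
    have := E.steersAfter_first hm hr h0.symm.le (by linarith)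
    rwa [h0, Pose.advance_zero, ← E.loiterPose_place_of_excess_eq_zero hm h0] at this
  rcases lt_trichotomy (E.excess m i S q t) (2 * Real.pi * E.radius) with h1 | h1 | h1
  · exact ⟨_, E.steersAfter_first hm hr h0.le h1, E.steersBefore_first hm hr h0 h1.le⟩
  · refine ⟨E.loiterPose m (E.departure m q), ?_, ?_⟩
    · have := E.steersAfter_second hm hr h1.symm.le (by linarith)
      rwa [h1, sub_self, Pose.advance_zero] at this
    · have := E.steersBefore_first hm hr h0 h1.le
      rw [h1] at this
      exact this.congr_pose (E.equiv_advance_circle q _).symm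
  rcases lt_trichotomy (E.excess m i S q t) (E.excursionLength m) with h2 | h2 | h2
  · exact ⟨_, E.steersAfter_second hm hr h1.le h2, E.steersBefore_second hm hr h1 h2.le⟩
  · refine ⟨_, E.steersAfter_of_ge hm h2.symm.le, ?_⟩
    have := E.steersBefore_second hm hr h1 h2.le
    rw [h2] at this
    rw [E.loiterPose_place_of_excess_eq hm h2]
    exact this.congr_pose (E.equiv_advance_idle hm _).symm
  · refine ⟨_, E.steersAfter_of_ge hm h2.le, (E.steersBefore_loiter hm i t).congr ?_⟩
    filter_upwards [mem_nhdsWithin_of_mem_nhds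
      (continuousAt_const.eventually_lt E.continuous_excess.continuousAt h2)] with s hs
    exact E.excursion_of_ge (le_of_lt hs)

/-! ### Measurability -/

theorem measurable_stripOf : Measurable (E.stripOf m) := by
  unfold stripOf
  exact (Nat.measurable_floor.comp
    ((measurable_const.sub (measurable_coord 1)).div_const _)).min measurable_const

theorem measurable_bisector_stripOf : Measurable fun q => E.bisector m (E.stripOf m q) := by
  have := E.measurable_stripOf (m := m)
  exact (measurable_from_nat (f := fun k => E.bisector m k)).comp this

theorem measurable_offset : Measurable (E.offset m) := by
  have h := (measurable_coord 1).sub (E.measurable_bisector_stripOf (m := m))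
  exact continuous_abs.measurable.comp h

theorem measurable_serviceAngle : Measurable (E.serviceAngle m) := by
  have := E.measurable_offset (m := m)
  unfold serviceAngle
  exact (Real.continuous_arcsin.measurable.comp (this.div_const _).sqrt).const_mul 2

theorem measurable_serviceLength : Measurable (E.serviceLength m) := by
  simp only [funext (E.serviceLength_eq (m := m))]
  exact E.measurable_serviceAngle.const_mul _

theorem measurableSet_even_stripOf : MeasurableSet {q | Even (E.stripOf m q)} :=
  E.measurable_stripOf (MeasurableSet.of_discrete (s := {k | Even k}))

theorem measurable_departure : Measurable (E.departure m) := by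
  have h1 := E.measurable_serviceAngle (m := m)
  have h2 : Measurable fun q => (E.stripOf m q : ℝ) :=
    measurable_from_nat.comp E.measurable_stripOf
  simp only [funext (E.departure_eq (m := m))]
  refine (h2.mul_const _).add (Measurable.sub (Measurable.ite E.measurableSet_even_stripOf ?_ ?_)
    (h1.sin.const_mul _))
  · exact (measurable_coord 0).add_const _
  · exact measurable_const.sub (measurable_coord 0)

theorem measurable_serviceCurvature : Measurable (E.serviceCurvature m) := by
  unfold serviceCurvature turnSign
  refine Measurable.div_const (Measurable.mul
    (Measurable.ite E.measurableSet_even_stripOf measurable_const measurable_const)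
    (Measurable.ite ?_ measurable_const measurable_const)) _
  exact measurableSet_le E.measurable_bisector_stripOf (measurable_coord 1)

theorem measurable_approachLength (c : ℝ) (i : Fin m) :
    Measurable fun p : ℝ × Plane => E.approachLength m c i p.1 p.2 := by
  have h := E.measurable_departure (m := m)
  unfold approachLength place
  refine (measurable_fract.comp (Measurable.div_const (Measurable.sub (h.comp measurable_snd) ?_) _)).const_mul _
  fun_prop

theorem measurable_excursion (i : Fin m) (hm : 1 ≤ m) (t : ℝ) :
    Measurable fun p : ℝ × Plane => E.excursion m i p.1 p.2 t := by
  have h1 := E.measurable_approachLength (m := m) 0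
  have h2 : Measurable fun p : ℝ × Plane => E.excess m i p.1 p.2 t := by
    unfold excess
    exact Measurable.sub (by fun_prop) (h1 i)
  have h3 : MeasurableSet {p : ℝ × Plane | E.Responsible m 0 i p.1 p.2} := by
    simp only [Responsible, Set.ofPred_forall]
    exact MeasurableSet.iInter fun i' => measurableSet_le (h1 i) (h1 i')
  -- Both circles have nonzero curvature, so the integrals in `Pose.advance` can be replaced by
  -- their closed form.
  have h4 : ∀ (κ e : ℝ × Plane → ℝ), Measurable κ → Measurable e → (∀ p, κ p ≠ 0) →
      Measurable fun p => ((E.loiterPose m (E.departure m p.2)).advance (κ p) (e p)).point := by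
    intro κ e hκ he hκ0
    have hs : Measurable fun p : ℝ × Plane =>
        E.loiterLength m * Int.fract (E.departure m p.2 / E.loiterLength m) :=
      (measurable_fract.comp ((E.measurable_departure.comp measurable_snd).div_const _)).const_mul _
    obtain ⟨hx, hy, hh⟩ := Pose.measurable_follow (E.loiterPieces m)
      (measurable_const (a := (E.loiterStart m).x)) (measurable_const (a := (E.loiterStart m).y))
      (measurable_const (a := (E.loiterStart m).heading)) hs
    change Measurable fun p : ℝ × Plane => (E.loiterPose m (E.departure m p.2)).x at hx
    change Measurable fun p : ℝ × Plane => (E.loiterPose m (E.departure m p.2)).y at hy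
    change Measurable fun p : ℝ × Plane => (E.loiterPose m (E.departure m p.2)).heading at hh
    simp only [Pose.advance_of_ne_zero (hκ0 _), Pose.point]
    exact measurable_plane_mk (by fun_prop) (by fun_prop)
  unfold excursion
  refine Measurable.ite ?_ (Measurable.ite ?_ ?_ ?_) measurable_const
  · exact h3.inter ((measurableSet_lt measurable_const h2).inter (measurableSet_lt h2 measurable_const))
  · exact measurableSet_le h2 measurable_const
  · exact h4 _ _ (E.measurable_serviceCurvature.comp measurable_snd) h2
      fun p => E.serviceCurvature_ne_zero _
  · exact h4 _ _ measurable_const (h2.sub_const _) fun p => (E.idleCurvature_pos hm).ne'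

end Setting

namespace RequestSeq

theorem measurable_gap (j : ℕ) : Measurable fun ω : RequestSeq => ω.gap j :=
  measurable_fst.comp (measurable_pi_apply j)

theorem measurable_loc (j : ℕ) : Measurable fun ω : RequestSeq => ω.loc j :=
  measurable_snd.comp (measurable_pi_apply j)

theorem measurable_arrival (j : ℕ) : Measurable fun ω : RequestSeq => ω.arrival j := by
  unfold arrival
  exact Finset.measurable_fun_sum _ fun k _ => measurable_gap k

theorem arrival_zero (ω : RequestSeq) : ω.arrival 0 = ω.gap 0 := by simp [arrival]

theorem arrival_succ (ω : RequestSeq) (j : ℕ) :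
    ω.arrival (j + 1) = ω.arrival j + ω.gap (j + 1) := by
  simp [arrival, Finset.sum_range_succ _ (j + 1)]

theorem arrival_congr {ω ω' : RequestSeq} {j : ℕ} (h : ∀ k ≤ j, ω k = ω' k) :
    ω.arrival j = ω'.arrival j := by
  unfold arrival gap
  exact Finset.sum_congr rfl fun k hk => by rw [h k (Nat.lt_succ_iff.1 (Finset.mem_range.1 hk))]

theorem Proper.arrival_strictMono {E : Setting} {ω : RequestSeq} (h : ω.Proper E) :
    StrictMono ω.arrival :=
  strictMono_nat_of_lt_succ fun j => by rw [arrival_succ]; linarith [h.1 (j + 1)]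

/-! ### The queue -/

/-- The time at which the service of request `j` begins, if requests are served one after the other
and every service takes the time `R`. -/
def start (R : ℝ) (ω : RequestSeq) : ℕ → ℝ
  | 0 => ω.arrival 0
  | j + 1 => max (ω.arrival (j + 1)) (start R ω j + R)

variable {R : ℝ} {ω ω' : RequestSeq}

theorem start_add_le (j : ℕ) : start R ω j + R ≤ start R ω (j + 1) := le_max_right _ _

theorem arrival_le_start (j : ℕ) : ω.arrival j ≤ start R ω j := by
  cases j with
  | zero => exact le_rfl
  | succ j => exact le_max_left _ _

theorem start_strictMono (hR : 0 < R) : StrictMono (start R ω) :=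
  strictMono_nat_of_lt_succ fun j => by linarith [start_add_le (R := R) (ω := ω) j]

theorem start_congr {j : ℕ} (h : ∀ k ≤ j, ω k = ω' k) : start R ω j = start R ω' j := by
  induction j with
  | zero => exact arrival_congr h
  | succ j ih =>
    simp only [start]
    rw [arrival_congr h, ih fun k hk => h k (hk.trans (Nat.le_succ j))]

theorem start_eq_arrival {j : ℕ} (h : ∀ k ≤ j, R ≤ ω.gap k) : start R ω j = ω.arrival j := by
  induction j with
  | zero => rfl
  | succ j ih =>
    rw [start, ih fun k hk => h k (hk.trans (Nat.le_succ j)), arrival_succ]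
    exact max_eq_left (by linarith [h (j + 1) le_rfl])

/-- Each of the `j` earlier requests delays the service by at most `R`; this makes waiting times
grow at most linearly in `j`. -/
theorem start_le (hR : 0 ≤ R) (hω : ∀ j, 0 ≤ ω.gap j) (j : ℕ) :
    start R ω j ≤ ω.arrival j + j * R := by
  induction j with
  | zero => simp [start]
  | succ j ih =>
    rw [start, arrival_succ]
    push_cast
    have := hω (j + 1)
    exact max_le (by nlinarith [Nat.cast_nonneg (α := ℝ) j]) (by linarith)

theorem exists_lt_start (hR : 0 < R) (ω : RequestSeq) (t : ℝ) : ∃ j, t < start R ω (j + 1) := by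
  have h : ∀ j : ℕ, start R ω 0 + j * R ≤ start R ω j := by
    intro j
    induction j with
    | zero => simp
    | succ j ih =>
      have := start_add_le (R := R) (ω := ω) j
      push_cast; linarith
  obtain ⟨j, hj⟩ := exists_nat_gt ((t - start R ω 0) / R)
  rw [div_lt_iff₀ hR] at hj
  refine ⟨j, ?_⟩
  have := h (j + 1)
  push_cast at this
  linarith

theorem measurable_start (R : ℝ) (j : ℕ) : Measurable fun ω : RequestSeq => start R ω j := by
  induction j with
  | zero => exact measurable_arrival 0
  | succ j ih => exact (measurable_arrival (j + 1)).max (ih.add_const R)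

open Classical in
/-- The request the service of which is the last one that has begun at time `t` (`0` if no service
has begun yet). -/
def current (R t : ℝ) (ω : RequestSeq) : ℕ :=
  if h : ∃ j, t < start R ω (j + 1) then Nat.find h else 0

theorem lt_start_current (hR : 0 < R) (ω : RequestSeq) (t : ℝ) :
    t < start R ω (current R t ω + 1) := by
  have h := exists_lt_start hR ω t
  rw [current, dif_pos h]
  exact Nat.find_spec h

/-- The first alternative is needed for times before the first service, when `current` is 0 although
no service has begun. -/
theorem start_current_le (hR : 0 < R) (ω : RequestSeq) (t : ℝ) :
    current R t ω = 0 ∨ start R ω (current R t ω) ≤ t := by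
  have h := exists_lt_start hR ω t
  rcases Nat.eq_zero_or_pos (current R t ω) with h0 | h0
  · exact Or.inl h0
  · right
    rw [current, dif_pos h] at h0 ⊢
    have := Nat.find_min h (Nat.sub_lt h0 one_pos)
    rwa [Nat.sub_add_cancel (show 1 ≤ Nat.find h from h0), not_lt] at this

open Classical in
theorem measurable_current (hR : 0 < R) (t : ℝ) : Measurable (current R t) := by
  have h := fun ω => exists_lt_start hR ω t
  have : current R t = fun ω => Nat.find (h ω) := by
    funext ω
    rw [current, dif_pos (h ω)]
  rw [this]
  exact measurable_find h fun k => measurableSet_lt measurable_const (measurable_start R (k + 1))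

end RequestSeq

/-! ### Service in the order of arrival -/

namespace Setting

variable (E : Setting) {m : ℕ}

/-- The time that is set aside for a service. -/
def serviceTime (m : ℕ) : ℝ := (E.excursionLength m + 2 * E.loiterLength m) / E.speed

theorem speed_mul_serviceTime :
    E.speed * E.serviceTime m = E.excursionLength m + 2 * E.loiterLength m := by
  have := E.speed_pos
  unfold serviceTime; field_simp

theorem serviceTime_pos (hm : 1 ≤ m) : 0 < E.serviceTime m := by
  have h1 := E.le_excursionLength hm
  have h2 := mul_pos Real.pi_pos E.radius_pos
  have h3 := E.loiterLength_pos hm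
  exact div_pos (by linarith) E.speed_pos

variable {i : Fin m} {S t : ℝ} {q : Plane}

/-- Shortly before the time that is set aside for it has passed, an excursion is finished. -/
theorem excursion_of_late (hm : 1 ≤ m) (h : S + E.serviceTime m - E.loiterLength m / E.speed ≤ t) :
    E.excursion m i S q t = E.loiter m i t := by
  apply E.excursion_of_ge
  -- Of the two loop lengths in `serviceTime`, one pays for the approach; the other is left over as
  -- a margin.
  have h1 := E.approachLength_lt hm 0 i S q
  have h2 := mul_le_mul_of_nonneg_left h E.speed_pos.le
  rw [mul_sub, mul_add, speed_mul_serviceTime, mul_div_cancel₀ _ E.speed_pos.ne'] at h2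
  unfold excess
  linarith

theorem excursion_of_early (hm : 1 ≤ m) (h : t ≤ S) : E.excursion m i S q t = E.loiter m i t := by
  apply E.excursion_of_nonpos
  have h1 := E.approachLength_nonneg hm 0 i S q
  have h2 := mul_le_mul_of_nonneg_left h E.speed_pos.le
  unfold excess
  linarith

/-- The position of robot `i` if requests are served one after the other. -/
def queuePos (m : ℕ) (ω : RequestSeq) (i : Fin m) (t : ℝ) : Plane :=
  E.excursion m i (ω.start (E.serviceTime m) (ω.current (E.serviceTime m) t))
    (ω.loc (ω.current (E.serviceTime m) t)) t

theorem loiterLength_div_speed_lt (hm : 1 ≤ m) : E.loiterLength m / E.speed < E.serviceTime m := by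
  have h1 := E.le_excursionLength hm
  have h2 := mul_pos Real.pi_pos E.radius_pos
  have h3 := E.loiterLength_pos hm
  exact div_lt_div_of_pos_right (by linarith) E.speed_pos

/-- The formula for request `j` remains valid slightly before its service begins: by the margin in
`serviceTime`, the preceding excursion is finished by then, and both formulas describe loitering.
Thus every time has an open neighbourhood on which one formula holds, and `steers_excursion` carries
over to the whole motion. -/
theorem queuePos_eq (hm : 1 ≤ m) (ω : RequestSeq) {j : ℕ}
    (h0 : j = 0 ∨ ω.start (E.serviceTime m) j - E.loiterLength m / E.speed ≤ t)
    (h1 : t ≤ ω.start (E.serviceTime m) (j + 1)) :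
    E.queuePos m ω i t = E.excursion m i (ω.start (E.serviceTime m) j) (ω.loc j) t := by
  have hR := E.serviceTime_pos hm
  have hs := RequestSeq.start_strictMono (ω := ω) hR
  have hlt := RequestSeq.lt_start_current hR ω t
  have hle := RequestSeq.start_current_le hR ω t
  have hLR := E.loiterLength_div_speed_lt hm
  have hL : 0 < E.loiterLength m / E.speed := div_pos (E.loiterLength_pos hm) E.speed_pos
  unfold queuePos
  set J := ω.current (E.serviceTime m) t
  set R := E.serviceTime m
  rcases lt_trichotomy J j with h | h | h
  · have h0' := h0.resolve_left (by omega)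
    have h2 : J + 1 = j := by
      by_contra h3
      have h4 : J + 1 + 1 ≤ j := by omega
      have h5 := hs.monotone h4
      have h6 := RequestSeq.start_add_le (R := R) (ω := ω) (J + 1)
      linarith
    have h3 := RequestSeq.start_add_le (R := R) (ω := ω) J
    rw [h2] at h3 hlt
    rw [E.excursion_of_late hm (by linarith), E.excursion_of_early hm hlt.le]
  · rw [h]
  · have h2 := hle.resolve_left (by omega)
    have h3 : J = j + 1 := by
      have := hs.le_iff_le.1 (h2.trans h1)
      omega
    rw [h3] at h2 ⊢
    have h4 := RequestSeq.start_add_le (R := R) (ω := ω) j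
    rw [E.excursion_of_early hm h1, E.excursion_of_late hm (by linarith)]

theorem steers_queuePos (hm : 1 ≤ m) (ω : RequestSeq) (i : Fin m) :
    Steers E.speed (1 / E.radius) (E.queuePos m ω i) := by
  intro t
  have hR := E.serviceTime_pos hm
  have hlt := RequestSeq.lt_start_current hR ω t
  have hle := RequestSeq.start_current_le hR ω t
  have hL : 0 < E.loiterLength m / E.speed := div_pos (E.loiterLength_pos hm) E.speed_pos
  set J := ω.current (E.serviceTime m) t
  obtain ⟨g, h1, h2⟩ := E.steers_excursion hm i (ω.start (E.serviceTime m) J) (ω.loc J) t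
  have h3 : ∀ᶠ s in 𝓝 t, E.queuePos m ω i s =
      E.excursion m i (ω.start (E.serviceTime m) J) (ω.loc J) s := by
    rcases hle with h | h
    · filter_upwards [Iio_mem_nhds hlt] with s hs
      exact E.queuePos_eq hm ω (Or.inl h) (le_of_lt hs)
    · filter_upwards [Iio_mem_nhds hlt, Ioi_mem_nhds (show
        ω.start (E.serviceTime m) J - E.loiterLength m / E.speed < t by linarith)] with s hs hs'
      exact E.queuePos_eq hm ω (Or.inr (le_of_lt hs')) (le_of_lt hs)
  exact ⟨g, h1.congr (h3.filter_mono nhdsWithin_le_nhds), h2.congr (h3.filter_mono nhdsWithin_le_nhds)⟩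

theorem measurable_queuePos (hm : 1 ≤ m) (i : Fin m) (t : ℝ) :
    Measurable fun ω => E.queuePos m ω i t := by
  have h1 := RequestSeq.measurable_current (E.serviceTime_pos hm) t
  have h2 : ∀ j : ℕ, Measurable fun ω : RequestSeq =>
      E.excursion m i (ω.start (E.serviceTime m) j) (ω.loc j) t := by
    intro j
    have h3 := (E.measurable_excursion i hm t).fun_comp
      ((RequestSeq.measurable_start (E.serviceTime m) j).prodMk (RequestSeq.measurable_loc j))
    dsimp only at h3
    exact h3
  have h4 := measurable_from_prod_countable_left (f := fun p : RequestSeq × ℕ =>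
      E.excursion m i (p.1.start (E.serviceTime m) p.2) (p.1.loc p.2) t) h2
  have h5 := h4.fun_comp (measurable_id.prodMk h1)
  dsimp only [id] at h5
  unfold queuePos
  exact h5

/-- A service that has begun by time `t` is determined by requests that have arrived by time `t`. A
service that has not begun contributes nothing but loitering. -/
theorem queuePos_causal (hm : 1 ≤ m) {ω ω' : RequestSeq} (hω : ω.Proper E) (hω' : ω'.Proper E)
    (h : ∀ j, ω.arrival j ≤ t ∨ ω'.arrival j ≤ t → ω j = ω' j) (i : Fin m) :
    E.queuePos m ω i t = E.queuePos m ω' i t := by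
  have hR := E.serviceTime_pos hm
  have hL : 0 < E.loiterLength m / E.speed := div_pos (E.loiterLength_pos hm) E.speed_pos
  have key : ∀ j, ω.start (E.serviceTime m) j ≤ t ∨ ω'.start (E.serviceTime m) j ≤ t →
      ω j = ω' j ∧ ω.start (E.serviceTime m) j = ω'.start (E.serviceTime m) j := by
    intro j hj
    have h1 : ∀ k ≤ j, ω k = ω' k := by
      intro k hk
      apply h
      rcases hj with hj | hj
      · exact Or.inl ((hω.arrival_strictMono.monotone hk).trans
          ((RequestSeq.arrival_le_start j).trans hj))
      · exact Or.inr ((hω'.arrival_strictMono.monotone hk).trans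
          ((RequestSeq.arrival_le_start j).trans hj))
    exact ⟨h1 j le_rfl, RequestSeq.start_congr h1⟩
  have hlt := RequestSeq.lt_start_current hR ω t
  have hle := RequestSeq.start_current_le hR ω t
  change E.excursion m i _ _ t = _
  set J := ω.current (E.serviceTime m) t
  have hlt' : t < ω'.start (E.serviceTime m) (J + 1) := by
    by_contra! h1
    linarith [(key (J + 1) (Or.inr h1)).2]
  by_cases hJ : ω.start (E.serviceTime m) J ≤ t
  · obtain ⟨h1, h2⟩ := key J (Or.inl hJ)
    rw [E.queuePos_eq hm ω' (j := J) (Or.inr (by linarith)) hlt'.le, h2]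
    unfold RequestSeq.loc
    rw [h1]
  · have hJ0 := hle.resolve_right hJ
    have hJ' : ¬ ω'.start (E.serviceTime m) J ≤ t := fun h1 => hJ (by linarith [(key J (Or.inr h1)).2])
    rw [E.queuePos_eq hm ω' (j := J) (Or.inl hJ0) hlt'.le, E.excursion_of_early hm (not_le.1 hJ).le,
      E.excursion_of_early hm (not_le.1 hJ').le]

/-- The policy by which requests are served one after the other, in the order of their arrival. -/
def queuePolicy (hm : 1 ≤ m) : Policy E m where
  pos := E.queuePos m
  measurable := E.measurable_queuePos hm
  isDIMotion ω _ i := (E.steers_queuePos hm ω i).isDIMotion E.speed_pos.le E.speed_le E.speed_sq.le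
  causal _ _ hω hω' _ _ h i := E.queuePos_causal hm hω hω' h i

/-- Requests at least `serviceTime` apart are served at once, so the motion is the explicit
excursion. In general request `j` waits for at most `j` earlier services and is reached within its
own, which gives the constant K. -/
theorem isStripLoiteringWith_queuePolicy (hm : 1 ≤ m) :
    IsStripLoiteringWith E m (E.queuePolicy hm) 0 (E.serviceTime m) (E.serviceTime m) := by
  have hR := E.serviceTime_pos hm
  have hv := E.speed_pos
  have hL : 0 < E.loiterLength m / E.speed := div_pos (E.loiterLength_pos hm) E.speed_pos
  have hpos : ∀ ω : RequestSeq, ω.Proper E → ∀ j, (∀ k ≤ j, E.serviceTime m ≤ ω.gap k) →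
      ∀ i t, ω.arrival j ≤ t → t ≤ ω.arrival (j + 1) →
        E.queuePos m ω i t = E.excursion m i (ω.arrival j) (ω.loc j) t := by
    intro ω hω j hj i t h0 h1
    rw [← RequestSeq.start_eq_arrival hj] at h0 ⊢
    exact E.queuePos_eq hm ω (Or.inr (by linarith)) (h1.trans (RequestSeq.arrival_le_start _))
  constructor
  · intro ω _ i t _
    exact (E.steers_queuePos hm ω i).norm_deriv hv.le t
  · intro ω hω t ht h i
    change E.excursion m i _ _ t = E.loiter m i t
    have hle := RequestSeq.start_current_le hR ω t
    set J := ω.current (E.serviceTime m) t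
    by_cases hJ : ω.arrival J < t
    · have h1 : ω.start (E.serviceTime m) J = ω.arrival J :=
        RequestSeq.start_eq_arrival fun k hk =>
          (h k ((hω.arrival_strictMono.monotone hk).trans_lt hJ)).1
      exact E.excursion_of_late hm (by linarith [(h J hJ).2])
    · exact E.excursion_of_early hm ((not_lt.1 hJ).trans (RequestSeq.arrival_le_start J))
  · intro ω hω j hj i hr t h0 h1
    exact (hpos ω hω j hj i t h0 h1).trans (E.excursion_of_not_responsible hr t)
  · intro ω hω j hj i hr t h0 h1 h2
    exact (hpos ω hω j hj i t h0 h1).trans (E.excursion_of_nonpos (sub_nonpos.2 h2))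
  · intro ω hω j hj i hr t h1 s hs0 hs1 h2
    have h3 : E.excess m i (ω.arrival j) (ω.loc j) t = s := by unfold excess; linarith
    have h4 : ω.arrival j ≤ t := by
      by_contra! h5
      have := mul_lt_mul_of_pos_left h5 hv
      linarith [E.approachLength_nonneg hm 0 i (ω.arrival j) (ω.loc j)]
    refine (hpos ω hω j hj i t h4 h1).trans ?_
    rw [E.excursion_first hm hr (by rw [h3]; exact hs0)
      (by rw [h3]; exact hs1.trans (E.serviceLength_le _)), h3]
  · intro ω hω j
    obtain ⟨i, hr⟩ := E.exists_responsible hm 0 (ω.start (E.serviceTime m) j) (ω.loc j)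
    set S := ω.start (E.serviceTime m) j with hS
    set e := E.approachLength m 0 i S (ω.loc j) + E.serviceLength m (ω.loc j) with he
    have h1 := E.approachLength_nonneg hm 0 i S (ω.loc j)
    have h2 := E.approachLength_lt hm 0 i S (ω.loc j)
    have h3 := E.serviceLength_nonneg (m := m) (ω.loc j)
    have h4 := E.serviceLength_le (m := m) (ω.loc j)
    have h5 := E.le_excursionLength hm
    have h6 := mul_pos Real.pi_pos E.radius_pos
    have h7 : e / E.speed ≤ E.serviceTime m := div_le_div_of_nonneg_right (by linarith) hv.le
    have h8 : 0 ≤ e / E.speed := div_nonneg (by linarith) hv.le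
    have h9 := RequestSeq.start_add_le (R := E.serviceTime m) (ω := ω) j
    have h10 : E.excess m i S (ω.loc j) (S + e / E.speed) = E.serviceLength m (ω.loc j) := by
      unfold excess
      rw [add_sub_cancel_left, mul_div_cancel₀ _ hv.ne', he]; ring
    have h11 := RequestSeq.arrival_le_start (R := E.serviceTime m) (ω := ω) j
    have h12 := RequestSeq.start_le (R := E.serviceTime m) (ω := ω) hR.le (fun j => (hω.1 j).le) j
    rw [← hS] at h9 h11 h12
    have h13 : (E.queuePolicy hm).pos ω i (S + e / E.speed) = ω.loc j := by
      change E.queuePos m ω i (S + e / E.speed) = ω.loc j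
      rw [E.queuePos_eq hm ω (j := j) (Or.inr (by linarith)) (by linarith), ← hS,
        E.excursion_first hm hr (by rw [h10]; exact h3) (by rw [h10]; exact h4), h10,
        E.point_advance_serviceLength hm (hω.2.1 j)]
    refine (iInf₂_le (S + e / E.speed) ⟨by linarith, i, h13⟩).trans ?_
    apply ENNReal.ofReal_le_ofReal
    linarith

end Setting

theorem exists_isStripLoitering (E : Setting) {m : ℕ} (hm : 1 ≤ m) :
    ∃ π : Policy E m, IsStripLoitering E m π :=
  ⟨E.queuePolicy hm, _, _, _, E.isStripLoiteringWith_queuePolicy hm⟩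

/-! ### Resampling one coordinate -/

theorem measurable_update_prod {X : Type*} [MeasurableSpace X] (j : ℕ) :
    Measurable fun p : (ℕ → X) × X => Function.update p.1 j p.2 := by
  rw [measurable_pi_iff]
  intro k
  by_cases hk : k = j
  · subst hk; simpa using measurable_snd
  · simp only [Function.update_of_ne hk]
    exact (measurable_pi_apply k).comp measurable_fst

/-- If one coordinate of a sequence of independent variables is replaced by an independent copy, the
law of the sequence does not change. -/
theorem map_update_infinitePi {X : Type*} [MeasurableSpace X] (μ : ℕ → Measure X)
    [∀ j, IsProbabilityMeasure (μ j)] (j : ℕ) :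
    ((Measure.infinitePi μ).prod (μ j)).map (fun p => Function.update p.1 j p.2) =
      Measure.infinitePi μ := by
  have hmeas := measurable_update_prod (X := X) j
  apply Measure.eq_infinitePi
  intro s t ht
  rw [Measure.map_apply hmeas (MeasurableSet.pi s.countable_toSet fun i _ => ht i)]
  have hpre : (fun p : (ℕ → X) × X => Function.update p.1 j p.2) ⁻¹' (Set.pi s t) =
      (Set.pi (s.erase j : Finset ℕ) t) ×ˢ (if j ∈ s then t j else Set.univ) := by
    ext ⟨ω, x⟩
    simp only [Set.mem_preimage, Set.mem_pi, Finset.mem_coe, Set.mem_prod, Finset.mem_erase]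
    constructor
    · intro h
      refine ⟨fun i hi => ?_, ?_⟩
      · have := h i hi.2
        rwa [Function.update_of_ne hi.1] at this
      · split_ifs with hj
        · simpa using h j hj
        · trivial
    · rintro ⟨h1, h2⟩ i hi
      by_cases hij : i = j
      · subst hij
        simpa [hi] using h2
      · rw [Function.update_of_ne hij]
        exact h1 i ⟨hij, hi⟩
  rw [hpre, Measure.prod_prod, Measure.infinitePi_pi _ fun i _ => ht i]
  split_ifs with hj
  · exact Finset.prod_erase_mul _ _ hj
  · rw [measure_univ, mul_one, Finset.erase_eq_of_notMem hj]

theorem lintegral_infinitePi_update {X : Type*} [MeasurableSpace X] (μ : ℕ → Measure X)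
    [∀ j, IsProbabilityMeasure (μ j)] (j : ℕ) {F : (ℕ → X) → ℝ≥0∞} (hF : Measurable F) :
    ∫⁻ ω, F ω ∂Measure.infinitePi μ =
      ∫⁻ ω, ∫⁻ x, F (Function.update ω j x) ∂μ j ∂Measure.infinitePi μ := by
  have hmeas := measurable_update_prod (X := X) j
  conv_lhs => rw [← map_update_infinitePi μ j]
  rw [lintegral_map hF hmeas, lintegral_prod _ (hF.fun_comp hmeas).aemeasurable]

/-! ### Uniformly distributed points of the square -/

namespace Setting

variable (E : Setting)

theorem square_eq : E.square =
    (@WithLp.ofLp 2 (Fin 2 → ℝ)) ⁻¹' (Set.univ.pi fun _ => Set.Icc 0 E.side) := by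
  ext p
  simp only [square, Set.mem_ofPred_eq, Set.mem_preimage, Set.mem_pi, Set.mem_univ, true_imp_iff,
    Set.mem_Icc]

theorem measurableSet_square : MeasurableSet E.square := by
  rw [square_eq]
  exact (PiLp.volume_preserving_ofLp (Fin 2)).measurable
    (MeasurableSet.univ_pi fun _ => measurableSet_Icc)

theorem volume_square : volume E.square = ENNReal.ofReal E.area := by
  rw [square_eq, (PiLp.volume_preserving_ofLp (Fin 2)).measure_preimage
    (MeasurableSet.univ_pi fun _ => measurableSet_Icc).nullMeasurableSet, volume_pi, Measure.pi_pi]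
  simp only [Real.volume_Icc, sub_zero, Fin.prod_univ_two]
  rw [← ENNReal.ofReal_mul E.side_pos.le, ← sq, side_sq]

instance : IsProbabilityMeasure E.uniformLaw :=
  cond_isProbabilityMeasure_of_finite
    (by rw [volume_square]; exact (ENNReal.ofReal_pos.2 E.area_pos).ne')
    (by rw [volume_square]; exact ENNReal.ofReal_ne_top)

theorem ae_mem_square : ∀ᵐ q ∂E.uniformLaw, q ∈ E.square :=
  ae_cond_mem E.measurableSet_square

theorem uniformLaw_le (s : Set Plane) : E.uniformLaw s ≤ volume s / ENNReal.ofReal E.area := by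
  rw [uniformLaw, cond_apply E.measurableSet_square, volume_square,
    ← ENNReal.div_eq_inv_mul]
  exact ENNReal.div_le_div_right (measure_mono Set.inter_subset_right) _

/-- Each coordinate of a uniformly distributed point of the square is uniformly distributed. -/
theorem lintegral_uniformLaw_coord (i : Fin 2) {f : ℝ → ℝ≥0∞} (hf : Measurable f) :
    ∫⁻ q, f (q i) ∂E.uniformLaw = (ENNReal.ofReal E.side)⁻¹ * ∫⁻ y in Set.Icc 0 E.side, f y := by
  have hs := E.side_pos
  have h1 : ∫⁻ q in E.square, f (q i) = ENNReal.ofReal E.side * ∫⁻ y in Set.Icc 0 E.side, f y := by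
    have h2 := (PiLp.volume_preserving_ofLp (Fin 2)).setLIntegral_comp_preimage
      (s := Set.univ.pi fun _ => Set.Icc 0 E.side) (MeasurableSet.univ_pi fun _ => measurableSet_Icc)
      (f := fun p : Fin 2 → ℝ => f (p i)) (hf.comp (measurable_pi_apply i))
    rw [← square_eq] at h2
    rw [h2, volume_pi, Measure.restrict_pi_pi]
    have h3 := Measure.pi_map_eval (fun _ : Fin 2 => (volume : Measure ℝ).restrict (Set.Icc 0 E.side)) i
    have h4 := lintegral_map (μ := Measure.pi fun _ : Fin 2 =>
      (volume : Measure ℝ).restrict (Set.Icc 0 E.side)) hf (measurable_pi_apply i)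
    change _ = ∫⁻ p : Fin 2 → ℝ, f (p i) ∂_ at h4
    rw [← h4]
    change ∫⁻ a : ℝ, f a ∂(Measure.map (Function.eval i) (Measure.pi fun _ : Fin 2 =>
      (volume : Measure ℝ).restrict (Set.Icc 0 E.side))) = _
    rw [h3, lintegral_smul_measure, smul_eq_mul]
    congr 1
    fin_cases i <;> simp [show Finset.univ.erase (0 : Fin 2) = {1} by decide,
      show Finset.univ.erase (1 : Fin 2) = {0} by decide]
  rw [uniformLaw, ProbabilityTheory.cond, lintegral_smul_measure, h1, volume_square, ← side_sq, sq,
    ENNReal.ofReal_mul hs.le, smul_eq_mul, ← mul_assoc]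
  congr 1
  have h5 : ENNReal.ofReal E.side ≠ 0 := (ENNReal.ofReal_pos.2 hs).ne'
  rw [ENNReal.mul_inv (Or.inl h5) (Or.inl ENNReal.ofReal_ne_top), mul_assoc,
    ENNReal.inv_mul_cancel h5 ENNReal.ofReal_ne_top, mul_one]

end Setting

/-- The image of a differentiable planar path is a null set. -/
theorem volume_range_eq_zero {γ : ℝ → Plane} (hγ : Differentiable ℝ γ) :
    volume (Set.range γ) = 0 := by
  -- The range of the path is the image of the horizontal axis under the differentiable map p ↦ γ(p
  -- 0) of the plane to itself. The axis is null, and such maps preserve null sets.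
  set P : Submodule ℝ Plane := LinearMap.ker (EuclideanSpace.proj (𝕜 := ℝ) (1 : Fin 2) :
    Plane →L[ℝ] ℝ).toLinearMap
  have hP : P ≠ ⊤ := by
    intro h
    have : (!₂[0, 1] : Plane) ∈ P := by rw [h]; trivial
    simp [P] at this
  have h0 : volume (P : Set Plane) = 0 := Measure.addHaar_submodule _ P hP
  have hd : DifferentiableOn ℝ (fun p : Plane => γ (p 0)) P := by
    have : Differentiable ℝ fun p : Plane => p 0 :=
      (EuclideanSpace.proj (𝕜 := ℝ) (0 : Fin 2) : Plane →L[ℝ] ℝ).differentiable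
    exact (hγ.comp this).differentiableOn
  have h1 := addHaar_image_eq_zero_of_differentiableOn_of_addHaar_eq_zero volume hd h0
  refine measure_mono_null ?_ h1
  rintro _ ⟨t, rfl⟩
  exact ⟨!₂[t, 0], by simp [P], by simp⟩

/-! ### Exponential variables of small rate -/

theorem expMeasure_Iio_le {r : ℝ} (hr : 0 < r) {R : ℝ} (hR : 0 ≤ R) :
    expMeasure r (Set.Iio R) ≤ ENNReal.ofReal (r * R) := by
  have := isProbabilityMeasure_expMeasure hr
  refine (measure_mono Set.Iio_subset_Iic_self).trans ?_
  rw [← ofReal_cdf, cdf_expMeasure_eq hr, if_pos hR]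
  apply ENNReal.ofReal_le_ofReal
  linarith [Real.add_one_le_exp (-(r * R))]

theorem expMeasure_Iio_one_lt {r : ℝ} (hr : 0 < r) : expMeasure r (Set.Iio 1) < 1 := by
  have := isProbabilityMeasure_expMeasure hr
  refine (measure_mono Set.Iio_subset_Iic_self).trans_lt ?_
  rw [← ofReal_cdf, cdf_expMeasure_eq hr, if_pos zero_le_one, ENNReal.ofReal_lt_one]
  linarith [Real.exp_pos (-(r * 1))]

theorem expMeasure_ae_pos {r : ℝ} (hr : 0 < r) : ∀ᵐ g ∂expMeasure r, 0 < g := by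
  have := isProbabilityMeasure_expMeasure hr
  rw [ae_iff]
  simp only [not_lt]
  change expMeasure r (Set.Iic 0) = 0
  rw [← ofReal_cdf, cdf_expMeasure_eq hr, if_pos le_rfl]
  simp

/-- Shifting the exponential density to the right by `a` multiplies it by exp(ra) beyond `a` and
removes it below. -/
theorem lintegral_expMeasure_add_le {r : ℝ} (hr : 0 < r) {a : ℝ} (ha : 0 ≤ a) {f : ℝ → ℝ≥0∞}
    (hf : Measurable f) :
    ∫⁻ g, f (g + a) ∂expMeasure r ≤ ENNReal.ofReal (Real.exp (r * a)) * ∫⁻ g, f g ∂expMeasure r := by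
  have hpdf : Measurable (exponentialPDF r) := (measurable_exponentialPDFReal r).ennreal_ofReal
  have hmu : expMeasure r = volume.withDensity (exponentialPDF r) := rfl
  rw [hmu, lintegral_withDensity_eq_lintegral_mul _ hpdf (by fun_prop),
    lintegral_withDensity_eq_lintegral_mul _ hpdf hf, ← lintegral_const_mul _ (hpdf.mul hf)]
  have h1 := lintegral_add_right_eq_self (μ := (volume : Measure ℝ))
    (fun g => exponentialPDF r (g - a) * f g) a
  simp only [add_sub_cancel_right] at h1
  simp only [Pi.mul_apply]
  rw [h1]
  refine lintegral_mono fun g => ?_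
  rw [← mul_assoc]
  gcongr
  rw [exponentialPDF_eq, exponentialPDF_eq, ← ENNReal.ofReal_mul (Real.exp_pos _).le]
  apply ENNReal.ofReal_le_ofReal
  by_cases h2 : 0 ≤ g - a
  · rw [if_pos h2, if_pos (by linarith), mul_left_comm, ← Real.exp_add]
    apply le_of_eq
    congr 2; ring
  · rw [if_neg h2]
    split_ifs <;> positivity

theorem lintegral_fract_sub (z : ℝ) :
    ∫⁻ u in Set.Ioc (0 : ℝ) 1, ENNReal.ofReal (Int.fract (z - u)) = ENNReal.ofReal (1 / 2) := by
  have hm : Measurable fun u : ℝ => Int.fract (z - u) := by fun_prop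
  have hint : ∀ f : ℝ → ℝ, Measurable f → IntervalIntegrable (fun u => Int.fract (f u)) volume 0 1 := by
    intro f hf
    refine IntervalIntegrable.mono_fun' (g := fun _ => 1) (by simp)
      (measurable_fract.comp hf).aestronglyMeasurable (Eventually.of_forall fun u => ?_)
    simp only
    rw [Real.norm_of_nonneg (Int.fract_nonneg _)]
    exact (Int.fract_lt_one _).le
  rw [← ofReal_integral_eq_lintegral_ofReal]
  · congr 1
    rw [← intervalIntegral.integral_of_le zero_le_one]
    have h1 := intervalIntegral.integral_comp_sub_left (a := 0) (b := 1)
      (fun x : ℝ => Int.fract x) z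
    rw [h1]
    have hp : Function.Periodic (Int.fract : ℝ → ℝ) 1 := fun x => Int.fract_add_one x
    have h2 := hp.intervalIntegral_add_eq (z - 1) 0
    rw [sub_add_cancel, zero_add] at h2
    rw [sub_zero, h2]
    have h3 : ∫ x in (0 : ℝ)..1, Int.fract x = ∫ x in (0 : ℝ)..1, x := by
      apply intervalIntegral.integral_congr_Ioo_of_le zero_le_one
      intro x hx
      exact Int.fract_eq_self.2 ⟨hx.1.le, hx.2⟩
    rw [h3]
    simp
  · have := hint (fun u => z - u) (by fun_prop)
    rwa [intervalIntegrable_iff_integrableOn_Ioc_of_le zero_le_one] at this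
  · exact Eventually.of_forall fun u => Int.fract_nonneg _

/-- The phase, at an exponential time of small rate, of a periodic motion is nearly uniformly
distributed, whatever the phase at the beginning. -/
theorem lintegral_fract_expMeasure {r β : ℝ} (hr : 0 < r) (hβ : 0 < β) (y : ℝ) :
    ENNReal.ofReal (1 / 2) ≤ ENNReal.ofReal (Real.exp (r / β)) *
      ∫⁻ g, ENNReal.ofReal (Int.fract (y - β * g)) ∂expMeasure r ∧
    ∫⁻ g, ENNReal.ofReal (Int.fract (y - β * g)) ∂expMeasure r ≤
      ENNReal.ofReal (Real.exp (r / β)) * ENNReal.ofReal (1 / 2) := by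
  have := isProbabilityMeasure_expMeasure hr
  set F : ℝ → ℝ≥0∞ := fun y => ∫⁻ g, ENNReal.ofReal (Int.fract (y - β * g)) ∂expMeasure r with hF
  have hmF : Measurable F := by
    apply Measurable.lintegral_prod_right
    fun_prop
  -- Lowering the phase by `u` amounts to delaying the exponential time by u/β. So F varies by at
  -- most the factor exp(r/β) over a period, whereas its mean over a period is exactly 1/2.
  have hshift : ∀ y u, 0 ≤ u → u ≤ 1 → F (y - u) ≤ ENNReal.ofReal (Real.exp (r / β)) * F y := by
    intro y u hu0 hu1
    have h1 := lintegral_expMeasure_add_le hr (a := u / β) (by positivity)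
      (f := fun g => ENNReal.ofReal (Int.fract (y - β * g))) (by fun_prop)
    have h2 : ∀ g, y - β * (g + u / β) = y - u - β * g := fun g => by field_simp; ring
    simp only [h2] at h1
    refine h1.trans ?_
    gcongr
    rw [mul_div_assoc']
    gcongr
    nlinarith
  have hper : ∀ y, F (y - 1) = F y := by
    intro y
    simp only [hF]
    congr 1; ext g
    rw [show y - 1 - β * g = y - β * g - 1 by ring, Int.fract_sub_one]
  have havg : ∫⁻ u in Set.Ioc (0 : ℝ) 1, F (y - u) = ENNReal.ofReal (1 / 2) := by
    simp only [hF]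
    rw [lintegral_lintegral_swap]
    · have : ∀ g, ∫⁻ u in Set.Ioc (0 : ℝ) 1, ENNReal.ofReal (Int.fract (y - u - β * g)) =
          ENNReal.ofReal (1 / 2) := by
        intro g
        rw [← lintegral_fract_sub (y - β * g)]
        congr 1; ext u; congr 2; ring
      simp [this]
    · apply Measurable.aemeasurable
      fun_prop
  have hone : volume (Set.Ioc (0 : ℝ) 1) = 1 := by simp
  constructor
  · rw [← havg]
    calc ∫⁻ u in Set.Ioc (0 : ℝ) 1, F (y - u)
        ≤ ∫⁻ _ in Set.Ioc (0 : ℝ) 1, ENNReal.ofReal (Real.exp (r / β)) * F y :=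
          setLIntegral_mono measurable_const fun u hu => hshift y u hu.1.le hu.2
      _ = ENNReal.ofReal (Real.exp (r / β)) * F y := by simp
  · rw [← havg, ← lintegral_const_mul _ (by fun_prop)]
    calc F y = ∫⁻ _ in Set.Ioc (0 : ℝ) 1, F y := by simp
      _ ≤ ∫⁻ u in Set.Ioc (0 : ℝ) 1, ENNReal.ofReal (Real.exp (r / β)) * F (y - u) := by
          refine setLIntegral_mono (by fun_prop) fun u hu => ?_
          -- Lowering the phase further, by 1 − u, completes a period; this gives the comparison in
          -- the other direction.
          have := hshift (y - u) (1 - u) (by linarith [hu.2]) (by linarith [hu.1])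
          rwa [show y - u - (1 - u) = y - 1 by ring, hper] at this

/-! ### The law of the requests -/

variable {E : Setting} {r : ℝ}

theorem isProbabilityMeasure_requestLaw (E : Setting) (hr : 0 < r) :
    IsProbabilityMeasure (requestLaw E r) := by
  have := isProbabilityMeasure_expMeasure hr
  unfold requestLaw
  infer_instance

/-- Integration over the gap and the location of one request while all other data are held fixed, as
a substitute for conditional expectation. -/
theorem lintegral_requestLaw (hr : 0 < r) (j : ℕ) {F : RequestSeq → ℝ≥0∞} (hF : Measurable F) :
    ∫⁻ ω, F ω ∂requestLaw E r = ∫⁻ ω, ∫⁻ q, ∫⁻ g, F (Function.update ω j (g, q))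
      ∂expMeasure r ∂E.uniformLaw ∂requestLaw E r := by
  have := isProbabilityMeasure_expMeasure hr
  unfold requestLaw
  rw [lintegral_infinitePi_update _ j hF]
  congr 1; ext ω
  have hu : Measurable fun p : ℝ × Plane => F (Function.update ω j p) :=
    hF.comp (measurable_update ω)
  rw [lintegral_prod_symm _ hu.aemeasurable]

theorem measurePreserving_eval_requestLaw (hr : 0 < r) (j : ℕ) : MeasurePreserving
    (fun ω : RequestSeq => ω j) (requestLaw E r) ((expMeasure r).prod E.uniformLaw) := by
  have := isProbabilityMeasure_expMeasure hr
  exact measurePreserving_eval_infinitePi (fun _ : ℕ => (expMeasure r).prod E.uniformLaw) j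

theorem measurePreserving_gap (hr : 0 < r) (j : ℕ) : MeasurePreserving
    (fun ω : RequestSeq => ω.gap j) (requestLaw E r) (expMeasure r) := by
  have := isProbabilityMeasure_expMeasure hr
  exact measurePreserving_fst.comp (measurePreserving_eval_requestLaw hr j)

theorem measurePreserving_loc (hr : 0 < r) (j : ℕ) : MeasurePreserving
    (fun ω : RequestSeq => ω.loc j) (requestLaw E r) E.uniformLaw := by
  have := isProbabilityMeasure_expMeasure hr
  exact measurePreserving_snd.comp (measurePreserving_eval_requestLaw hr j)

theorem ae_exists_one_le_gap (hr : 0 < r) :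
    ∀ᵐ ω ∂requestLaw E r, ∀ n, ∃ k ≥ n, 1 ≤ RequestSeq.gap ω k := by
  have := isProbabilityMeasure_expMeasure hr
  rw [ae_all_iff]
  intro n
  rw [ae_iff]
  set c := expMeasure r (Set.Iio 1)
  have key : ∀ N : ℕ, requestLaw E r {ω | ¬ ∃ k ≥ n, 1 ≤ RequestSeq.gap ω k} ≤ c ^ N := by
    intro N
    have h1 : {ω : RequestSeq | ¬ ∃ k ≥ n, 1 ≤ ω.gap k} ⊆
        Set.pi (Finset.Ico n (n + N) : Finset ℕ) fun _ => Set.Iio (1 : ℝ) ×ˢ Set.univ := by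
      intro ω hω k hk
      simp only [not_exists, not_and, not_le, Set.mem_ofPred_eq] at hω
      exact ⟨hω k (Finset.mem_Ico.1 hk).1, trivial⟩
    refine (measure_mono h1).trans ?_
    unfold requestLaw
    rw [Measure.infinitePi_pi _ fun i _ => measurableSet_Iio.prod MeasurableSet.univ]
    simp [c]
  have hc : Tendsto (fun N : ℕ => c ^ N) atTop (𝓝 0) :=
    ENNReal.tendsto_pow_atTop_nhds_zero_of_lt_one (expMeasure_Iio_one_lt hr)
  -- The event has probability at most `c ^ N` for every `N`, with `c < 1`.
  exact le_antisymm (ge_of_tendsto' hc key) zero_le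

theorem ae_proper (hr : 0 < r) : ∀ᵐ ω ∂requestLaw E r, RequestSeq.Proper E ω := by
  have h1 : ∀ᵐ ω ∂requestLaw E r, ∀ j, 0 < RequestSeq.gap ω j := by
    rw [ae_all_iff]
    exact fun j => (measurePreserving_gap hr j).quasiMeasurePreserving.ae (expMeasure_ae_pos hr)
  have h2 : ∀ᵐ ω ∂requestLaw E r, ∀ j, RequestSeq.loc ω j ∈ E.square := by
    rw [ae_all_iff]
    exact fun j => (measurePreserving_loc hr j).quasiMeasurePreserving.ae E.ae_mem_square
  filter_upwards [h1, h2, ae_exists_one_le_gap (E := E) hr] with ω hω1 hω2 hω3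
  refine ⟨hω1, hω2, ?_⟩
  have hmono : StrictMono ω.arrival :=
    strictMono_nat_of_lt_succ fun j => by rw [RequestSeq.arrival_succ]; linarith [hω1 (j + 1)]
  apply tendsto_atTop_atTop_of_monotone hmono.monotone
  have hM : ∀ M : ℕ, ∃ n, (M : ℝ) ≤ ω.arrival n := by
    intro M
    induction M with
    | zero => exact ⟨0, by rw [RequestSeq.arrival_zero]; simpa using (hω1 0).le⟩
    | succ M ih =>
      obtain ⟨n, hn⟩ := ih
      obtain ⟨k, hk, hk'⟩ := hω3 (n + 1)
      obtain ⟨l, rfl⟩ : ∃ l, k = l + 1 := ⟨k - 1, by omega⟩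
      refine ⟨l + 1, ?_⟩
      rw [RequestSeq.arrival_succ]
      have := hmono.monotone (show n ≤ l by omega)
      push_cast
      linarith
  intro b
  obtain ⟨M, hb⟩ := exists_nat_ge b
  obtain ⟨n, hn⟩ := hM M
  exact ⟨n, hb.trans hn⟩

/-- Requests rarely appear in quick succession if their intensity is small. -/
theorem requestLaw_gap_lt_le (hr : 0 < r) {R : ℝ} (hR : 0 ≤ R) (n : ℕ) :
    requestLaw E r {ω | ∃ k < n, RequestSeq.gap ω k < R} ≤ n * ENNReal.ofReal (r * R) := by
  have h1 : {ω : RequestSeq | ∃ k < n, ω.gap k < R} =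
      ⋃ k ∈ Finset.range n, (fun ω : RequestSeq => ω.gap k) ⁻¹' Set.Iio R := by
    ext ω; simp
  rw [h1]
  refine (measure_biUnion_finset_le _ _).trans ?_
  calc ∑ k ∈ Finset.range n, requestLaw E r ((fun ω : RequestSeq => ω.gap k) ⁻¹' Set.Iio R)
      ≤ ∑ k ∈ Finset.range n, ENNReal.ofReal (r * R) := by
        refine Finset.sum_le_sum fun k _ => ?_
        rw [(measurePreserving_gap hr k).measure_preimage measurableSet_Iio.nullMeasurableSet]
        exact expMeasure_Iio_le hr hR
    _ = n * ENNReal.ofReal (r * R) := by simp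

/-! ### The coverage cost of the Strip Loitering algorithm -/

/-- Of `m` equally spaced phases, the smallest one. -/
theorem fract_mul_le {m : ℕ} (hm : 1 ≤ m) (y : ℝ) (i : ℕ) :
    Int.fract (m * y) / m ≤ Int.fract (y - i / m) := by
  have hm' : (0 : ℝ) < m := by exact_mod_cast hm
  rw [div_le_iff₀ hm']
  have h1 : Int.fract (y - i / m) * m = m * y - ((i + m * ⌊y - i / m⌋ : ℤ) : ℝ) := by
    rw [Int.fract]; push_cast; field_simp; ring
  calc Int.fract (m * y) = Int.fract (Int.fract (y - i / m) * m) := by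
        rw [h1, Int.fract_sub_intCast]
    _ ≤ Int.fract (y - i / m) * m := by
        rw [Int.fract]
        have : 0 ≤ ⌊Int.fract (y - i / m) * m⌋ :=
          Int.floor_nonneg.2 (mul_nonneg (Int.fract_nonneg _) hm'.le)
        have : (0 : ℝ) ≤ ⌊Int.fract (y - i / m) * m⌋ := by exact_mod_cast this
        linarith

/-- The minimizing index is the remainder of ⌊my⌋ modulo `m`: removing it from my leaves the
fractional part and a multiple of `m`. -/
theorem exists_fract_mul_eq {m : ℕ} (hm : 1 ≤ m) (y : ℝ) :
    ∃ i : Fin m, Int.fract (y - (i : ℕ) / m) = Int.fract (m * y) / m := by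
  have hm' : (0 : ℝ) < m := by exact_mod_cast hm
  have hmz : (0 : ℤ) < m := by exact_mod_cast hm
  have h0 : 0 ≤ ⌊(m * y : ℝ)⌋ % m := Int.emod_nonneg _ hmz.ne'
  have h1 : ⌊(m * y : ℝ)⌋ % m < m := Int.emod_lt_of_pos _ hmz
  refine ⟨⟨(⌊(m * y : ℝ)⌋ % m).toNat, by omega⟩, ?_⟩
  have h2 : (((⌊(m * y : ℝ)⌋ % m).toNat : ℕ) : ℝ) = ((⌊(m * y : ℝ)⌋ % m : ℤ) : ℝ) := by
    have : (((⌊(m * y : ℝ)⌋ % m).toNat : ℕ) : ℤ) = ⌊(m * y : ℝ)⌋ % m := Int.toNat_of_nonneg h0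
    exact_mod_cast this
  simp only [h2]
  have h3 : y - ((⌊(m * y : ℝ)⌋ % m : ℤ) : ℝ) / m =
      Int.fract (m * y) / m + ((⌊(m * y : ℝ)⌋ / m : ℤ) : ℝ) := by
    have h4 := Int.emod_add_mul_ediv ⌊(m * y : ℝ)⌋ m
    have h5 : ((⌊(m * y : ℝ)⌋ % m : ℤ) : ℝ) = ⌊(m * y : ℝ)⌋ - m * ((⌊(m * y : ℝ)⌋ / m : ℤ) : ℝ) := by
      rw [eq_sub_iff_add_eq]; exact_mod_cast h4
    rw [h5, Int.fract]
    field_simp; ring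
  rw [h3, Int.fract_add_intCast, Int.fract_eq_self]
  refine ⟨div_nonneg (Int.fract_nonneg _) hm'.le, ?_⟩
  rw [div_lt_one hm']
  have : (1 : ℝ) ≤ m := by exact_mod_cast hm
  exact (Int.fract_lt_one _).trans_le this

namespace Setting

variable (E : Setting) {m : ℕ}

/-- The distance that the responsible robot covers until it reaches the target. -/
def reachLength (m : ℕ) (c t : ℝ) (q : Plane) : ℝ :=
  E.loiterLength m / m *
    Int.fract (m * (E.departure m q - c) / E.loiterLength m - m * E.speed / E.loiterLength m * t) +
    E.serviceLength m q

/-- The responsible robot realizes the smallest of `m` equally spaced phases, which is a fractional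
part divided by `m`. The distance is therefore the same for all robots that tie for responsibility.
-/
theorem approachLength_of_responsible (hm : 1 ≤ m) {c t : ℝ} {i : Fin m} {q : Plane}
    (h : E.Responsible m c i t q) :
    E.approachLength m c i t q + E.serviceLength m q = E.reachLength m c t q := by
  have hL := E.loiterLength_pos hm
  have hm' : (0 : ℝ) < m := by exact_mod_cast hm
  set y := (E.departure m q - c - E.speed * t) / E.loiterLength m with hy
  have h1 : ∀ i : Fin m, E.approachLength m c i t q =
      E.loiterLength m * Int.fract (y - (i : ℕ) / m) := by
    intro i
    unfold approachLength place
    congr 2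
    rw [hy]; field_simp; ring
  have h2 : m * (E.departure m q - c) / E.loiterLength m -
      m * E.speed / E.loiterLength m * t = m * y := by
    rw [hy]; field_simp
  obtain ⟨i₀, hi₀⟩ := exists_fract_mul_eq hm y
  have h3 := h i₀
  rw [h1, h1, hi₀] at h3
  have h4 := mul_le_mul_of_nonneg_left (fract_mul_le hm y i) hL.le
  rw [reachLength, h2, h1, le_antisymm h3 h4]
  ring

theorem reachLength_nonneg (hm : 1 ≤ m) (c t : ℝ) (q : Plane) : 0 ≤ E.reachLength m c t q := by
  obtain ⟨i, hi⟩ := E.exists_responsible hm c t q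
  rw [← E.approachLength_of_responsible hm hi]
  linarith [E.approachLength_nonneg hm c i t q, E.serviceLength_nonneg (m := m) q]

theorem reachLength_le (hm : 1 ≤ m) (c t : ℝ) (q : Plane) :
    E.reachLength m c t q ≤ E.loiterLength m + 2 * Real.pi * E.radius := by
  obtain ⟨i, hi⟩ := E.exists_responsible hm c t q
  rw [← E.approachLength_of_responsible hm hi]
  linarith [E.approachLength_lt hm c i t q, E.serviceLength_le (m := m) q]

theorem measurable_reachLength (c : ℝ) :
    Measurable fun p : ℝ × Plane => E.reachLength m c p.1 p.2 := by
  have h1 : Measurable fun p : ℝ × Plane => E.departure m p.2 :=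
    E.measurable_departure.comp measurable_snd
  have h2 : Measurable fun p : ℝ × Plane => E.serviceLength m p.2 :=
    E.measurable_serviceLength.comp measurable_snd
  unfold reachLength
  refine Measurable.add (Measurable.const_mul (measurable_fract.comp (Measurable.sub ?_ ?_)) _) h2
  · exact ((h1.sub_const c).const_mul _).div_const _
  · exact measurable_fst.const_mul _

/-- Almost no target lies on the loitering path. -/
theorem ae_notMem_loiter (hm : 1 ≤ m) :
    ∀ᵐ q ∂E.uniformLaw, ∀ s, (E.loiterPose m s).point ≠ q := by
  have h0 := volume_range_eq_zero (E.steers_loiter hm ⟨0, hm⟩).differentiable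
  have h1 : E.uniformLaw (Set.range (E.loiter m ⟨0, hm⟩)) = 0 := by
    have := E.uniformLaw_le (Set.range (E.loiter m ⟨0, hm⟩))
    rw [h0, ENNReal.zero_div] at this
    exact le_antisymm this zero_le
  rw [← compl_mem_ae_iff] at h1
  filter_upwards [h1] with q hq s hs
  refine hq ⟨s / E.speed, ?_⟩
  rw [loiter, ← hs]
  have := E.speed_pos
  congr 2
  unfold place
  simp
  field_simp

end Setting

/-- The time that a service takes at most, and that it takes until all robots are back in place. -/
def settleTime (E : Setting) (m : ℕ) (R : ℝ) : ℝ :=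
  max R ((E.loiterLength m + 2 * Real.pi * E.radius) / E.speed)

variable {E : Setting} {m : ℕ} {π : Policy E m} {c R K : ℝ}

theorem settleTime_nonneg (hm : 1 ≤ m) (R : ℝ) : 0 ≤ settleTime E m R := by
  refine le_trans ?_ (le_max_right _ _)
  have h1 := E.loiterLength_pos hm
  have h2 := E.radius_pos
  have h3 := Real.pi_pos
  have h4 := E.speed_pos
  positivity

theorem reachLength_div_le (hm : 1 ≤ m) (R t : ℝ) (q : Plane) :
    E.reachLength m c t q / E.speed ≤ settleTime E m R :=
  (div_le_div_of_nonneg_right (E.reachLength_le hm c t q) E.speed_pos.le).trans (le_max_right _ _)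

/-- The waiting time of a request that does not interfere with others. -/
theorem IsStripLoiteringWith.waitTime_eq (h : IsStripLoiteringWith E m π c R K) (hm : 1 ≤ m)
    {ω : RequestSeq} (hω : ω.Proper E) {j : ℕ} (hgap : ∀ k < j + 2, settleTime E m R ≤ ω.gap k)
    (hloc : ∀ s, (E.loiterPose m s).point ≠ ω.loc j) :
    π.waitTime j ω =
      ENNReal.ofReal (E.reachLength m c (ω.arrival j) (ω.loc j) / E.speed) := by
  have hv := E.speed_pos
  have hR : ∀ k ≤ j, R ≤ ω.gap k := fun k hk =>
    (le_max_left _ _).trans (hgap k (by omega))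
  -- The gap after request `j` is long as well, so no further request appears before the target is
  -- reached.
  have hnext : ω.arrival j + E.reachLength m c (ω.arrival j) (ω.loc j) / E.speed ≤
      ω.arrival (j + 1) := by
    rw [RequestSeq.arrival_succ]
    linarith [reachLength_div_le (E := E) (c := c) hm R (ω.arrival j) (ω.loc j),
      hgap (j + 1) (by omega)]
  have hnn : 0 ≤ E.reachLength m c (ω.arrival j) (ω.loc j) / E.speed :=
    div_nonneg (E.reachLength_nonneg hm _ _ _) hv.le
  apply le_antisymm
  · obtain ⟨i, hi⟩ := E.exists_responsible hm c (ω.arrival j) (ω.loc j)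
    have h1 := h.serve ω hω j hR i hi _ hnext (E.serviceLength m (ω.loc j))
      (E.serviceLength_nonneg _) le_rfl (by
        rw [E.approachLength_of_responsible hm hi, add_sub_cancel_left, mul_div_cancel₀ _ hv.ne'])
    rw [E.point_advance_serviceLength hm (hω.2.1 j)] at h1
    refine (iInf₂_le _ ⟨by linarith, i, h1⟩).trans ?_
    rw [add_sub_cancel_left]
  -- No robot can be at the target earlier: loitering robots are on the path, which avoids the
  -- target, and the responsible one meets the target only at the end of its arc.
  · refine le_iInf₂ fun t ht => ?_
    obtain ⟨ht, i, hi⟩ := ht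
    by_contra! hlt
    have h1 := (ENNReal.ofReal_lt_ofReal_iff_of_nonneg (by linarith)).1 hlt
    have h2 : t ≤ ω.arrival (j + 1) := by linarith
    by_cases hr : E.Responsible m c i (ω.arrival j) (ω.loc j)
    · rcases le_or_gt (E.speed * (t - ω.arrival j))
        (E.approachLength m c i (ω.arrival j) (ω.loc j)) with h3 | h3
      · rw [h.approach ω hω j hR i hr t ht h2 h3] at hi
        exact hloc _ hi
      · have h4 : E.speed * (t - ω.arrival j) - E.approachLength m c i (ω.arrival j) (ω.loc j) <
            E.serviceLength m (ω.loc j) := by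
          rw [lt_div_iff₀ hv, ← E.approachLength_of_responsible hm hr] at h1
          linarith
        rw [h.serve ω hω j hR i hr t h2 _ (sub_pos.2 h3).le h4.le (by ring)] at hi
        exact E.point_advance_ne hm (hω.2.1 j) (sub_pos.2 h3).le h4 hi
    · rw [h.others_loiter ω hω j hR i hr t ht h2] at hi
      exact hloc _ hi

/-- The coverage cost of the Strip Loitering algorithm. -/
def loiterCost (E : Setting) (m : ℕ) : ℝ≥0∞ :=
  ENNReal.ofReal (E.loiterLength m / m / E.speed) * ENNReal.ofReal (1 / 2) +
    ∫⁻ q, ENNReal.ofReal (E.serviceLength m q / E.speed) ∂E.uniformLaw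

theorem loiterCost_ne_top (E : Setting) (m : ℕ) : loiterCost E m ≠ ∞ := by
  refine ENNReal.add_ne_top.2 ⟨ENNReal.mul_ne_top ENNReal.ofReal_ne_top ENNReal.ofReal_ne_top, ?_⟩
  have h : ∫⁻ q, ENNReal.ofReal (E.serviceLength m q / E.speed) ∂E.uniformLaw ≤
      ∫⁻ _, ENNReal.ofReal (2 * Real.pi * E.radius / E.speed) ∂E.uniformLaw :=
    lintegral_mono fun q => ENNReal.ofReal_le_ofReal
      (div_le_div_of_nonneg_right (E.serviceLength_le q) E.speed_pos.le)
  refine ne_top_of_le_ne_top ?_ h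
  simp

theorem arrival_update (ω : RequestSeq) (j : ℕ) (p : ℝ × Plane) :
    RequestSeq.arrival (Function.update ω j p) j = ∑ k ∈ Finset.range j, ω.gap k + p.1 := by
  unfold RequestSeq.arrival RequestSeq.gap
  rw [Finset.sum_range_succ, Function.update_self]
  congr 1
  refine Finset.sum_congr rfl fun k hk => ?_
  rw [Function.update_of_ne (Finset.mem_range.1 hk).ne]

theorem measurable_ofReal_reachLength (c : ℝ) (j : ℕ) : Measurable fun ω : RequestSeq =>
    ENNReal.ofReal (E.reachLength m c (ω.arrival j) (ω.loc j) / E.speed) := by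
  have h := (E.measurable_reachLength (m := m) c).fun_comp
    ((RequestSeq.measurable_arrival j).prodMk (RequestSeq.measurable_loc j))
  exact (h.div_const _).ennreal_ofReal

/-- Requests of small intensity find the robots at nearly uniformly distributed places. -/
theorem lintegral_reachLength (hm : 1 ≤ m) {r : ℝ} (hr : 0 < r) (c : ℝ) (j : ℕ) :
    ∃ β > 0, β = m * E.speed / E.loiterLength m ∧
    loiterCost E m ≤ ENNReal.ofReal (Real.exp (r / β)) * ∫⁻ ω, ENNReal.ofReal
      (E.reachLength m c (RequestSeq.arrival ω j) (RequestSeq.loc ω j) / E.speed) ∂requestLaw E r ∧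
    ∫⁻ ω, ENNReal.ofReal (E.reachLength m c (RequestSeq.arrival ω j) (RequestSeq.loc ω j) / E.speed)
      ∂requestLaw E r ≤ ENNReal.ofReal (Real.exp (r / β)) * loiterCost E m := by
  have hL := E.loiterLength_pos hm
  have hv := E.speed_pos
  have hm' : (0 : ℝ) < m := by exact_mod_cast hm
  have hP := isProbabilityMeasure_requestLaw E hr
  have hexp := isProbabilityMeasure_expMeasure hr
  set β := m * E.speed / E.loiterLength m with hβ
  have hβ0 : 0 < β := by positivity
  refine ⟨β, hβ0, rfl, ?_⟩
  set X := ENNReal.ofReal (Real.exp (r / β)) with hX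
  have hX1 : 1 ≤ X := by
    rw [hX, ENNReal.one_le_ofReal]
    exact Real.one_le_exp (by positivity)
  set a := ENNReal.ofReal (E.loiterLength m / m / E.speed) with ha
  set sv : Plane → ℝ≥0∞ := fun q => ENNReal.ofReal (E.serviceLength m q / E.speed) with hsv
  set F : RequestSeq → Plane → ℝ≥0∞ := fun ω q =>
    ∫⁻ g, ENNReal.ofReal (Int.fract ((m * (E.departure m q - c) / E.loiterLength m -
      β * ∑ k ∈ Finset.range j, ω.gap k) - β * g)) ∂expMeasure r with hF
  -- With the location and all other requests fixed, only the gap before request `j` is random, and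
  -- it enters only through the phase of the robots.
  have hinner : ∀ (ω : RequestSeq) (q : Plane), ∫⁻ g, ENNReal.ofReal (E.reachLength m c
      (RequestSeq.arrival (Function.update ω j (g, q)) j)
      (RequestSeq.loc (Function.update ω j (g, q)) j) / E.speed) ∂expMeasure r = a * F ω q + sv q := by
    intro ω q
    have h1 : ∀ g : ℝ, ENNReal.ofReal (E.reachLength m c
      (RequestSeq.arrival (Function.update ω j (g, q)) j)
      (RequestSeq.loc (Function.update ω j (g, q)) j) / E.speed) =
        a * ENNReal.ofReal (Int.fract ((m * (E.departure m q - c) / E.loiterLength m -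
          β * ∑ k ∈ Finset.range j, ω.gap k) - β * g)) + sv q := by
      intro g
      have h2 : RequestSeq.loc (Function.update ω j (g, q)) j = q := by
        unfold RequestSeq.loc; rw [Function.update_self]
      have hs := E.serviceLength_nonneg (m := m) q
      have hf := Int.fract_nonneg ((m * (E.departure m q - c) / E.loiterLength m -
          β * ∑ k ∈ Finset.range j, ω.gap k) - β * g)
      rw [h2, arrival_update, ha, hsv, ← ENNReal.ofReal_mul (by positivity),
        ← ENNReal.ofReal_add (by positivity) (by positivity), Setting.reachLength, add_div, ← hβ]
      congr 2
      rw [show m * (E.departure m q - c) / E.loiterLength m -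
        β * (∑ k ∈ Finset.range j, ω.gap k + g) = m * (E.departure m q - c) / E.loiterLength m -
          β * ∑ k ∈ Finset.range j, ω.gap k - β * g by ring]
      ring
    simp only [h1]
    rw [lintegral_add_right _ measurable_const, lintegral_const_mul _ (by fun_prop)]
    simp [hF]
  have hFb : ∀ ω q, ENNReal.ofReal (1 / 2) ≤ X * F ω q ∧ F ω q ≤ X * ENNReal.ofReal (1 / 2) :=
    fun ω q => lintegral_fract_expMeasure hr hβ0 _
  rw [lintegral_requestLaw hr j (measurable_ofReal_reachLength c j)]
  simp only [hinner]
  have hcost : loiterCost E m = ∫⁻ _, ∫⁻ q, (a * ENNReal.ofReal (1 / 2) + sv q)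
      ∂E.uniformLaw ∂requestLaw E r := by
    rw [lintegral_const, measure_univ, mul_one, lintegral_add_left measurable_const,
      lintegral_const, measure_univ, mul_one]
    rfl
  constructor
  · rw [hcost]
    calc ∫⁻ _, ∫⁻ q, (a * ENNReal.ofReal (1 / 2) + sv q) ∂E.uniformLaw ∂requestLaw E r
        ≤ ∫⁻ ω, ∫⁻ q, X * (a * F ω q + sv q) ∂E.uniformLaw ∂requestLaw E r := by
          refine lintegral_mono fun ω => lintegral_mono fun q => ?_
          rw [mul_add, mul_left_comm]
          gcongr
          · exact (hFb ω q).1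
          · exact le_mul_of_one_le_left zero_le hX1
      _ = X * ∫⁻ ω, ∫⁻ q, (a * F ω q + sv q) ∂E.uniformLaw ∂requestLaw E r := by
          rw [← lintegral_const_mul' _ _ ENNReal.ofReal_ne_top]
          congr 1; ext ω
          rw [lintegral_const_mul' _ _ ENNReal.ofReal_ne_top]
  · rw [hcost, ← lintegral_const_mul' _ _ ENNReal.ofReal_ne_top]
    refine lintegral_mono fun ω => ?_
    simp only
    rw [← lintegral_const_mul' _ _ ENNReal.ofReal_ne_top]
    refine lintegral_mono fun q => ?_
    rw [mul_add, mul_left_comm]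
    gcongr
    · exact (hFb ω q).2
    · exact le_mul_of_one_le_left zero_le hX1

/-- Unless one of the first `j + 2` gaps is short, the wait is almost surely the explicit one. The
exceptional event has probability O(r); on it the wait is at most K(j + 1) and the explicit value at
most `settleTime`. -/
theorem IsStripLoiteringWith.expectedWait_bounds (h : IsStripLoiteringWith E m π c R K) (hm : 1 ≤ m)
    {r : ℝ} (hr : 0 < r) (j : ℕ) :
    π.expectedWait j r ≤ (∫⁻ ω, ENNReal.ofReal (E.reachLength m c (RequestSeq.arrival ω j)
        (RequestSeq.loc ω j) / E.speed) ∂requestLaw E r) +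
      ENNReal.ofReal (K * (j + 1)) * ((j + 2 : ℕ) * ENNReal.ofReal (r * settleTime E m R)) ∧
    (∫⁻ ω, ENNReal.ofReal (E.reachLength m c (RequestSeq.arrival ω j) (RequestSeq.loc ω j) / E.speed)
        ∂requestLaw E r) ≤ π.expectedWait j r +
      ENNReal.ofReal (settleTime E m R) *
        ((j + 2 : ℕ) * ENNReal.ofReal (r * settleTime E m R)) := by
  set bad : Set RequestSeq := {ω | ∃ k < j + 2, ω.gap k < settleTime E m R} with hbad
  have hbm : MeasurableSet bad := by
    have : bad = ⋃ k ∈ Finset.range (j + 2), {ω : RequestSeq | ω.gap k < settleTime E m R} := by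
      ext ω; simp [hbad]
    rw [this]
    exact Finset.measurableSet_biUnion _ fun k _ =>
      measurableSet_lt (RequestSeq.measurable_gap k) measurable_const
  have hbP := requestLaw_gap_lt_le (E := E) hr (settleTime_nonneg (E := E) hm R) (j + 2)
  have hae : ∀ᵐ ω ∂requestLaw E r, ω.Proper E ∧ ∀ s, (E.loiterPose m s).point ≠ ω.loc j :=
    (ae_proper hr).and ((measurePreserving_loc hr j).quasiMeasurePreserving.ae
      (E.ae_notMem_loiter hm))
  have hgood : ∀ ω : RequestSeq, ω ∉ bad → ∀ k < j + 2, settleTime E m R ≤ ω.gap k := by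
    intro ω hω k hk
    by_contra! hlt
    exact hω ⟨k, hk, hlt⟩
  have hind : ∀ b : ℝ≥0∞, ∫⁻ ω, bad.indicator (fun _ => b) ω ∂requestLaw E r ≤
      b * ((j + 2 : ℕ) * ENNReal.ofReal (r * settleTime E m R)) := by
    intro b
    rw [lintegral_indicator_const hbm]
    gcongr
  constructor
  · refine le_trans ?_ (add_le_add_right (hind _) _)
    rw [← lintegral_add_left (measurable_ofReal_reachLength c j)]
    refine lintegral_mono_ae ?_
    filter_upwards [hae] with ω hω
    by_cases hb : ω ∈ bad
    · rw [Set.indicator_of_mem hb]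
      exact (h.bounded_wait ω hω.1 j).trans le_add_self
    · rw [h.waitTime_eq hm hω.1 (hgood ω hb) hω.2]
      exact le_self_add
  · refine le_trans ?_ (add_le_add_right (hind _) _)
    unfold Policy.expectedWait
    rw [← lintegral_add_right _ (measurable_const.indicator hbm)]
    refine lintegral_mono_ae ?_
    filter_upwards [hae] with ω hω
    by_cases hb : ω ∈ bad
    · rw [Set.indicator_of_mem hb]
      exact (ENNReal.ofReal_le_ofReal (reachLength_div_le hm R _ _)).trans le_add_self
    · rw [h.waitTime_eq hm hω.1 (hgood ω hb) hω.2]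
      exact le_self_add

/-- Squeezed between bounds with factors exp(±r/β) and errors O(r). The limit does not depend on
`j`, so the outer limit in the coverage cost is that of a constant sequence. -/
theorem IsStripLoiteringWith.tendsto_expectedWait (h : IsStripLoiteringWith E m π c R K)
    (hm : 1 ≤ m) (j : ℕ) :
    Tendsto (π.expectedWait j) (𝓝[>] 0) (𝓝 (loiterCost E m)) := by
  have hL := E.loiterLength_pos hm
  have hv := E.speed_pos
  have hm' : (0 : ℝ) < m := by exact_mod_cast hm
  set β := m * E.speed / E.loiterLength m with hβ
  have herr : ∀ b : ℝ≥0∞, b ≠ ∞ → Tendsto (fun r : ℝ => b * ((j + 2 : ℕ) *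
      ENNReal.ofReal (r * settleTime E m R))) (𝓝[>] 0) (𝓝 0) := by
    intro b hb
    have h1 : Tendsto (fun r : ℝ => ENNReal.ofReal (r * settleTime E m R)) (𝓝[>] 0) (𝓝 0) := by
      have : Continuous fun r : ℝ => ENNReal.ofReal (r * settleTime E m R) :=
        ENNReal.continuous_ofReal.comp (by fun_prop)
      have := (this.tendsto 0).mono_left (nhdsWithin_le_nhds (s := Set.Ioi 0))
      simpa using this
    have h2 := ENNReal.Tendsto.const_mul (a := b) (ENNReal.Tendsto.const_mul
      (a := ((j + 2 : ℕ) : ℝ≥0∞)) h1 (Or.inr (ENNReal.natCast_ne_top _))) (Or.inr hb)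
    simpa using h2
  have hexp : ∀ s : ℝ, Tendsto (fun r : ℝ => ENNReal.ofReal (Real.exp (s * (r / β))) *
      loiterCost E m) (𝓝[>] 0) (𝓝 (loiterCost E m)) := by
    intro s
    have : Continuous fun r : ℝ => ENNReal.ofReal (Real.exp (s * (r / β))) :=
      ENNReal.continuous_ofReal.comp (by fun_prop)
    have h1 := (this.tendsto 0).mono_left (nhdsWithin_le_nhds (s := Set.Ioi 0))
    have h2 := ENNReal.Tendsto.mul_const (b := loiterCost E m) h1
      (Or.inr (loiterCost_ne_top E m))
    simpa using h2
  have hupper := (hexp 1).add (herr (ENNReal.ofReal (K * (j + 1))) ENNReal.ofReal_ne_top)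
  have hlower := ENNReal.Tendsto.sub (hexp (-1))
    (herr (ENNReal.ofReal (settleTime E m R)) ENNReal.ofReal_ne_top)
    (Or.inl (loiterCost_ne_top E m))
  rw [add_zero] at hupper
  rw [tsub_zero] at hlower
  refine tendsto_of_tendsto_of_tendsto_of_le_of_le' hlower hupper ?_ ?_
  · filter_upwards [self_mem_nhdsWithin] with r hr
    obtain ⟨β', -, hβ', h1, -⟩ := lintegral_reachLength (E := E) hm hr c j
    rw [← hβ] at hβ'
    subst hβ'
    rw [tsub_le_iff_right]
    refine le_trans ?_ (h.expectedWait_bounds hm hr j).2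
    calc ENNReal.ofReal (Real.exp (-1 * (r / β))) * loiterCost E m
        ≤ ENNReal.ofReal (Real.exp (-1 * (r / β))) * (ENNReal.ofReal (Real.exp (r / β)) * _) := by
          gcongr
      _ = _ := by
          rw [← mul_assoc, ← ENNReal.ofReal_mul (Real.exp_pos _).le, ← Real.exp_add]
          simp
  · filter_upwards [self_mem_nhdsWithin] with r hr
    obtain ⟨β', -, hβ', -, h1⟩ := lintegral_reachLength (E := E) hm hr c j
    rw [← hβ] at hβ'
    subst hβ'
    refine (h.expectedWait_bounds hm hr j).1.trans ?_
    rw [one_mul]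
    gcongr

theorem IsStripLoitering.hasCoverageCost (h : IsStripLoitering E m π) (hm : 1 ≤ m) :
    π.HasCoverageCost (loiterCost E m) := by
  obtain ⟨c, R, K, h⟩ := h
  exact ⟨fun _ => loiterCost E m, h.tendsto_expectedWait hm, tendsto_const_nhds⟩

/-! ### Asymptotics of the coverage cost -/

theorem lintegral_abs_sub (b : ℝ) {h : ℝ} (hh : 0 ≤ h) :
    ∫⁻ y in Set.Icc (b - h) (b + h), ENNReal.ofReal |y - b| = ENNReal.ofReal (h ^ 2) := by
  have hc : Continuous fun y : ℝ => |y - b| := by fun_prop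
  rw [← ofReal_integral_eq_lintegral_ofReal hc.continuousOn.integrableOn_Icc
    (Eventually.of_forall fun y => abs_nonneg _), integral_Icc_eq_integral_Ioc,
    ← intervalIntegral.integral_of_le (by linarith),
    intervalIntegral.integral_comp_sub_right (fun y => |y|) b]
  congr 1
  have hi : ∀ a b : ℝ, IntervalIntegrable (fun y : ℝ => |y|) volume a b :=
    fun a b => continuous_abs.intervalIntegrable a b
  rw [← intervalIntegral.integral_add_adjacent_intervals (hi _ 0) (hi 0 _)]
  have h1 : ∫ y in (b - h - b)..0, |y| = ∫ y in (b - h - b)..0, -y := by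
    apply intervalIntegral.integral_congr
    intro y hy
    rw [Set.uIcc_of_le (by linarith)] at hy
    exact abs_of_nonpos hy.2
  have h2 : ∫ y in (0 : ℝ)..(b + h - b), |y| = ∫ y in (0 : ℝ)..(b + h - b), y := by
    apply intervalIntegral.integral_congr
    intro y hy
    rw [Set.uIcc_of_le (by linarith)] at hy
    exact abs_of_nonneg hy.1
  rw [h1, h2, intervalIntegral.integral_neg, integral_id, integral_id]
  ring

/-- An angle below π/2 is at most its tangent, here y/√(1 − y²), and 0.97 ≥ 1/1.02². -/
theorem arcsin_le_mul {y : ℝ} (h0 : 0 ≤ y) (h1 : y ^ 2 ≤ 0.03) : Real.arcsin y ≤ 1.02 * y := by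
  have hy1 : y < 1 := by nlinarith
  have hs : (1 / 1.02 : ℝ) ≤ √(1 - y ^ 2) := by
    apply Real.le_sqrt_of_sq_le
    norm_num at h1 ⊢
    linarith
  have h2 : 0 < √(1 - y ^ 2) := lt_of_lt_of_le (by norm_num) hs
  refine (Real.le_tan (Real.arcsin_nonneg.2 h0) (Real.arcsin_lt_pi_div_two.2 hy1)).trans ?_
  rw [Real.tan_arcsin, div_le_iff₀ h2]
  have : 1 ≤ 1.02 * √(1 - y ^ 2) := by
    rw [div_le_iff₀ (by norm_num)] at hs
    linarith
  nlinarith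

namespace Setting

variable (E : Setting) {m : ℕ}

/-- Each strip contributes the integral of the distance to its bisector, (w/2)². The last strip may
extend below the square, which only enlarges the bound. -/
theorem lintegral_offset_le (hm : 1 ≤ m) : ∫⁻ q, ENNReal.ofReal (E.offset m q) ∂E.uniformLaw ≤
    ENNReal.ofReal (E.numStrips m * (E.width m / 2) ^ 2 / E.side) := by
  have hs := E.side_pos
  have hw := E.width_pos hm
  set f : ℝ → ℝ≥0∞ := fun y => ∑ k ∈ Finset.range (E.numStrips m),
    (Set.Icc (E.bisector m k - E.width m / 2) (E.bisector m k + E.width m / 2)).indicator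
      (fun y => ENNReal.ofReal |y - E.bisector m k|) y with hf
  have hfk : ∀ k : ℕ, Measurable fun y : ℝ => ENNReal.ofReal |y - E.bisector m k| := fun k => by
    have : Continuous fun y : ℝ => |y - E.bisector m k| := by fun_prop
    exact this.measurable.ennreal_ofReal
  have hfm : Measurable f :=
    Finset.measurable_fun_sum _ fun k _ => (hfk k).indicator measurableSet_Icc
  have hle : ∫⁻ q, ENNReal.ofReal (E.offset m q) ∂E.uniformLaw ≤ ∫⁻ q, f (q 1) ∂E.uniformLaw := by
    refine lintegral_mono_ae ?_
    filter_upwards [E.ae_mem_square] with q hq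
    obtain ⟨h1, h2⟩ := E.stripOf_bounds hm hq
    have hmem : E.stripOf m q ∈ Finset.range (E.numStrips m) := Finset.mem_range.2 (E.stripOf_lt hm q)
    refine le_trans (le_of_eq ?_) (Finset.single_le_sum (fun _ _ => zero_le) hmem)
    rw [Set.indicator_of_mem]
    · rfl
    · unfold bisector
      constructor <;> linarith
  refine hle.trans ?_
  rw [E.lintegral_uniformLaw_coord 1 hfm]
  have hint : ∫⁻ y in Set.Icc 0 E.side, f y ≤
      ENNReal.ofReal (E.numStrips m * (E.width m / 2) ^ 2) := by
    refine (setLIntegral_le_lintegral _ _).trans ?_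
    rw [lintegral_finsetSum _ fun k _ => (hfk k).indicator measurableSet_Icc]
    simp only [lintegral_indicator measurableSet_Icc, lintegral_abs_sub _ (half_pos hw).le]
    rw [Finset.sum_const, Finset.card_range, nsmul_eq_mul,
      ENNReal.ofReal_mul (Nat.cast_nonneg _), ENNReal.ofReal_natCast]
  rw [ENNReal.ofReal_div_of_pos hs, ENNReal.div_eq_inv_mul]
  gcongr

/-- For narrow strips the arc length is about √(2ρd) at offset d. The tangent line of the square
root at d = w/4 reduces its mean to that of the offset, which is about w/4. This replaces the exact
mean by √(ρw/2), which is enough for the constant 1.238. -/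
theorem lintegral_serviceLength_le (hm : 1 ≤ m) (h1 : E.width m ≤ 0.12 * E.radius)
    (h2 : E.width m ≤ 0.02 * E.side) :
    ∫⁻ q, ENNReal.ofReal (E.serviceLength m q / E.speed) ∂E.uniformLaw ≤
      ENNReal.ofReal (1.0302 * √(E.radius * E.width m / 2) / E.speed) := by
  have hs := E.side_pos
  have hw := E.width_pos hm
  have hρ := E.radius_pos
  have hv := E.speed_pos
  have hhpos : 0 < √(E.radius * E.width m / 2) := Real.sqrt_pos.2 (by positivity)
  have hh2 : √(E.radius * E.width m / 2) ^ 2 = E.radius * E.width m / 2 :=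
    Real.sq_sqrt (by positivity)
  set h := √(E.radius * E.width m / 2)
  have hpt : ∀ q ∈ E.square, E.serviceLength m q / E.speed ≤
      1.02 * E.radius / (h * E.speed) * E.offset m q + 1.02 * h / (2 * E.speed) := by
    intro q hq
    have hd := E.offset_le hm hq
    have hd0 := E.offset_nonneg (m := m) q
    set d := E.offset m q
    have hx0 : 0 ≤ d / (2 * E.radius) := by positivity
    have hsq := Real.sq_sqrt hx0
    set x := √(d / (2 * E.radius)) with hx
    have hx0' : 0 ≤ x := Real.sqrt_nonneg _
    have ha : Real.arcsin x ≤ 1.02 * x := by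
      apply arcsin_le_mul hx0'
      rw [hsq, div_le_iff₀ (by positivity)]
      norm_num at h1 ⊢
      linarith
    have hsl : E.serviceLength m q ≤ 2 * E.radius * (1.02 * x) := by
      unfold serviceLength
      gcongr
    have hdx : d = 2 * E.radius * x ^ 2 := by rw [hsq]; field_simp
    -- The inequality of arithmetic and geometric means, with h = √(ρw/2) as the value of √(2ρd) at
    -- the mean offset w/4; the difference of the two sides is a square over 2h.
    have ham : 2 * E.radius * x ≤ E.radius / h * d + h / 2 := by
      rw [hdx]
      have h3 : E.radius / h * (2 * E.radius * x ^ 2) + h / 2 - 2 * E.radius * x =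
          (2 * E.radius * x - h) ^ 2 / (2 * h) := by
        field_simp; ring
      have h4 : 0 ≤ (2 * E.radius * x - h) ^ 2 / (2 * h) := by positivity
      linarith
    rw [div_le_iff₀ hv]
    have h5 : (1.02 * E.radius / (h * E.speed) * d + 1.02 * h / (2 * E.speed)) * E.speed =
        1.02 * (E.radius / h * d + h / 2) := by field_simp
    rw [h5]
    linarith
  have ha0 : 0 ≤ 1.02 * E.radius / (h * E.speed) := by positivity
  have hb0 : 0 ≤ 1.02 * h / (2 * E.speed) := by positivity
  calc ∫⁻ q, ENNReal.ofReal (E.serviceLength m q / E.speed) ∂E.uniformLaw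
      ≤ ∫⁻ q, (ENNReal.ofReal (1.02 * E.radius / (h * E.speed)) * ENNReal.ofReal (E.offset m q) +
          ENNReal.ofReal (1.02 * h / (2 * E.speed))) ∂E.uniformLaw := by
        refine lintegral_mono_ae ?_
        filter_upwards [E.ae_mem_square] with q hq
        rw [← ENNReal.ofReal_mul ha0,
          ← ENNReal.ofReal_add (mul_nonneg ha0 (E.offset_nonneg q)) hb0]
        exact ENNReal.ofReal_le_ofReal (hpt q hq)
    _ = ENNReal.ofReal (1.02 * E.radius / (h * E.speed)) *
          (∫⁻ q, ENNReal.ofReal (E.offset m q) ∂E.uniformLaw) +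
          ENNReal.ofReal (1.02 * h / (2 * E.speed)) := by
        rw [lintegral_add_right _ measurable_const,
          lintegral_const_mul _ E.measurable_offset.ennreal_ofReal, lintegral_const, measure_univ,
          mul_one]
    _ ≤ ENNReal.ofReal (1.02 * E.radius / (h * E.speed)) *
          ENNReal.ofReal (1.02 * (E.width m / 4)) + ENNReal.ofReal (1.02 * h / (2 * E.speed)) := by
        gcongr
        refine (E.lintegral_offset_le hm).trans (ENNReal.ofReal_le_ofReal ?_)
        rw [div_le_iff₀ hs]
        have h6 : E.numStrips m * E.width m ≤ 1.02 * E.side := by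
          have := E.numStrips_sub_one_mul_lt hm
          norm_num at h2 ⊢
          linarith
        nlinarith
    -- 1.0302 = 1.02 · (1.02 + 1)/2: one factor 1.02 comes from the arcsine, the other from rounding
    -- the number of strips up.
    _ = ENNReal.ofReal (1.0302 * h / E.speed) := by
        rw [← ENNReal.ofReal_mul ha0, ← ENNReal.ofReal_add (by positivity) hb0]
        congr 1
        have h7 : E.width m = 2 * h ^ 2 / E.radius := by rw [hh2]; field_simp
        rw [h7]
        field_simp
        norm_num

/-- The area of the square, increased by the area that the turns take. -/
def extendedArea : ℝ := E.area + 10.38 * E.radius * √E.area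

theorem extendedArea_pos : 0 < E.extendedArea := by
  have := E.area_pos; have := E.radius_pos
  unfold extendedArea; positivity

theorem uTurnAngle_le (hm : 1 ≤ m) : E.uTurnAngle m ≤ Real.pi / 3 := by
  have h1 : Real.arccos (1 / 2) = Real.pi / 3 := by
    rw [← Real.cos_pi_div_three, Real.arccos_cos (by linarith [Real.pi_pos]) (by linarith [Real.pi_pos])]
  rw [← h1]
  apply Real.arccos_le_arccos
  have := E.width_pos hm; have := E.radius_pos
  have : 0 ≤ E.width m / (4 * E.radius) := by positivity
  linarith

/-- There are fewer than side/w strips before the last one. Each costs the side, 2ρ for the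
extensions, and a U-turn of length at most 7πρ/3 < 7.36ρ since α ≤ π/3; this is within side +
10.38ρ. The last run and the closing piece are bounded. -/
theorem loiterLength_le (hm : 1 ≤ m) : E.loiterLength m ≤
    E.extendedArea / E.width m + (3 * E.side + 4 * E.radius + 2 * Real.pi * E.radius) := by
  have hs := E.side_pos
  have hw := E.width_pos hm
  have hρ := E.radius_pos
  have hπ : Real.pi < 3.15 := Real.pi_lt_d2
  have hn : (E.numStrips m : ℝ) - 1 ≤ E.side / E.width m := by
    rw [le_div_iff₀ hw]; exact (E.numStrips_sub_one_mul_lt hm).le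
  have hu : E.uTurnLength m ≤ 7.36 * E.radius := by
    have := E.uTurnAngle_le hm
    unfold uTurnLength
    nlinarith
  have h1 : (E.numStrips m - 1) * (E.runLength + E.uTurnLength m) ≤
      E.side / E.width m * (E.side + 10.38 * E.radius) := by
    have h2 : 0 ≤ E.runLength + E.uTurnLength m := by
      linarith [E.runLength_pos, E.uTurnLength_pos (m := m)]
    refine (mul_le_mul_of_nonneg_right hn h2).trans ?_
    refine mul_le_mul_of_nonneg_left ?_ (by positivity)
    unfold runLength
    norm_num at hu ⊢
    linarith
  have h3 : E.side / E.width m * (E.side + 10.38 * E.radius) = E.extendedArea / E.width m := by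
    unfold extendedArea
    rw [← side_sq]
    rw [Real.sqrt_sq hs.le]
    ring
  rw [E.loiterLength_eq hm]
  have h4 := E.closureLength_le hm
  unfold runLength at h4
  rw [h3] at h1
  have h5 : E.runLength = E.side + 2 * E.radius := rfl
  linarith

end Setting

/-- With κ³ = 4B/(3√ρ) and z = m^(1/3), the width is eventually (κ/z)², so both contributions are
multiples of √ρ·κ/z. The approach gives 3/8, plus 0.02 to absorb bounded lengths, and the arc gives
at most 0.7286. The sum 1.1236 is below 1.238 · 0.908, and 0.908 is a lower bound for (3/4)^(1/3),
the factor of √ρ·κ in (ρB)^(1/3). -/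
theorem eventually_loiterCost_le (E : Setting) : ∀ᶠ m : ℕ in atTop,
    loiterCost E m * ENNReal.ofReal ((m : ℝ) ^ (1 / 3 : ℝ)) ≤ ENNReal.ofReal (1.238 / E.speed *
      (E.radius * E.area + 10.38 * E.radius ^ 2 * √E.area) ^ (1 / 3 : ℝ)) := by
  have hs := E.side_pos
  have hρ := E.radius_pos
  have hv := E.speed_pos
  have hB := E.extendedArea_pos
  have hsρ : 0 < √E.radius := Real.sqrt_pos.2 hρ
  have hsρ2 : √E.radius ^ 2 = E.radius := Real.sq_sqrt hρ.le
  set C := 3 * E.side + 4 * E.radius + 2 * Real.pi * E.radius with hC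
  have hC0 : 0 ≤ C := by have := Real.pi_pos; positivity
  set κ := (4 / (3 * √E.radius) * E.extendedArea) ^ (1 / 3 : ℝ) with hκ
  have hκ0 : 0 < κ := by positivity
  have hκ3 : κ ^ 3 = 4 / (3 * √E.radius) * E.extendedArea := by
    rw [hκ, ← Real.rpow_natCast, ← Real.rpow_mul (by positivity)]
    norm_num
  have hz : Tendsto (fun m : ℕ => (m : ℝ) ^ (1 / 3 : ℝ)) atTop atTop :=
    (tendsto_rpow_atTop (by norm_num)).comp tendsto_natCast_atTop_atTop
  have hx : Tendsto (fun m : ℕ => (κ / (m : ℝ) ^ (1 / 3 : ℝ)) ^ 2) atTop (𝓝 0) := by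
    have := (tendsto_const_nhds (x := κ)).div_atTop hz
    simpa using this.pow 2
  have hy : Tendsto (fun m : ℕ => C / (2 * ((m : ℝ) ^ (1 / 3 : ℝ)) ^ 2)) atTop (𝓝 0) :=
    (tendsto_const_nhds (x := C)).div_atTop
      (((tendsto_pow_atTop two_ne_zero).comp hz).const_mul_atTop two_pos)
  filter_upwards [eventually_ge_atTop 1,
    hx.eventually (eventually_le_nhds (show 0 < 2 * E.radius by positivity)),
    hx.eventually (eventually_le_nhds (show 0 < 0.12 * E.radius by positivity)),
    hx.eventually (eventually_le_nhds (show 0 < 0.02 * E.side by positivity)),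
    hy.eventually (eventually_le_nhds (show 0 < 0.02 * (√E.radius * κ) by positivity))]
    with m hm h1 h2 h3 h4
  have hm' : (0 : ℝ) < m := by exact_mod_cast hm
  have hz0 : 0 < (m : ℝ) ^ (1 / 3 : ℝ) := by positivity
  have hz3 : ((m : ℝ) ^ (1 / 3 : ℝ)) ^ 3 = m := by
    rw [← Real.rpow_natCast, ← Real.rpow_mul hm'.le]
    norm_num
  set z := (m : ℝ) ^ (1 / 3 : ℝ)
  have hw : E.width m = (κ / z) ^ 2 := by
    have h5 : 4 / (3 * √E.radius) * ((E.area + 10.38 * E.radius * √E.area) / m) = (κ / z) ^ 3 := by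
      rw [div_pow, hκ3, hz3, mul_div_assoc']; rfl
    have h6 : ((κ / z) ^ 3) ^ (2 / 3 : ℝ) = (κ / z) ^ 2 := by
      rw [← Real.rpow_natCast, ← Real.rpow_mul (by positivity), ← Real.rpow_natCast]
      norm_num
    rw [Setting.width, h5, h6, min_eq_left h1]
  rw [← hw] at h1 h2 h3
  have hserv := E.lintegral_serviceLength_le hm h2 h3
  have hlen := E.loiterLength_le hm
  have hL := E.loiterLength_pos hm
  have hsqrt : √(E.radius * E.width m / 2) ≤ 0.7072 * (√E.radius * (κ / z)) := by
    apply Real.sqrt_le_iff.2 ⟨by positivity, ?_⟩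
    rw [mul_pow, mul_pow, hsρ2, ← hw]
    have : 0 ≤ E.radius * E.width m := mul_nonneg hρ.le (E.width_pos hm).le
    norm_num
    linarith
  have hBκ : E.extendedArea = 3 / 4 * √E.radius * κ ^ 3 := by
    rw [hκ3]; field_simp
  have hRHS : 0.908 * (√E.radius * κ) ≤
      (E.radius * E.area + 10.38 * E.radius ^ 2 * √E.area) ^ (1 / 3 : ℝ) := by
    have h5 : E.radius * E.area + 10.38 * E.radius ^ 2 * √E.area = 3 / 4 * (√E.radius * κ) ^ 3 := by
      have h6 : E.radius * E.area + 10.38 * E.radius ^ 2 * √E.area = E.radius * E.extendedArea := by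
        unfold Setting.extendedArea; ring
      rw [h6, hBκ]
      nth_rewrite 1 [← hsρ2]
      ring
    rw [h5]
    have h6 : (0 : ℝ) ≤ 0.908 * (√E.radius * κ) := by positivity
    calc 0.908 * (√E.radius * κ) = ((0.908 * (√E.radius * κ)) ^ 3) ^ (1 / 3 : ℝ) := by
          rw [← Real.rpow_natCast, ← Real.rpow_mul h6]; norm_num
      _ ≤ (3 / 4 * (√E.radius * κ) ^ 3) ^ (1 / 3 : ℝ) := by
          apply Real.rpow_le_rpow (by positivity) _ (by norm_num)
          rw [mul_pow]
          gcongr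
          norm_num
  have hcost : loiterCost E m ≤ ENNReal.ofReal (E.loiterLength m / m / E.speed * (1 / 2) +
      1.0302 * √(E.radius * E.width m / 2) / E.speed) := by
    rw [ENNReal.ofReal_add (by positivity) (by positivity), ENNReal.ofReal_mul (by positivity)]
    exact add_le_add_right hserv _
  refine (mul_le_mul_left hcost _).trans ?_
  rw [← ENNReal.ofReal_mul (by positivity)]
  apply ENNReal.ofReal_le_ofReal
  have hfirst : E.loiterLength m / m * (1 / 2) * z ≤
      3 / 8 * (√E.radius * κ) + 0.02 * (√E.radius * κ) := by
    have h5 : (E.extendedArea / E.width m + C) / m * (1 / 2) * z =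
        3 / 8 * (√E.radius * κ) + C / (2 * z ^ 2) := by
      rw [hBκ, hw, ← hz3]
      field_simp
      ring
    calc E.loiterLength m / m * (1 / 2) * z
        ≤ (E.extendedArea / E.width m + C) / m * (1 / 2) * z := by gcongr
      _ ≤ _ := by rw [h5]; linarith
  have hsecond : 1.0302 * √(E.radius * E.width m / 2) * z ≤ 0.7286 * (√E.radius * κ) := by
    calc 1.0302 * √(E.radius * E.width m / 2) * z
        ≤ 1.0302 * (0.7072 * (√E.radius * (κ / z))) * z := by gcongr
      _ = 1.0302 * 0.7072 * (√E.radius * κ) := by field_simp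
      _ ≤ 0.7286 * (√E.radius * κ) := by
          gcongr
          norm_num
  have h6 : (E.loiterLength m / m / E.speed * (1 / 2) +
      1.0302 * √(E.radius * E.width m / 2) / E.speed) * z =
      (E.loiterLength m / m * (1 / 2) * z + 1.0302 * √(E.radius * E.width m / 2) * z) / E.speed := by
    field_simp
  rw [h6, div_mul_eq_mul_div (1.238 : ℝ)]
  refine div_le_div_of_nonneg_right ?_ hv.le
  have h7 : 0 < √E.radius * κ := by positivity
  norm_num at hfirst hsecond hRHS ⊢
  linarith

/-! ### The lower bound on the optimal cost -/

/-- The motion of a double integrator over a short time is predicted, up to an error that is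
quadratic in time, by its motion shortly before. -/
theorem IsDIMotion.norm_extrapolation_le {E : Setting} {x : ℝ → Plane} (hx : IsDIMotion E x)
    {h t₀ t : ℝ} (hh : 0 < h) (h0 : h ≤ t₀) (h1 : t₀ ≤ t) (h2 : t ≤ t₀ + 2 * h) :
    ‖x t - x t₀ - ((t - t₀) / h) • (x t₀ - x (t₀ - h))‖ ≤ 6 * E.umax * h ^ 2 ∧
      ‖x t₀ - x (t₀ - h)‖ ≤ E.vmax * h := by
  obtain ⟨v, u, hu, hub, hvb, hxv⟩ := hx
  have hui : ∀ a b, IntervalIntegrable u volume a b := fun a b =>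
    IntervalIntegrable.mono_fun' (g := fun _ => E.umax) (by simp) hu.aestronglyMeasurable
      (Eventually.of_forall hub)
  have hvd : ∀ a b, 0 ≤ a → 0 ≤ b → v b - v a = ∫ s in a..b, u s := by
    intro a b ha hb
    rw [(hxv a ha).2, (hxv b hb).2, add_sub_add_left_eq_sub]
    exact intervalIntegral.integral_interval_sub_left (hui _ _) (hui _ _)
  have hvlip : ∀ a b, 0 ≤ a → 0 ≤ b → ‖v b - v a‖ ≤ E.umax * |b - a| := by
    intro a b ha hb
    rw [hvd a b ha hb]
    exact intervalIntegral.norm_integral_le_of_norm_le_const fun s _ => hub s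
  have hvc : ContinuousOn v (Set.Ici 0) := by
    have hl : LipschitzOnWith (Real.toNNReal E.umax) v (Set.Ici 0) := by
      refine LipschitzOnWith.of_dist_le_mul fun a ha b hb => ?_
      rw [dist_eq_norm, Real.coe_toNNReal _ E.umax_pos.le, Real.dist_eq]
      exact hvlip b a hb ha
    exact hl.continuousOn
  have hvi : ∀ a b, 0 ≤ a → 0 ≤ b → IntervalIntegrable v volume a b := fun a b ha hb =>
    (hvc.mono fun s hs => (le_min ha hb).trans hs.1).intervalIntegrable
  have hxd : ∀ a b, 0 ≤ a → 0 ≤ b → x b - x a = ∫ s in a..b, v s := by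
    intro a b ha hb
    rw [(hxv a ha).1, (hxv b hb).1, add_sub_add_left_eq_sub]
    exact intervalIntegral.integral_interval_sub_left (hvi _ _ le_rfl hb) (hvi _ _ le_rfl ha)
  have ht0 : 0 ≤ t₀ := by linarith
  have key : ∀ a b δ, 0 ≤ a → a ≤ b → (∀ s ∈ Set.uIoc a b, |s - t₀| ≤ δ) →
      ‖x b - x a - (b - a) • v t₀‖ ≤ E.umax * δ * (b - a) := by
    intro a b δ ha hab hδ
    have h3 : x b - x a - (b - a) • v t₀ = ∫ s in a..b, (v s - v t₀) := by
      rw [intervalIntegral.integral_sub (hvi a b ha (ha.trans hab)) (by simp),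
        hxd a b ha (ha.trans hab), intervalIntegral.integral_const]
    rw [h3]
    have h4 := intervalIntegral.norm_integral_le_of_norm_le_const (a := a) (b := b)
      (f := fun s => v s - v t₀) (C := E.umax * δ) fun s hs => by
        have hs' : 0 ≤ s := by
          rw [Set.uIoc_of_le hab] at hs
          exact ha.trans hs.1.le
        exact (hvlip t₀ s ht0 hs').trans (mul_le_mul_of_nonneg_left (hδ s hs) E.umax_pos.le)
    rwa [abs_of_nonneg (by linarith)] at h4
  have hU := E.umax_pos
  constructor
  -- Of the 6 units of umax·h², 4 come from the deviation from the tangent after `t₀`. The other 2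
  -- come from replacing the velocity by a difference quotient, whose error is extrapolated over at
  -- most twice the step.
  · have k1 := key t₀ t (2 * h) ht0 h1 (fun s hs => by
      rw [Set.uIoc_of_le h1] at hs
      rw [abs_of_nonneg (by linarith [hs.1])]
      linarith [hs.2])
    have k2 := key (t₀ - h) t₀ h (by linarith) (by linarith) (fun s hs => by
      rw [Set.uIoc_of_le (by linarith)] at hs
      rw [abs_of_nonpos (by linarith [hs.2])]
      linarith [hs.1])
    rw [sub_sub_cancel] at k2
    have h5 : x t - x t₀ - ((t - t₀) / h) • (x t₀ - x (t₀ - h)) =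
        (x t - x t₀ - (t - t₀) • v t₀) - ((t - t₀) / h) • (x t₀ - x (t₀ - h) - h • v t₀) := by
      rw [smul_sub ((t - t₀) / h) (x t₀ - x (t₀ - h)), smul_smul, div_mul_cancel₀ _ hh.ne']
      abel
    have h6 : 0 ≤ (t - t₀) / h := div_nonneg (by linarith) hh.le
    have h7 : (t - t₀) / h ≤ 2 := by rw [div_le_iff₀ hh]; linarith
    rw [h5]
    refine (norm_sub_le _ _).trans ?_
    rw [norm_smul, Real.norm_of_nonneg h6]
    have h8 : (t - t₀) / h * ‖x t₀ - x (t₀ - h) - h • v t₀‖ ≤ 2 * (E.umax * h * h) := by gcongr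
    have h9 : E.umax * (2 * h) * (t - t₀) ≤ E.umax * (2 * h) * (2 * h) := by
      gcongr; linarith
    nlinarith
  · rw [hxd (t₀ - h) t₀ (by linarith) ht0]
    have h4 := intervalIntegral.norm_integral_le_of_norm_le_const (a := t₀ - h) (b := t₀)
      (f := v) (C := E.vmax) fun s hs => by
        rw [Set.uIoc_of_le (by linarith)] at hs
        exact hvb s (by linarith [hs.1])
    rwa [sub_sub_cancel, abs_of_pos hh] at h4

/-- One of the points on which a covering of the reachable set of robot `i` after time `k * h` is
centred. -/
def centre {E : Setting} {m : ℕ} (π : Policy E m) (h : ℝ) (M : ℕ) (i : Fin m) (l k : ℕ)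
    (ω : RequestSeq) : Plane :=
  π.pos ω i (k * h) + ((l : ℝ) / M) • (π.pos ω i (k * h) - π.pos ω i ((k * h) - h))

/-- Extrapolation costs 6·umax·h². Rounding to one of the equally spaced centres costs at most
vmax·h/M ≤ umax·h² more. The factor 2 in `2 * M` reflects the time span 2h. -/
theorem exists_dist_centre_le {E : Setting} {m : ℕ} (π : Policy E m) {ω : RequestSeq}
    (hω : ω.Proper E) {h t : ℝ} (hh : 0 < h) {M k : ℕ} (hM : E.vmax / (E.umax * h) ≤ M) (hk : 1 ≤ k)
    (h1 : k * h ≤ t) (h2 : t ≤ k * h + 2 * h) (i : Fin m) :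
    ∃ l ∈ Finset.range (2 * M + 1), dist (π.pos ω i t) (centre π h M i l k ω) ≤
      7 * E.umax * h ^ 2 := by
  have hU := E.umax_pos
  have hV := E.vmax_pos
  have hM0 : (0 : ℝ) < M := lt_of_lt_of_le (by positivity) hM
  have hk' : h ≤ k * h := by
    have : (1 : ℝ) ≤ k := by exact_mod_cast hk
    nlinarith
  obtain ⟨e1, e2⟩ := (π.isDIMotion ω hω i).norm_extrapolation_le hh hk' h1 h2
  set s := (t - k * h) / h with hs
  have hs0 : 0 ≤ s := div_nonneg (by linarith) hh.le
  have hs2 : s ≤ 2 := by rw [hs, div_le_iff₀ hh]; linarith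
  have hsM : 0 ≤ s * M := by positivity
  have hl1 := Nat.floor_le hsM
  have hl2 := Nat.lt_floor_add_one (s * M)
  refine ⟨⌊s * M⌋₊, ?_, ?_⟩
  · rw [Finset.mem_range, Nat.lt_succ_iff]
    apply Nat.floor_le_of_le
    push_cast
    gcongr
  · set d := π.pos ω i (k * h) - π.pos ω i (k * h - h)
    have h3 : π.pos ω i t - centre π h M i ⌊s * M⌋₊ k ω =
        (π.pos ω i t - π.pos ω i (k * h) - s • d) + (s - (⌊s * M⌋₊ : ℝ) / M) • d := by
      rw [sub_smul]
      unfold centre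
      abel
    have h4 : 0 ≤ s - (⌊s * M⌋₊ : ℝ) / M := by
      rw [sub_nonneg, div_le_iff₀ hM0]; exact hl1
    have h5 : s - (⌊s * M⌋₊ : ℝ) / M ≤ 1 / M := by
      rw [sub_le_iff_le_add, ← add_div, le_div_iff₀ hM0]; linarith
    rw [dist_eq_norm, h3]
    refine (norm_add_le _ _).trans ?_
    rw [norm_smul, Real.norm_of_nonneg h4]
    have h6 : (s - (⌊s * M⌋₊ : ℝ) / M) * ‖d‖ ≤ 1 / M * (E.vmax * h) := by gcongr
    have h7 : 1 / M * (E.vmax * h) ≤ E.umax * h ^ 2 := by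
      rw [div_le_iff₀ (by positivity)] at hM
      rw [one_div, inv_mul_le_iff₀ hM0]
      nlinarith
    linarith

/-- The number of the time interval of length `h` in which request `j` appears. -/
def slot (h : ℝ) (j : ℕ) (ω : RequestSeq) : ℕ := ⌈ω.arrival j / h⌉₊ - 1

/-- The ceiling minus one gives a grid time strictly before the arrival, when the motion cannot
depend on the new location yet. That it is at least 1 leaves room for the difference quotient over
the preceding step. -/
theorem slot_bounds {h : ℝ} (hh : 0 < h) {j : ℕ} {ω : RequestSeq} (hj : h < ω.arrival j) :
    1 ≤ slot h j ω ∧ slot h j ω * h < ω.arrival j ∧ ω.arrival j ≤ slot h j ω * h + h := by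
  have h1 : 1 < ω.arrival j / h := by rwa [one_lt_div hh]
  have h2 : 1 < ⌈ω.arrival j / h⌉₊ := by
    rw [Nat.lt_ceil]; exact_mod_cast h1
  have h3 : ((slot h j ω : ℕ) : ℝ) = ⌈ω.arrival j / h⌉₊ - 1 := by
    unfold slot
    rw [Nat.cast_sub h2.le]; simp
  refine ⟨by unfold slot; omega, ?_, ?_⟩
  · rw [h3, ← lt_div_iff₀ hh]
    linarith [Nat.ceil_lt_add_one (show 0 ≤ ω.arrival j / h by linarith)]
  · rw [h3, show ((⌈ω.arrival j / h⌉₊ : ℝ) - 1) * h + h = ⌈ω.arrival j / h⌉₊ * h by ring,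
      ← div_le_iff₀ hh]
    exact Nat.le_ceil _

theorem measurable_slot (h : ℝ) (j : ℕ) : Measurable (slot h j) := by
  unfold slot
  exact (measurable_from_nat (f := fun n => n - 1)).comp
    (Nat.measurable_ceil.comp ((RequestSeq.measurable_arrival j).div_const h))

/-! ### The location of a request is independent of the motion before it -/

section

variable {E : Setting} {m : ℕ} (π : Policy E m) (h : ℝ) (M : ℕ) (j : ℕ)

/-- The request sequence in which the location of request `j` is replaced by the origin. -/
def forget (j : ℕ) (ω : RequestSeq) : RequestSeq := Function.update ω j (ω.gap j, 0)

theorem gap_forget (ω : RequestSeq) (k : ℕ) : (forget j ω).gap k = ω.gap k := by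
  unfold forget RequestSeq.gap
  by_cases hk : k = j
  · subst hk; simp
  · rw [Function.update_of_ne hk]

theorem arrival_forget (ω : RequestSeq) (k : ℕ) : (forget j ω).arrival k = ω.arrival k := by
  unfold RequestSeq.arrival
  simp only [gap_forget]

theorem proper_forget {ω : RequestSeq} (hω : ω.Proper E) : (forget j ω).Proper E := by
  refine ⟨fun k => by rw [gap_forget]; exact hω.1 k, fun k => ?_, ?_⟩
  · by_cases hk : k = j
    · subst hk
      intro i
      simp [forget, RequestSeq.loc, E.side_pos.le]
    · unfold forget RequestSeq.loc
      rw [Function.update_of_ne hk]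
      exact hω.2.1 k
  · simp only [funext (arrival_forget j ω)]
    exact hω.2.2

theorem measurable_forget : Measurable (forget j) := by
  rw [measurable_pi_iff]
  intro k
  by_cases hk : k = j
  · subst hk
    simp only [forget, Function.update_self]
    exact (RequestSeq.measurable_gap k).prodMk measurable_const
  · simp only [forget, Function.update_of_ne hk]
    exact measurable_pi_apply k

theorem forget_update (ω : RequestSeq) (g : ℝ) (q : Plane) :
    forget j (Function.update ω j (g, q)) = Function.update ω j (g, 0) := by
  simp [forget, RequestSeq.gap]

/-- Before request `j` appears, the motion does not depend on its location. -/
theorem pos_forget {ω : RequestSeq} (hω : ω.Proper E) {t : ℝ} (ht : 0 ≤ t) (htj : t < ω.arrival j)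
    (i : Fin m) : π.pos (forget j ω) i t = π.pos ω i t := by
  refine (π.causal ω (forget j ω) hω (proper_forget j hω) t ht (fun k hk => ?_) i).symm
  rw [arrival_forget, or_self] at hk
  have : k ≠ j := fun hkj => by subst hkj; linarith
  rw [forget, Function.update_of_ne this]

/-- Positions are assumed to be measurable only at fixed times; restriction to grid times leaves
countably many cases. -/
theorem measurable_centre (i : Fin m) (l : ℕ) :
    Measurable fun ω => centre π h M i l (slot h j ω) ω := by
  have h1 : ∀ k : ℕ, Measurable fun ω => centre π h M i l k ω := by
    intro k
    unfold centre
    have hd : Measurable fun ω => π.pos ω i (k * h) - π.pos ω i (k * h - h) :=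
      (π.measurable i _).sub (π.measurable i _)
    exact (π.measurable i _).add (hd.fun_const_smul _)
  have h2 := measurable_from_prod_countable_left
    (f := fun p : RequestSeq × ℕ => centre π h M i l p.2 p.1) h1
  exact h2.fun_comp (measurable_id.prodMk (measurable_slot h j))

/-- The event that request `j` appears close to one of the points that can be reached quickly. -/
def nearEvent : Set RequestSeq :=
  {ω | ∃ i : Fin m, ∃ l ∈ Finset.range (2 * M + 1),
    dist (ω.loc j) (centre π h M i l (slot h j (forget j ω)) (forget j ω)) ≤ 7 * E.umax * h ^ 2}

theorem measurableSet_nearEvent : MeasurableSet (nearEvent π h M j) := by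
  have : nearEvent π h M j = ⋃ i : Fin m, ⋃ l ∈ Finset.range (2 * M + 1), {ω : RequestSeq |
      dist (ω.loc j) (centre π h M i l (slot h j (forget j ω)) (forget j ω)) ≤
        7 * E.umax * h ^ 2} := by
    ext ω
    simp [nearEvent]
  rw [this]
  refine MeasurableSet.iUnion fun i => Finset.measurableSet_biUnion _ fun l _ =>
    measurableSet_le ((RequestSeq.measurable_loc j).dist ?_) measurable_const
  exact (measurable_centre π h M j i l).fun_comp (measurable_forget j)

/-- The centres are computed after forgetting the location of request `j`. Given all other data they
are fixed while the location is uniform, so the probability is at most the total area of the discs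
divided by that of the square. -/
theorem requestLaw_nearEvent_le {r : ℝ} (hr : 0 < r) : requestLaw E r (nearEvent π h M j) ≤
    ENNReal.ofReal (m * (2 * M + 1) * ((7 * E.umax * h ^ 2) ^ 2 * Real.pi / E.area)) := by
  have := isProbabilityMeasure_expMeasure hr
  have := isProbabilityMeasure_requestLaw E hr
  have hA := E.area_pos
  rw [← lintegral_indicator_one (measurableSet_nearEvent π h M j),
    lintegral_requestLaw hr j (measurable_one.indicator (measurableSet_nearEvent π h M j))]
  set b := ENNReal.ofReal (m * (2 * M + 1) * ((7 * E.umax * h ^ 2) ^ 2 * Real.pi / E.area)) with hb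
  have key : ∀ ω : RequestSeq, ∀ g : ℝ, ∫⁻ q, (nearEvent π h M j).indicator 1
      (Function.update ω j (g, q)) ∂E.uniformLaw ≤ b := by
    intro ω g
    set ω' := Function.update ω j (g, (0 : Plane))
    set S : Set Plane := ⋃ i : Fin m, ⋃ l ∈ Finset.range (2 * M + 1),
      Metric.closedBall (centre π h M i l (slot h j ω') ω') (7 * E.umax * h ^ 2) with hS
    have hSm : MeasurableSet S := MeasurableSet.iUnion fun i =>
      Finset.measurableSet_biUnion _ fun l _ => measurableSet_closedBall
    have h1 : ∀ q : Plane, (nearEvent π h M j).indicator (1 : RequestSeq → ℝ≥0∞)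
        (Function.update ω j (g, q)) = S.indicator 1 q := by
      intro q
      have h2 : Function.update ω j (g, q) ∈ nearEvent π h M j ↔ q ∈ S := by
        simp only [nearEvent, Set.mem_ofPred_eq, forget_update, hS, Set.mem_iUnion,
          Metric.mem_closedBall, exists_prop]
        have h3 : RequestSeq.loc (Function.update ω j (g, q)) j = q := by
          unfold RequestSeq.loc; rw [Function.update_self]
        rw [h3]
      by_cases hq : q ∈ S
      · rw [Set.indicator_of_mem hq, Set.indicator_of_mem (h2.2 hq)]; rfl
      · rw [Set.indicator_of_notMem hq, Set.indicator_of_notMem fun h3 => hq (h2.1 h3)]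
    simp only [h1]
    rw [lintegral_indicator_one hSm]
    have hball : ∀ z : Plane, volume (Metric.closedBall z (7 * E.umax * h ^ 2)) =
        ENNReal.ofReal ((7 * E.umax * h ^ 2) ^ 2 * Real.pi) := by
      intro z
      have hU := E.umax_pos
      have h3 : 0 ≤ 7 * E.umax * h ^ 2 := by positivity
      rw [EuclideanSpace.volume_closedBall_fin_two,
        ENNReal.ofReal_mul (p := (7 * E.umax * h ^ 2) ^ 2) (sq_nonneg _), ENNReal.ofReal_pow h3,
        ← NNReal.coe_real_pi, ENNReal.ofReal_coe_nnreal]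
    have hvol : volume S ≤
        ENNReal.ofReal (m * (2 * M + 1) * ((7 * E.umax * h ^ 2) ^ 2 * Real.pi)) := by
      refine (measure_iUnion_le _).trans ?_
      rw [tsum_fintype]
      have h4 : ∀ i : Fin m, volume (⋃ l ∈ Finset.range (2 * M + 1),
          Metric.closedBall (centre π h M i l (slot h j ω') ω') (7 * E.umax * h ^ 2)) ≤
          (2 * M + 1 : ℕ) * ENNReal.ofReal ((7 * E.umax * h ^ 2) ^ 2 * Real.pi) := by
        intro i
        refine (measure_biUnion_finset_le _ _).trans ?_
        simp [hball]
      refine (Finset.sum_le_sum fun i _ => h4 i).trans ?_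
      rw [Finset.sum_const, Finset.card_univ, Fintype.card_fin, nsmul_eq_mul,
        mul_assoc (m : ℝ) (2 * M + 1), ENNReal.ofReal_mul (p := (m : ℝ)) (Nat.cast_nonneg _),
        ENNReal.ofReal_natCast, ENNReal.ofReal_mul (p := 2 * (M : ℝ) + 1) (by positivity)]
      gcongr
      rw [← ENNReal.ofReal_natCast]
      push_cast
      exact le_rfl
    refine (E.uniformLaw_le S).trans ((ENNReal.div_le_div_right hvol _).trans ?_)
    rw [← ENNReal.ofReal_div_of_pos hA, hb]
    apply le_of_eq
    congr 1
    ring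
  calc ∫⁻ ω, ∫⁻ q, ∫⁻ g, (nearEvent π h M j).indicator 1 (Function.update ω j (g, q))
        ∂expMeasure r ∂E.uniformLaw ∂requestLaw E r
      = ∫⁻ ω, ∫⁻ g, ∫⁻ q, (nearEvent π h M j).indicator 1 (Function.update ω j (g, q))
        ∂E.uniformLaw ∂expMeasure r ∂requestLaw E r := by
        congr 1; ext ω
        apply lintegral_lintegral_swap
        apply Measurable.aemeasurable
        have h5 : Measurable fun p : Plane × ℝ => Function.update ω j (p.2, p.1) :=
          (measurable_update ω).comp (measurable_snd.prodMk measurable_fst)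
        exact (measurable_one.indicator (measurableSet_nearEvent π h M j)).fun_comp h5
    _ ≤ ∫⁻ _, ∫⁻ _, b ∂expMeasure r ∂requestLaw E r :=
        lintegral_mono fun ω => lintegral_mono fun g => key ω g
    _ = b := by simp

/-- A request that does not appear close to the points that can be reached quickly has to wait. -/
theorem le_waitTime {h : ℝ} (hh : 0 < h) {M : ℕ} (hM : E.vmax / (E.umax * h) ≤ M) {j : ℕ}
    {ω : RequestSeq} (hω : ω.Proper E) (hj : h < ω.arrival j) (hn : ω ∉ nearEvent π h M j) :
    ENNReal.ofReal h ≤ π.waitTime j ω := by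
  refine le_iInf₂ fun t ht => ?_
  obtain ⟨ht, i, hi⟩ := ht
  by_contra! hlt
  have h1 := (ENNReal.ofReal_lt_ofReal_iff hh).1 hlt
  obtain ⟨hk1, hk2, hk3⟩ := slot_bounds hh hj
  have hslot : slot h j (forget j ω) = slot h j ω := by unfold slot; rw [arrival_forget]
  set k := slot h j ω
  -- The request appears within h of the grid time and is assumed to be fulfilled within h of its
  -- appearance; hence the horizon 2h.
  obtain ⟨l, hl, hd⟩ := exists_dist_centre_le π hω hh hM hk1 (t := t) (by linarith) (by linarith) i
  refine hn ⟨i, l, hl, ?_⟩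
  have hkh : h ≤ k * h := by
    have : (1 : ℝ) ≤ k := by exact_mod_cast hk1
    nlinarith
  have h2 : centre π h M i l k (forget j ω) = centre π h M i l k ω := by
    unfold centre
    rw [pos_forget π j hω (by linarith) hk2, pos_forget π j hω (by linarith) (by linarith)]
  rw [hslot, h2, ← hi]
  exact hd

/-- The wait is at least h except on two events: a first request so early that no past is available
for extrapolation, which becomes negligible as the rate tends to 0, and a location close to one of
the centres. -/
theorem ofReal_le_expectedWait {h : ℝ} (hh : 0 < h) {M : ℕ} (hM : E.vmax / (E.umax * h) ≤ M)
    (j : ℕ) {r : ℝ} (hr : 0 < r) : ENNReal.ofReal h ≤ π.expectedWait j r +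
      (ENNReal.ofReal h * ENNReal.ofReal (r * (2 * h)) + ENNReal.ofReal h *
        ENNReal.ofReal (m * (2 * M + 1) * ((7 * E.umax * h ^ 2) ^ 2 * Real.pi / E.area))) := by
  have := isProbabilityMeasure_requestLaw E hr
  have hnm := measurableSet_nearEvent π h M j
  set early : Set RequestSeq := {ω | ω.gap 0 < 2 * h}
  have hem : MeasurableSet early := measurableSet_lt (RequestSeq.measurable_gap 0) measurable_const
  have heP : requestLaw E r early ≤ ENNReal.ofReal (r * (2 * h)) := by
    have := requestLaw_gap_lt_le (E := E) hr (show 0 ≤ 2 * h by linarith) 1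
    simpa [early] using this
  have hae : ∀ᵐ ω ∂requestLaw E r, ENNReal.ofReal h ≤ π.waitTime j ω +
      (early.indicator (fun _ => ENNReal.ofReal h) ω +
        (nearEvent π h M j).indicator (fun _ => ENNReal.ofReal h) ω) := by
    filter_upwards [ae_proper (E := E) hr] with ω hω
    by_cases h1 : ω ∈ early
    · rw [Set.indicator_of_mem h1]
      exact le_add_left le_self_add
    by_cases h2 : ω ∈ nearEvent π h M j
    · rw [Set.indicator_of_mem h2]
      exact le_add_left le_add_self
    · refine (le_waitTime π hh hM hω ?_ h2).trans le_self_add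
      have h3 : 2 * h ≤ ω.gap 0 := not_lt.1 h1
      have h4 := hω.arrival_strictMono.monotone (Nat.zero_le j)
      rw [RequestSeq.arrival_zero] at h4
      linarith
  have hme : Measurable fun ω => early.indicator (fun _ => ENNReal.ofReal h) ω +
      (nearEvent π h M j).indicator (fun _ => ENNReal.ofReal h) ω :=
    (measurable_const.indicator hem).add (measurable_const.indicator hnm)
  calc ENNReal.ofReal h = ∫⁻ _, ENNReal.ofReal h ∂requestLaw E r := by simp
    _ ≤ _ := lintegral_mono_ae hae
    _ = π.expectedWait j r + (ENNReal.ofReal h * requestLaw E r early +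
          ENNReal.ofReal h * requestLaw E r (nearEvent π h M j)) := by
        rw [lintegral_add_right _ hme, lintegral_add_left (measurable_const.indicator hem),
          lintegral_indicator_const hem, lintegral_indicator_const hnm]
        rfl
    _ ≤ _ := by
        gcongr
        exact requestLaw_nearEvent_le π h M j hr

theorem ofReal_le_coverageCost {T : ℝ≥0∞} (hT : π.HasCoverageCost T) {h : ℝ} (hh : 0 < h) {M : ℕ}
    (hM : E.vmax / (E.umax * h) ≤ M) : ENNReal.ofReal h ≤ T + ENNReal.ofReal h *
        ENNReal.ofReal (m * (2 * M + 1) * ((7 * E.umax * h ^ 2) ^ 2 * Real.pi / E.area)) := by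
  obtain ⟨τ, h1, h2⟩ := hT
  set p := ENNReal.ofReal h *
    ENNReal.ofReal (m * (2 * M + 1) * ((7 * E.umax * h ^ 2) ^ 2 * Real.pi / E.area))
  have h3 : ∀ j, ENNReal.ofReal h ≤ τ j + p := by
    intro j
    have h4 : Tendsto (fun r : ℝ => ENNReal.ofReal h * ENNReal.ofReal (r * (2 * h)))
        (𝓝[>] 0) (𝓝 0) := by
      have h5 : Continuous fun r : ℝ => ENNReal.ofReal (r * (2 * h)) :=
        ENNReal.continuous_ofReal.comp (by fun_prop)
      have h6 := ENNReal.Tendsto.const_mul (a := ENNReal.ofReal h)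
        ((h5.tendsto 0).mono_left (nhdsWithin_le_nhds (s := Set.Ioi 0)))
        (Or.inr ENNReal.ofReal_ne_top)
      simpa using h6
    have h7 := (h1 j).add (h4.add (tendsto_const_nhds (x := p)))
    rw [zero_add] at h7
    refine ge_of_tendsto h7 ?_
    filter_upwards [self_mem_nhdsWithin] with r hr
    exact ofReal_le_expectedWait π hh hM j hr
  exact ge_of_tendsto' (h2.add tendsto_const_nhds) h3

end

/-- For h ≤ vmax/umax there are at most 5·vmax/(umax·h) discs per robot, of area 49π·umax²·h⁴ each.
The probability of being close is thus at most 245π·umax·vmax·mh³/A, and the constant 490 in `a`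
makes this 1/2. -/
theorem eventually_le_optimalCost (E : Setting) : ∃ c : ℝ, 0 < c ∧ ∀ᶠ m : ℕ in atTop,
    ENNReal.ofReal (c * (m : ℝ) ^ (-1 / 3 : ℝ)) ≤ optimalCost E m := by
  have hU := E.umax_pos
  have hV := E.vmax_pos
  have hA := E.area_pos
  have hπ := Real.pi_pos
  set a := (E.area / (490 * Real.pi * E.umax * E.vmax)) ^ (1 / 3 : ℝ) with ha
  have ha0 : 0 < a := by positivity
  have ha3 : a ^ 3 = E.area / (490 * Real.pi * E.umax * E.vmax) := by
    rw [ha, ← Real.rpow_natCast, ← Real.rpow_mul (by positivity)]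
    norm_num
  have hz : Tendsto (fun m : ℕ => (m : ℝ) ^ (1 / 3 : ℝ)) atTop atTop :=
    (tendsto_rpow_atTop (by norm_num)).comp tendsto_natCast_atTop_atTop
  have hx : Tendsto (fun m : ℕ => a / (m : ℝ) ^ (1 / 3 : ℝ)) atTop (𝓝 0) :=
    (tendsto_const_nhds (x := a)).div_atTop hz
  refine ⟨a / 2, half_pos ha0, ?_⟩
  filter_upwards [eventually_ge_atTop 1,
    hx.eventually (eventually_le_nhds (show 0 < E.vmax / E.umax by positivity))] with m hm hhV
  have hm' : (0 : ℝ) < m := by exact_mod_cast hm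
  have hz3 : ((m : ℝ) ^ (1 / 3 : ℝ)) ^ 3 = m := by
    rw [← Real.rpow_natCast, ← Real.rpow_mul hm'.le]
    norm_num
  have hz0 : 0 < (m : ℝ) ^ (1 / 3 : ℝ) := by positivity
  have hpow : (m : ℝ) ^ (-1 / 3 : ℝ) = 1 / (m : ℝ) ^ (1 / 3 : ℝ) := by
    rw [neg_div, Real.rpow_neg hm'.le, one_div, one_div]
  rw [hpow]
  set z := (m : ℝ) ^ (1 / 3 : ℝ)
  set h := a / z with hh
  have hh0 : 0 < h := by positivity
  have hh3 : m * h ^ 3 = E.area / (490 * Real.pi * E.umax * E.vmax) := by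
    rw [hh, div_pow, hz3, ha3]; field_simp
  refine le_sInf ?_
  rintro T ⟨π, hT⟩
  set M := ⌈E.vmax / (E.umax * h)⌉₊
  have hM1 : E.vmax / (E.umax * h) ≤ M := Nat.le_ceil _
  have hM2 : (M : ℝ) < E.vmax / (E.umax * h) + 1 := Nat.ceil_lt_add_one (by positivity)
  have h1 := ofReal_le_coverageCost π hT hh0 hM1
  have hM3 : (2 * M + 1 : ℝ) ≤ 5 * E.vmax / (E.umax * h) := by
    have h2 : 1 ≤ E.vmax / (E.umax * h) := by
      rw [le_div_iff₀ (by positivity)]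
      rw [le_div_iff₀ hU] at hhV
      linarith
    have h3 : 5 * E.vmax / (E.umax * h) = 5 * (E.vmax / (E.umax * h)) := by ring
    linarith
  have hp : m * (2 * M + 1) * ((7 * E.umax * h ^ 2) ^ 2 * Real.pi / E.area) ≤ 1 / 2 := by
    calc m * (2 * M + 1) * ((7 * E.umax * h ^ 2) ^ 2 * Real.pi / E.area)
        ≤ m * (5 * E.vmax / (E.umax * h)) * ((7 * E.umax * h ^ 2) ^ 2 * Real.pi / E.area) := by
          gcongr
      _ = m * h ^ 3 * (245 * Real.pi * E.umax * E.vmax / E.area) := by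
          field_simp
          norm_num
      _ = 1 / 2 := by
          rw [hh3]
          field_simp
          norm_num
  have h2 : ENNReal.ofReal h ≤ T + ENNReal.ofReal (h / 2) := by
    refine h1.trans ?_
    rw [← ENNReal.ofReal_mul hh0.le]
    gcongr
    nlinarith
  have h3 : ENNReal.ofReal h = ENNReal.ofReal (h / 2) + ENNReal.ofReal (h / 2) := by
    rw [← ENNReal.ofReal_add (by positivity) (by positivity), add_halves]
  rw [h3] at h2
  have h4 : a / 2 * (1 / z) = h / 2 := by rw [hh]; ring
  rw [h4]
  exact (ENNReal.add_le_add_iff_right ENNReal.ofReal_ne_top).1 h2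

theorem eventually_optimalCost_le (E : Setting) : ∃ C : ℝ, 0 < C ∧ ∀ᶠ m : ℕ in atTop,
    optimalCost E m ≤ ENNReal.ofReal (C * (m : ℝ) ^ (-1 / 3 : ℝ)) := by
  have hρ := E.radius_pos
  have hv := E.speed_pos
  have hA := E.area_pos
  refine ⟨1.238 / E.speed * (E.radius * E.area + 10.38 * E.radius ^ 2 * √E.area) ^ (1 / 3 : ℝ),
    by positivity, ?_⟩
  filter_upwards [eventually_ge_atTop 1, eventually_loiterCost_le E] with m hm h
  obtain ⟨π, hπ⟩ := exists_isStripLoitering E hm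
  have hm' : (0 : ℝ) < m := by exact_mod_cast hm
  have hle : optimalCost E m ≤ loiterCost E m := sInf_le ⟨π, hπ.hasCoverageCost hm⟩
  refine hle.trans ?_
  have hz0 : 0 < (m : ℝ) ^ (1 / 3 : ℝ) := by positivity
  have hpow : (m : ℝ) ^ (-1 / 3 : ℝ) = ((m : ℝ) ^ (1 / 3 : ℝ))⁻¹ := by
    rw [neg_div, Real.rpow_neg hm'.le]
  rw [hpow, ← div_eq_mul_inv, ENNReal.ofReal_div_of_pos hz0,
    ENNReal.le_div_iff_mul_le (Or.inl (ENNReal.ofReal_pos.2 hz0).ne') (Or.inl ENNReal.ofReal_ne_top)]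
  exact h

end StripLoitering

end

theorem mainTheorem3 (E : StripLoitering.Setting) :
    -- the algorithm can be implemented by any number of robots
    (∀ m : ℕ, 1 ≤ m →
      ∃ π : StripLoitering.Policy E m, StripLoitering.IsStripLoitering E m π) ∧
    -- the asymptotic upper bound on its coverage cost
    (∀ π : (m : ℕ) → StripLoitering.Policy E m,
      (∀ m : ℕ, 1 ≤ m → StripLoitering.IsStripLoitering E m (π m)) →
      ∃ T : ℕ → ℝ≥0∞, (∀ m : ℕ, 1 ≤ m → (π m).HasCoverageCost (T m)) ∧
        limsup (fun m : ℕ => T m * ENNReal.ofReal ((m : ℝ) ^ (1 / 3 : ℝ))) atTop ≤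
          ENNReal.ofReal (1.238 / E.speed *
            (E.radius * E.area + 10.38 * E.radius ^ 2 * √E.area) ^ (1 / 3 : ℝ))) ∧
    -- the optimal coverage cost is of order `m ^ (-1 / 3)`
    (∃ c C : ℝ, 0 < c ∧ 0 < C ∧ ∀ᶠ m : ℕ in atTop,
      ENNReal.ofReal (c * (m : ℝ) ^ (-1 / 3 : ℝ)) ≤ StripLoitering.optimalCost E m ∧
      StripLoitering.optimalCost E m ≤ ENNReal.ofReal (C * (m : ℝ) ^ (-1 / 3 : ℝ))) := by
  -- The coverage cost is the same for all implementing policies, so `loiterCost` works for every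
  -- family of them.
  refine ⟨fun m hm => StripLoitering.exists_isStripLoitering E hm, fun π hπ =>
    ⟨StripLoitering.loiterCost E, fun m hm => (hπ m hm).hasCoverageCost hm,
      limsup_le_of_le (by isBoundedDefault) (StripLoitering.eventually_loiterCost_le E)⟩, ?_⟩
  obtain ⟨c, hc, h1⟩ := StripLoitering.eventually_le_optimalCost E
  obtain ⟨C, hC, h2⟩ := StripLoitering.eventually_optimalCost_le E
  exact ⟨c, C, hc, hC, h1.and h2⟩
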